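/- Let $G$ be a connected real reductive Lie group with Cartan involution $\Theta$, maximal compact subgroup $K=G^{\Theta}$, Cartan decompositions $\mathfrak g=\mathfrak k\oplus\mathfrak p$ and $G\simeq K\times\exp(\mathfrak p)$, and an $\mathrm{Ad}(G)$- and $\Theta$-invariant non-degenerate symmetric bilinear form $b$ on $\mathfrak g$ such that $-b(X,\Theta Y)$ is a scalar product. Let $(M,\Omega_M)$ be a connected symplectic manifold with a Hamiltonian action of $G$: $G$ acts smoothly by symplectomorphisms, and the moment map $\Phi=\Phi^G_M:M\to\mathfrak g^*$ is smooth, $G$-equivariant and satisfies $\iota(X_M)\Omega_M=-d\langle\Phi,X\rangle$ for $X\in\mathfrak g$, where $X_M(m)=\frac{d}{ds}e^{-sX}\cdot m|_{s=0}$. Assume that the action of $G$ on $M$ is proper (for every compact $A\subset M$ the set $\{g\in G: gA\cap A\neq\emptyset\}$ is compact) and that $\Phi$ is a proper map. Let $\Phi^{\mathfrak p}_M:M\to\mathfrak p^*$ and $\Phi^K_M:M\to\mathfrak k^*$ be the compositions of $\Phi$ with the restriction maps to $\mathfrak p^*$ and $\mathfrak k^*$, and put $Y=(\Phi^{\mathfrak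 p}_M)^{-1}(0)$. Identify $\mathfrak k^*$ with the annihilator of $\mathfrak p$ in $\mathfrak g^*$. Then: 1. $Y$ is a $K$-invariant symplectic (embedded) submanifold of $M$. With $\Omega_Y=\Omega_M|_Y$, the action of $K$ on $(Y,\Omega_Y)$ is Hamiltonian, with proper moment map $\Phi^K_Y=\Phi^K_M|_Y$, which equals the restriction of $\Phi$ to $Y$. 2. Let $G\times_K Y$ be the quotient of $G\times Y$ by the action $k\cdot(g,y)=(gk^{-1},k\cdot y)$ of $K$; it is a smooth manifold such that $G\times Y\to G\times_KY$ is a submersion. It carries a symplectic form whose pull-back to $G\times Y$ is the $2$-form $\Omega_Y-d\langle\Phi^K_Y,\theta^K\rangle$, where $\theta^K\in\mathcal A^1(G)\otimes\mathfrak k$ is the composition of the left Maurer–Cartan form $\theta^G$, $\theta^G\big(\frac{d}{dt}ge^{tX}|_{t=0}\big)=X$, with the projection $\mathfrak g\to\mathfrak k$ along $\mathfrak p$. For this form the $G$-action $g'\cdot[g,y]=[g'g,y]$ is Hamiltonian, with moment map $[g,y]\mapsto \mathrm{Ad}^*(g)\,\Phi^K_Y(y)$. 3. The map $\pi:G\times_KY\to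 M$, $[g,y]\mapsto g\cdot y$, is a $G$-equivariant diffeomorphism of Hamiltonian $G$-manifolds: it pulls $\Omega_M$ back to the symplectic form of part 2, and $\Phi\circ\pi$ is the moment map of part 2. 4. $Y$ is connected (and non-empty). -/

import Mathlib

open scoped Manifold ContDiff

noncomputable section

namespace HamReductive

/-! ## Differential forms on manifolds without boundary -/

section Forms

variable {E : Type*} [NormedAddCommGroup E] [NormedSpace ℝ E] {H : Type*} [TopologicalSpace H]
  (I : ModelWithCorners ℝ E H)
  {E' : Type*} [NormedAddCommGroup E'] [NormedSpace ℝ E'] {H' : Type*} [TopologicalSpace H']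
  (I' : ModelWithCorners ℝ E' H')

/-- (Not necessarily smooth) differential `k`-forms on `N`. -/
abbrev DForm (N : Type*) [TopologicalSpace N] [ChartedSpace H N] (k : ℕ) : Type _ :=
  (x : N) → TangentSpace I x [⋀^Fin k]→L[ℝ] ℝ

variable {N : Type*} [TopologicalSpace N] [ChartedSpace H N]
  {N' : Type*} [TopologicalSpace N'] [ChartedSpace H' N'] {k : ℕ}

/-- The expression of a form in the preferred chart at `x₀`; it is meaningful on the target of
that chart, which is open since the manifolds considered here have no boundary. -/
def localRep (α : DForm I N k) (x₀ : N) : E → E [⋀^Fin k]→L[ℝ] ℝ := fun u =>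
  (α ((extChartAt I x₀).symm u)).compContinuousLinearMap
    (mfderiv 𝓘(ℝ, E) I (extChartAt I x₀).symm u)

/-- Smoothness of a form. -/
def SmoothForm (α : DForm I N k) : Prop :=
  ∀ x₀ : N, ContDiffOn ℝ ∞ (localRep I α x₀) (extChartAt I x₀).target

/-- Exterior derivative `d`, computed at `x` in the preferred chart at `x`. The convention is
`dα(V, W) = V α(W) - W α(V) - α([V, W])` for a `1`-form `α`. -/
def extD (α : DForm I N k) : DForm I N (k + 1) := fun x =>
  (extDeriv (localRep I α x) (extChartAt I x x)).compContinuousLinearMap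
    (mfderiv I 𝓘(ℝ, E) (extChartAt I x) x)

/-- Pull-back `f^* α`. -/
def pullbackForm (f : N → N') (α : DForm I' N' k) : DForm I N k := fun x =>
  (α (f x)).compContinuousLinearMap (mfderiv I I' f x)

/-- Symplectic forms: smooth closed non-degenerate `2`-forms. -/
structure IsSymplecticForm (α : DForm I N 2) : Prop where
  smooth : SmoothForm I α
  closed : ∀ x, extD I α x = 0
  nondegenerate : ∀ (x : N) (v : TangentSpace I x),
    (∀ w : TangentSpace I x, α x ![v, w] = 0) → v = 0

end Forms

/-! ## Lie groups

The Lie algebra of a Lie group `L` modelled on `E` is `T_1 L`, whose underlying vector space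
is `E`; accordingly its dual is `StrongDual ℝ E`. -/

section LieGroups

variable {E : Type*} [NormedAddCommGroup E] [NormedSpace ℝ E]
  {L : Type*} [TopologicalSpace L] [ChartedSpace E L] [Group L]

instance instLieGroupMinSmoothness [LieGroup 𝓘(ℝ, E) ∞ L] :
    LieGroup 𝓘(ℝ, E) (minSmoothness ℝ 3) L := by
  rw [minSmoothness_of_isRCLikeNormedField]; infer_instance

/-- The adjoint action `Ad(g)`. -/
def Ad (g : L) : E →L[ℝ] E :=
  (mfderiv 𝓘(ℝ, E) 𝓘(ℝ, E) (fun h : L => g * h * g⁻¹) (1 : L) :)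

/-- The coadjoint action, `⟨Ad^*(g) ξ, X⟩ = ⟨ξ, Ad(g⁻¹) X⟩`. -/
def coAd (g : L) (ξ : StrongDual ℝ E) : StrongDual ℝ E := ξ.comp (Ad g⁻¹)

/-- The left Maurer-Cartan form `θ^G`, with `θ^G (d/dt (g exp(tX))|₀) = X`. -/
def maurerCartan (g : L) : E →L[ℝ] E :=
  (mfderiv 𝓘(ℝ, E) 𝓘(ℝ, E) (fun h : L => g⁻¹ * h) g :)

/-- `γ` is the one-parameter subgroup of `L` with initial velocity `X`. -/
structure IsOneParam (γ : ℝ → L) (X : E) : Prop where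
  map_add : ∀ s t, γ (s + t) = γ s * γ t
  smooth : ContMDiff 𝓘(ℝ, ℝ) 𝓘(ℝ, E) ∞ γ
  velocity : (mfderiv 𝓘(ℝ, ℝ) 𝓘(ℝ, E) γ 0 (1 : ℝ) : E) = X

open Classical in
/-- The exponential map of a Lie group: `exp X = γ 1`, for the one-parameter subgroup `γ` with
velocity `X` (which exists and is unique for every `X`). -/
def lieExp (X : E) : L :=
  if h : ∃ γ : ℝ → L, IsOneParam γ X then h.choose 1 else 1

/-- The differential at `1` of a homomorphism from `L` to itself. -/
def lieDeriv (Θ : L →* L) : E →L[ℝ] E :=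
  (mfderiv 𝓘(ℝ, E) 𝓘(ℝ, E) Θ (1 : L) :)

/-- The `(-1)`-eigenspace `𝔭` of the differential of `Θ`. -/
def pSubspace (Θ : L →* L) : Submodule ℝ E :=
  LinearMap.ker ((lieDeriv Θ + ContinuousLinearMap.id ℝ E : E →L[ℝ] E) : E →ₗ[ℝ] E)

/-- The projection `X ↦ X_𝔨` of `𝔤 = 𝔨 ⊕ 𝔭` onto the `(+1)`-eigenspace `𝔨` along the
`(-1)`-eigenspace `𝔭` (it is orthogonal for the scalar product `-b(X, ΘY)`). -/
def kProj (Θ : L →* L) : E →L[ℝ] E :=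
  (2⁻¹ : ℝ) • (ContinuousLinearMap.id ℝ E + lieDeriv Θ)

end LieGroups

/-! ## Hamiltonian actions -/

section Hamiltonian

variable {E : Type*} [NormedAddCommGroup E] [NormedSpace ℝ E]
  {L : Type*} [TopologicalSpace L] [ChartedSpace E L] [Group L]
  {F : Type*} [NormedAddCommGroup F] [NormedSpace ℝ F]
  {N : Type*} [TopologicalSpace N] [ChartedSpace F N] [MulAction L N]

/-- The vector field `X_N(m) = d/ds (exp(-sX) • m)|₀` generated by `X`, i.e. minus the image of
`X` under the differential of `g ↦ g • m`. -/
def generator (X : E) (m : N) : TangentSpace 𝓘(ℝ, F) m :=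
  (-(mfderiv 𝓘(ℝ, E) 𝓘(ℝ, F) (fun g : L => g • m) (1 : L) X : F) : F)

variable (L) in
/-- `(N, Ω, Φ)` is a Hamiltonian `L`-manifold: `L` acts smoothly on the symplectic manifold
`(N, Ω)` by symplectomorphisms, and `Φ : N → 𝔩^*` is a moment map, that is, a smooth
`L`-equivariant map with `ι(X_N) Ω = - d⟨Φ, X⟩`. -/
structure IsHamiltonian (Ω : DForm 𝓘(ℝ, F) N 2) (Φ : N → StrongDual ℝ E) : Prop where
  symplectic : IsSymplecticForm 𝓘(ℝ, F) Ω
  smooth_action : ContMDiffSMul 𝓘(ℝ, E) 𝓘(ℝ, F) ∞ L N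
  invariant : ∀ g : L, pullbackForm 𝓘(ℝ, F) 𝓘(ℝ, F) (fun m : N => g • m) Ω = Ω
  smooth_moment : ContMDiff 𝓘(ℝ, F) 𝓘(ℝ, StrongDual ℝ E) ∞ Φ
  moment : ∀ (X : E) (m : N) (v : TangentSpace 𝓘(ℝ, F) m),
    Ω m ![generator (L := L) X m, v] =
      -(mfderiv 𝓘(ℝ, F) 𝓘(ℝ, ℝ) (fun m' : N => Φ m' X) m v : ℝ)
  equivariant : ∀ (g : L) (m : N), Φ (g • m) = coAd g (Φ m)

variable (L N) in
/-- The action is proper: for every compact `A ⊆ N`, the set of `g` with `g • A ∩ A ≠ ∅` is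
compact. -/
def ProperAction : Prop :=
  ∀ A : Set N, IsCompact A → IsCompact {g : L | ∃ a ∈ A, g • a ∈ A}

end Hamiltonian

/-! ## Real reductive groups and the bundle `G ×_K Y` -/

section Reductive

variable {E : Type*} [NormedAddCommGroup E] [NormedSpace ℝ E]
  {G : Type*} [TopologicalSpace G] [ChartedSpace E G] [Group G]
  {EK : Type*} [NormedAddCommGroup EK] [NormedSpace ℝ EK]

/-- The inclusion `𝔨 → 𝔤` of the Lie algebra of a Lie subgroup. -/
def lieIncl (K : Subgroup G) [ChartedSpace EK K] : EK →L[ℝ] E :=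
  (mfderiv 𝓘(ℝ, EK) 𝓘(ℝ, E) (Subtype.val : K → G) (1 : K) :)

/-- `G` is a real reductive Lie group, with Cartan involution `Θ`, maximal compact subgroup
`K = G^Θ` (with its structure of embedded Lie subgroup), and invariant form `b`. -/
structure IsRealReductive [CompleteSpace E] [LieGroup 𝓘(ℝ, E) ∞ G]
    (K : Subgroup G) [ChartedSpace EK K] (Θ : G →* G) (b : LinearMap.BilinForm ℝ E) : Prop where
  /-- `𝔤` is reductive: every ideal has a complementary ideal. -/
  reductive : ComplementedLattice (LieIdeal ℝ (GroupLieAlgebra 𝓘(ℝ, E) G))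
  smooth_involution : ContMDiff 𝓘(ℝ, E) 𝓘(ℝ, E) ∞ Θ
  involutive : ∀ g, Θ (Θ g) = g
  mem_K : ∀ g, g ∈ K ↔ Θ g = g
  compact_K : IsCompact (K : Set G)
  embedding_K : Manifold.IsSmoothEmbedding 𝓘(ℝ, EK) 𝓘(ℝ, E) ∞ (Subtype.val : K → G)
  /-- The Lie algebra of `K` is the `(+1)`-eigenspace. -/
  lie_K : ∀ X : E, X ∈ Set.range (lieIncl (E := E) (EK := EK) K) ↔ lieDeriv Θ X = X
  symm_form : ∀ X Z, b X Z = b Z X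
  nondegenerate_form : b.Nondegenerate
  invariant_form : ∀ (g : G) (X Z : E), b (Ad g X) (Ad g Z) = b X Z
  involution_form : ∀ X Z, b (lieDeriv Θ X) (lieDeriv Θ Z) = b X Z
  /-- `-b(X, ΘX)` is positive definite. -/
  pos_form : ∀ X, X ≠ 0 → 0 < -b X (lieDeriv Θ X)
  /-- Cartan decomposition: `K × 𝔭 → G`, `(k, X) ↦ k exp X`, is a diffeomorphism. -/
  cartan : ∃ C : Diffeomorph (𝓘(ℝ, EK).prod 𝓘(ℝ, pSubspace (E := E) Θ)) 𝓘(ℝ, E)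
      (K × pSubspace (E := E) Θ) G ∞,
    ∀ (k : K) (X : pSubspace (E := E) Θ), C (k, X) = (k : G) * lieExp (X : E)

/-- `Φ^K`, the composition of `Φ` with the restriction map `𝔤^* → 𝔨^*`. -/
def momentK {N : Type*} (K : Subgroup G) [ChartedSpace EK K] (Φ : N → StrongDual ℝ E) (m : N) :
    StrongDual ℝ EK :=
  (Φ m).comp (lieIncl K)

variable {M : Type*} [MulAction G M] {K : Subgroup G}

/-- Two points of `G × Y` are equivalent when they lie in the same orbit of the `K`-action
`k • (g, y) = (g k⁻¹, k • y)`. -/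
def assocSetoid (Y : SubMulAction K M) : Setoid (G × Y) where
  r p q := ∃ k : K, q.1 = p.1 * (k : G)⁻¹ ∧ q.2 = k • p.2
  iseqv :=
    { refl := fun p => ⟨1, by simp⟩
      symm := by
        rintro p q ⟨k, h₁, h₂⟩
        exact ⟨k⁻¹, by simp [h₁], by simp [h₂]⟩
      trans := by
        rintro p q r ⟨k, h₁, h₂⟩ ⟨l, h₃, h₄⟩
        exact ⟨l * k, by simp [h₁, h₃, mul_assoc], by simp [h₂, h₄, mul_smul]⟩ }

/-- `G ×_K Y`, with the quotient topology. -/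
abbrev Assoc (Y : SubMulAction K M) : Type _ := Quotient (assocSetoid Y)

/-- The quotient map `(g, y) ↦ [g, y]`. -/
def Assoc.mk (Y : SubMulAction K M) (p : G × Y) : Assoc Y := Quotient.mk (assocSetoid Y) p

/-- The action `g' • [g, y] = [g' g, y]`. -/
instance Assoc.instMulAction (Y : SubMulAction K M) : MulAction G (Assoc Y) where
  smul g := Quotient.map (fun p => (g * p.1, p.2)) (by
    rintro p q ⟨k, h₁, h₂⟩
    exact ⟨k, by simp [h₁, mul_assoc], h₂⟩)
  one_smul := by
    rintro ⟨p⟩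
    change Quotient.mk _ (1 * p.1, p.2) = Quotient.mk _ p
    simp
  mul_smul g g' := by
    rintro ⟨p⟩
    change Quotient.mk _ (g * g' * p.1, p.2) = Quotient.mk _ (g * (g' * p.1), p.2)
    rw [mul_assoc]

/-- The canonical map `π : G ×_K Y → M`, `[g, y] ↦ g • y`. -/
def Assoc.toM (Y : SubMulAction K M) : Assoc Y → M :=
  Quotient.lift (fun p => p.1 • (p.2 : M)) (by
    rintro p q ⟨k, h₁, h₂⟩
    simp only [h₁, h₂, SubMulAction.val_smul]
    rw [Subgroup.smul_def, smul_smul]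
    simp)

variable [TopologicalSpace M] {F : Type*} [NormedAddCommGroup F] [NormedSpace ℝ F]

/-- The `1`-form `⟨Φ^K_Y, θ^K⟩` on `G × Y`, whose value at `(g, y)` on `(V, v)` is
`⟨Φ(y), θ^K_g(V)⟩`, with `θ^K` the `𝔨`-component of the Maurer-Cartan form. -/
def thetaForm (Θ : G →* G) (Y : SubMulAction K M) [ChartedSpace F Y]
    (Φ : M → StrongDual ℝ E) : DForm (𝓘(ℝ, E).prod 𝓘(ℝ, F)) (G × Y) 1 := fun p =>
  ContinuousAlternatingMap.ofSubsingleton ℝ (E × F) ℝ (0 : Fin 1)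
    (((Φ (p.2 : M)).comp ((kProj Θ).comp (maurerCartan p.1))).comp
      (ContinuousLinearMap.fst ℝ E F))

end Reductive

end HamReductive

end

open HamReductive

/-!
Let `Φ^𝔭 = momentP Θ Φ` be the `𝔭`-component of `Φ`, so that `Y = {Φ^𝔭 = 0}`, and let `X_M` be the
vector field generated by `X`. Everything rests on one consequence of properness: for
`0 ≠ X ∈ 𝔭` the element `exp X` moves every value of `Φ`. Otherwise all the powers of `exp X` would
map some point into one compact fibre of `Φ`, so that they would stay in a compact subset of `G`;
but `exp : 𝔭 → G` is proper by the Cartan decomposition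
(`IsRealReductive.eq_zero_of_moment_lieExp_smul`). An infinitesimal form follows:
if `dΦ(X_M)` vanishes at a point, then `Φ` is constant along the curve `exp(tX) • m`, and `X = 0`
(`eq_zero_of_symplectic_eq_zero`). In both arguments below the condition `dΦ(X_M) = 0` only
has to be checked on `𝔭`, since, by the symmetry of the situation under `Θ`, the function
`t ↦ ⟨Φ(exp(tX) • m), W⟩` is even for `W ∈ 𝔨` (`eq_zero_of_moment_even`).

* *Transversality.* At `y ∈ Y` the map `𝔭 → 𝔭^*`, `X ↦ dΦ^𝔭(X_M)`, is injective, hence bijective.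
  So `Y` is a regular level set (`exists_submanifold_levelSet`), with
  `T_y M = T_y Y ⊕ {X_M(y) : X ∈ 𝔭}`; as `dΦ^𝔭` is given by `Ω`, the two summands are
  `Ω`-orthogonal and `Y` is symplectic (`isSymplecticForm_pullback_val`).
* *Every orbit meets `Y`.* On an orbit, the norm of `Φ` has a minimum, as `Φ` and the action are
  proper. Since `b(x, x)` is constant on the orbit, where `x` corresponds to `Φ` under `b`, the
  norm of the `𝔭`-component `x_𝔭` is minimal too. The derivative of `x` in the direction `Z` pairs
  with `W` to `Ω(W_M, Z_M)`, which is antisymmetric, so criticality in all directions of `𝔭` says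
  that `dΦ^𝔭` vanishes in the direction of `x_𝔭` itself, and `x_𝔭 = 0`
  (`moment_vanishes_of_minimal`, `exists_smul_moment_vanishes`).
* *In a single `K`-orbit.* If `y` and `exp(X) • y` lie in `Y`, then applying `Θ` shows
  `Φ(exp(X) • y) = Φ(exp(-X) • y)`, so that `exp(2X)` fixes the value `Φ(y)` and `X = 0`
  (`mem_of_moment_vanishes_smul`).

So `G ×_K Y → M` is bijective. By transversality the action map `G × Y → M` is a submersion, hence
open, and `G ×_K Y → M` is a homeomorphism (`exists_homeomorph_toM`). The manifold structure and
the Hamiltonian structure of `G ×_K Y` are those of `M`, transported along it, and it only remains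
to compute the pull-back of `Ω` to `G × Y` (`IsHamiltonian.pullbackForm_smul_val`). The value of
`d⟨Φ, θ⟩` on a right-invariant and a left-invariant vector field, together with
arbitrary vectors of `Y`, is read off from the surfaces `(s, t) ↦ (κ(s) g η(t), υ(s, t))`
(`extD_thetaForm_apply`), which needs neither Lie brackets nor the structure equation for `θ`.

Finally `Y` is connected, since `[g, y] ↦ κ(g) • y`, where `g ∈ exp(𝔭) κ(g)`, maps the connected
space `G ×_K Y` onto it (`isConnected_of_connectedSpace_assoc`).
-/

/-! ### Pull-backs of differential forms -/

section FormPullback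

open Filter Topology Set

variable {E : Type*} [NormedAddCommGroup E] [NormedSpace ℝ E] {H : Type*} [TopologicalSpace H]
  {I : ModelWithCorners ℝ E H}
  {E' : Type*} [NormedAddCommGroup E'] [NormedSpace ℝ E'] {H' : Type*} [TopologicalSpace H']
  {I' : ModelWithCorners ℝ E' H'}
  {E'' : Type*} [NormedAddCommGroup E''] [NormedSpace ℝ E''] {H'' : Type*} [TopologicalSpace H'']
  {I'' : ModelWithCorners ℝ E'' H''}
  {N : Type*} [TopologicalSpace N] [ChartedSpace H N]
  {N' : Type*} [TopologicalSpace N'] [ChartedSpace H' N']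
  {N'' : Type*} [TopologicalSpace N''] [ChartedSpace H'' N''] {k : ℕ}

theorem minSmoothness_two_le_infty : minSmoothness ℝ 2 ≤ (∞ : WithTop ℕ∞) := by
  rw [minSmoothness_of_isRCLikeNormedField]
  exact ENat.LEInfty.out

theorem DForm.compContinuousLinearMap_congr (α : DForm I' N' k) {y y' : N'} {D D' : E →L[ℝ] E'}
    (hy : y = y') (hD : D = D') :
    ((α y).compContinuousLinearMap D : E [⋀^Fin k]→L[ℝ] ℝ) =
      (α y').compContinuousLinearMap D' := by
  subst hy hD; rfl

theorem pullbackForm_congr_of_eventuallyEq (α : DForm I' N' k) {f f' : N → N'} {x : N}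
    (h : f =ᶠ[𝓝 x] f') : pullbackForm I I' f α x = pullbackForm I I' f' α x :=
  DForm.compContinuousLinearMap_congr (E := E) α h.eq_of_nhds h.mfderiv_eq

theorem pullbackForm_comp_apply (α : DForm I'' N'' k) {f : N → N'} {g : N' → N''} {x : N}
    (hg : MDifferentiableAt I' I'' g (f x)) (hf : MDifferentiableAt I I' f x) :
    pullbackForm I I'' (g ∘ f) α x = pullbackForm I I' f (pullbackForm I' I'' g α) x := by
  have := mfderiv_comp x hg hf
  exact (DForm.compContinuousLinearMap_congr (E := E) α rfl this).trans rfl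

theorem localRep_eq_pullbackForm (α : DForm I N k) (x₀ : N) :
    localRep I α x₀ = pullbackForm 𝓘(ℝ, E) I (extChartAt I x₀).symm α := rfl

theorem mdifferentiableAt_extChartAt_symm_of_mem [IsManifold I ∞ N] [I.Boundaryless] {x₀ : N}
    {u : E} (hu : u ∈ (extChartAt I x₀).target) :
    MDifferentiableAt 𝓘(ℝ, E) I (extChartAt I x₀).symm u :=
  ((contMDiffOn_extChartAt_symm (n := ∞) x₀).contMDiffAt
    ((isOpen_extChartAt_target x₀).mem_nhds hu)).mdifferentiableAt (by simp)

/-- In charts, the pull-back of a form by a smooth map is the pull-back by its coordinate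
expression. -/
theorem localRep_pullbackForm_eventuallyEq [IsManifold I ∞ N] [IsManifold I' ∞ N']
    [I.Boundaryless] [I'.Boundaryless] (α : DForm I' N' k) {f : N → N'}
    (hf : ContMDiff I I' ∞ f) {x₀ : N} {u : E} (hu : u ∈ (extChartAt I x₀).target) {x₁ : N'}
    (hx₁ : f ((extChartAt I x₀).symm u) ∈ (extChartAt I' x₁).source) :
    localRep I (pullbackForm I I' f α) x₀ =ᶠ[𝓝 u] fun w =>
      (localRep I' α x₁
        (((extChartAt I' x₁) ∘ f ∘ (extChartAt I x₀).symm) w)).compContinuousLinearMap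
        (fderiv ℝ ((extChartAt I' x₁) ∘ f ∘ (extChartAt I x₀).symm) w) := by
  have hc : ContinuousAt (f ∘ (extChartAt I x₀).symm) u :=
    hf.continuous.continuousAt.comp
      (mdifferentiableAt_extChartAt_symm_of_mem hu).continuousAt
  have hev : ∀ᶠ w in 𝓝 u, w ∈ (extChartAt I x₀).target ∧
      f ((extChartAt I x₀).symm w) ∈ (extChartAt I' x₁).source :=
    ((isOpen_extChartAt_target x₀).mem_nhds hu |> Filter.eventually_of_mem <| fun _ h => h).and
      (hc.eventually_mem ((isOpen_extChartAt_source x₁).mem_nhds hx₁))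
  filter_upwards [hev.eventually_nhds] with w hw
  obtain ⟨hw₁, hw₂⟩ := hw.self_of_nhds
  have hs := mdifferentiableAt_extChartAt_symm_of_mem (I := I) hw₁
  have hfw := (hf.mdifferentiable (by simp) ((extChartAt I x₀).symm w))
  have hF : MDifferentiableAt 𝓘(ℝ, E) 𝓘(ℝ, E')
      ((extChartAt I' x₁) ∘ f ∘ (extChartAt I x₀).symm) w :=
    (mdifferentiableAt_extChartAt (by simpa using hw₂)).comp w (hfw.comp w hs)
  rw [localRep_eq_pullbackForm, ← pullbackForm_comp_apply α hfw hs]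
  have hF₂ : ((extChartAt I' x₁) ∘ f ∘ (extChartAt I x₀).symm) w ∈ (extChartAt I' x₁).target :=
    (extChartAt I' x₁).map_source hw₂
  have e1 : f ∘ (extChartAt I x₀).symm =ᶠ[𝓝 w]
      (extChartAt I' x₁).symm ∘ ((extChartAt I' x₁) ∘ f ∘ (extChartAt I x₀).symm) := by
    filter_upwards [hw] with z hz
    simp only [Function.comp_apply, (extChartAt I' x₁).left_inv hz.2]
  rw [pullbackForm_congr_of_eventuallyEq α e1,
    pullbackForm_comp_apply α (mdifferentiableAt_extChartAt_symm_of_mem hF₂) hF]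
  rw [← mfderiv_eq_fderiv]
  rfl

theorem contDiffAt_chart_expression [IsManifold I ∞ N] [IsManifold I' ∞ N']
    [I.Boundaryless] {f : N → N'}
    (hf : ContMDiff I I' ∞ f) {x₀ : N} {u : E} (hu : u ∈ (extChartAt I x₀).target) {x₁ : N'}
    (hx₁ : f ((extChartAt I x₀).symm u) ∈ (extChartAt I' x₁).source) :
    ContDiffAt ℝ ∞ ((extChartAt I' x₁) ∘ f ∘ (extChartAt I x₀).symm) u := by
  have h1 := (contMDiffOn_extChartAt_symm (I := I) (n := ∞) x₀).contMDiffAt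
    ((isOpen_extChartAt_target x₀).mem_nhds hu)
  have h2 : ContMDiffAt I' 𝓘(ℝ, E') ∞ (extChartAt I' x₁) (f ((extChartAt I x₀).symm u)) :=
    contMDiffAt_extChartAt' (by simpa using hx₁)
  exact (h2.comp u ((hf.contMDiffAt).comp u h1)).contDiffAt

theorem HamReductive.SmoothForm.contDiffAt [I.Boundaryless] {α : DForm I N k}
    (hα : SmoothForm I α) {x₀ : N} {u : E} (hu : u ∈ (extChartAt I x₀).target) :
    ContDiffAt ℝ ∞ (localRep I α x₀) u :=
  (hα x₀).contDiffAt ((isOpen_extChartAt_target x₀).mem_nhds hu)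

/-- A map into the alternating forms on a finite-dimensional space is smooth as soon as its values
on all vectors are: the evaluations on the tuples of basis vectors determine a form linearly. -/
theorem contDiffAt_alternating_of_apply [FiniteDimensional ℝ E] {G : Type*} [NormedAddCommGroup G]
    [NormedSpace ℝ G] {τ : G → E [⋀^Fin k]→L[ℝ] ℝ} {u : G}
    (h : ∀ v : Fin k → E, ContDiffAt ℝ ∞ (fun w => τ w v) u) : ContDiffAt ℝ ∞ τ u := by
  let b := Module.finBasis ℝ E
  let ev : (E [⋀^Fin k]→L[ℝ] ℝ) →ₗ[ℝ] ((Fin k → Fin (Module.finrank ℝ E)) → ℝ) :=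
    { toFun := fun α i => α (fun j => b (i j))
      map_add' := fun _ _ => rfl
      map_smul' := fun _ _ => rfl }
  have hinj : LinearMap.ker ev = ⊥ := by
    rw [LinearMap.ker_eq_bot]
    intro α β hαβ
    apply ContinuousAlternatingMap.toContinuousMultilinearMap_injective
    apply ContinuousMultilinearMap.toMultilinearMap_injective
    exact Module.Basis.ext_multilinear (fun _ => b) (fun i => congrFun hαβ i)
  obtain ⟨g, hg⟩ := LinearMap.exists_leftInverse_of_injective ev hinj
  have hgc : ContDiff ℝ ∞ (LinearMap.toContinuousLinearMap g) := ContinuousLinearMap.contDiff _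
  have : τ = fun w => (LinearMap.toContinuousLinearMap g) (ev (τ w)) := by
    funext w
    exact (LinearMap.congr_fun hg (τ w)).symm
  rw [this]
  exact hgc.contDiffAt.comp u (contDiffAt_pi.2 fun i => h _)

theorem ContDiffAt.compContinuousLinearMap_alternating [FiniteDimensional ℝ E]
    {G : Type*} [NormedAddCommGroup G]
    [NormedSpace ℝ G] {τ : G → E' [⋀^Fin k]→L[ℝ] ℝ} {A : G → E →L[ℝ] E'} {u : G}
    (hτ : ContDiffAt ℝ ∞ τ u) (hA : ContDiffAt ℝ ∞ A u) :
    ContDiffAt ℝ ∞ (fun w => (τ w).compContinuousLinearMap (A w)) u := by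
  apply contDiffAt_alternating_of_apply
  intro v
  have h1 : ContDiffAt ℝ ∞
      (fun w => ContinuousAlternatingMap.toContinuousMultilinearMapLI (𝕜 := ℝ) (E := E') (F := ℝ)
        (ι := Fin k) (τ w)) u :=
    (ContinuousAlternatingMap.toContinuousMultilinearMapLI (𝕜 := ℝ) (E := E') (F := ℝ)
      (ι := Fin k)).contDiff.contDiffAt.comp u hτ
  have h2 : ContDiffAt ℝ ∞ (fun w =>
      ContinuousMultilinearMap.compContinuousLinearMapContinuousMultilinear ℝ
        (fun _ : Fin k => E) (fun _ => E') ℝ (fun _ => A w)) u :=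
    (ContinuousMultilinearMap.contDiff _).contDiffAt.comp u (contDiffAt_pi.2 fun _ => hA)
  have h3 := h2.clm_apply h1
  exact ((ContinuousMultilinearMap.apply ℝ (fun _ : Fin k => E) ℝ v).contDiff.contDiffAt).comp u h3

theorem HamReductive.SmoothForm.pullbackForm [IsManifold I ∞ N] [IsManifold I' ∞ N']
    [I.Boundaryless] [I'.Boundaryless] [FiniteDimensional ℝ E] {α : DForm I' N' k}
    (hα : SmoothForm I' α) {f : N → N'} (hf : ContMDiff I I' ∞ f) :
    SmoothForm I (pullbackForm I I' f α) := by
  intro x₀ u hu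
  apply ContDiffAt.contDiffWithinAt
  have hx₁ := mem_extChartAt_source (I := I') (f ((extChartAt I x₀).symm u))
  have hF := contDiffAt_chart_expression hf hu hx₁
  refine ContDiffAt.congr_of_eventuallyEq ?_ (localRep_pullbackForm_eventuallyEq α hf hu hx₁)
  refine ContDiffAt.compContinuousLinearMap_alternating ?_ (hF.fderiv_right (m := ∞) (by simp))
  exact (hα.contDiffAt (by simp)).comp u hF

/-- The exterior derivative commutes with pull-backs. -/
theorem extD_pullbackForm [IsManifold I ∞ N] [IsManifold I' ∞ N']
    [I.Boundaryless] [I'.Boundaryless] {α : DForm I' N' k}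
    (hα : SmoothForm I' α) {f : N → N'} (hf : ContMDiff I I' ∞ f) :
    extD I (pullbackForm I I' f α) = pullbackForm I I' f (extD I' α) := by
  funext x
  have hx : (extChartAt I x).symm (extChartAt I x x) = x := extChartAt_to_inv x
  have hu := mem_extChartAt_target (I := I) x
  have hx₁ : f ((extChartAt I x).symm (extChartAt I x x)) ∈ (extChartAt I' (f x)).source := by
    rw [hx]; exact mem_extChartAt_source (f x)
  have hF := contDiffAt_chart_expression hf hu hx₁
  have hFx : ((extChartAt I' (f x)) ∘ f ∘ (extChartAt I x).symm) (extChartAt I x x) =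
      extChartAt I' (f x) (f x) := by simp
  have hα' : DifferentiableAt ℝ (localRep I' α (f x))
      (((extChartAt I' (f x)) ∘ f ∘ (extChartAt I x).symm) (extChartAt I x x)) := by
    rw [hFx]
    exact (hα.contDiffAt (mem_extChartAt_target (f x))).differentiableAt (by simp)
  have key : (fderiv ℝ ((extChartAt I' (f x)) ∘ f ∘ (extChartAt I x).symm) (extChartAt I x x)).comp
      (mfderiv I 𝓘(ℝ, E) (extChartAt I x) x : E →L[ℝ] E) =
      (mfderiv I' 𝓘(ℝ, E') (extChartAt I' (f x)) (f x) : E' →L[ℝ] E').comp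
        (mfderiv I I' f x : E →L[ℝ] E') := by
    have h1 : MDifferentiableAt I 𝓘(ℝ, E) (extChartAt I x) x :=
      mdifferentiableAt_extChartAt (mem_chart_source H x)
    have h2 : MDifferentiableAt I' 𝓘(ℝ, E') (extChartAt I' (f x)) (f x) :=
      mdifferentiableAt_extChartAt (mem_chart_source H' (f x))
    have h3 := mfderiv_comp x (hF.differentiableAt (by simp)).mdifferentiableAt h1
    have h4 := mfderiv_comp x h2 (hf.mdifferentiable (by simp) x)
    have h5 : ((extChartAt I' (f x)) ∘ f ∘ (extChartAt I x).symm) ∘ (extChartAt I x) =ᶠ[𝓝 x]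
        (extChartAt I' (f x)) ∘ f := by
      filter_upwards [extChartAt_source_mem_nhds (I := I) x] with z hz
      simp only [Function.comp_apply, (extChartAt I x).left_inv hz]
    rw [mfderiv_eq_fderiv] at h3
    exact h3.symm.trans (h5.mfderiv_eq.trans h4)
  have e1 := (localRep_pullbackForm_eventuallyEq α hf hu hx₁).extDeriv_eq
  have e2 := extDeriv_pullback hα' hF minSmoothness_two_le_infty
  rw [hFx] at e2
  have e3 := e1.trans e2
  unfold HamReductive.extD
  rw [e3]
  have aux : ∀ (A : E' [⋀^Fin (k+1)]→L[ℝ] ℝ) (B C : E →L[ℝ] E'), B = C →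
    A.compContinuousLinearMap B = A.compContinuousLinearMap C := by rintro A B C rfl; rfl
  exact aux _ _ _ key

end FormPullback

/-! ### Submersions and their level sets -/

section Submersion

open Filter Topology Set Manifold

/-- A linear surjection `A` can be completed to an isomorphism onto a product. -/
theorem ContinuousLinearMap.exists_equiv_fst_eq {E E' F : Type*} [NormedAddCommGroup E]
    [NormedSpace ℝ E] [FiniteDimensional ℝ E] [NormedAddCommGroup E'] [NormedSpace ℝ E']
    [FiniteDimensional ℝ E'] [NormedAddCommGroup F] [NormedSpace ℝ F] [FiniteDimensional ℝ F]
    (A : E →L[ℝ] E') (hA : Function.Surjective A) (L : E ≃L[ℝ] E' × F) :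
    ∃ (q : E →L[ℝ] F) (T : E ≃L[ℝ] E' × F), (T : E →L[ℝ] E' × F) = A.prod q := by
  obtain ⟨r, hr⟩ := A.ker_closedComplemented_of_finiteDimensional_range
  have hdim : Module.finrank ℝ (LinearMap.ker (A : E →ₗ[ℝ] E')) = Module.finrank ℝ F := by
    have h1 := LinearMap.finrank_range_add_finrank_ker (A : E →ₗ[ℝ] E')
    rw [LinearMap.range_eq_top.2 hA, finrank_top] at h1
    have h2 := L.toLinearEquiv.finrank_eq
    rw [Module.finrank_prod] at h2
    omega
  let j : LinearMap.ker (A : E →ₗ[ℝ] E') ≃L[ℝ] F := ContinuousLinearEquiv.ofFinrankEq hdim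
  let q : E →L[ℝ] F := (j : _ →L[ℝ] F).comp r
  have hinj : Function.Injective (A.prod q) := by
    rw [injective_iff_map_eq_zero]
    intro x hx
    have h1 : A x = 0 := congrArg Prod.fst hx
    have h2 : j (r x) = 0 := congrArg Prod.snd hx
    have h3 : r x = 0 := by simpa using h2
    have h4 := hr ⟨x, h1⟩
    rw [h3] at h4
    exact (congrArg Subtype.val h4).symm
  have hfin : Module.finrank ℝ E = Module.finrank ℝ (E' × F) := L.toLinearEquiv.finrank_eq
  refine ⟨q, (LinearMap.linearEquivOfInjective ((A.prod q : E →L[ℝ] E' × F) : E →ₗ[ℝ] E' × F)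
    hinj hfin).toContinuousLinearEquiv, ?_⟩
  ext x <;> rfl

/-- Near a point where its differential is onto, a map is a linear projection composed with a
diffeomorphism of the source. -/
theorem ContDiffOn.exists_straightening {E E' F : Type*} [NormedAddCommGroup E]
    [NormedSpace ℝ E] [FiniteDimensional ℝ E] [NormedAddCommGroup E'] [NormedSpace ℝ E']
    [FiniteDimensional ℝ E'] [NormedAddCommGroup F] [NormedSpace ℝ F] [FiniteDimensional ℝ F]
    {W : Set E} (hW : IsOpen W) {f : E → E'} (hf : ContDiffOn ℝ ∞ f W) {x : E} (hx : x ∈ W)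
    (hsurj : Function.Surjective (fderiv ℝ f x)) (L : E ≃L[ℝ] E' × F) :
    ∃ d : OpenPartialHomeomorph E E, x ∈ d.source ∧ d.source ⊆ W ∧ ContDiffOn ℝ ∞ d d.source ∧
      ContDiffOn ℝ ∞ d.symm d.target ∧ ∀ u ∈ d.source, (L (d u)).1 = f u := by
  have : CompleteSpace E := FiniteDimensional.complete ℝ E
  obtain ⟨q, T, hT⟩ := (fderiv ℝ f x).exists_equiv_fst_eq hsurj L
  let D : E → E := fun u => L.symm (f u, q u)
  have hD : ContDiffOn ℝ ∞ D W :=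
    L.symm.contDiff.comp_contDiffOn (hf.prodMk q.contDiff.contDiffOn)
  have hDat : ∀ u ∈ W, ContDiffAt ℝ ∞ D u := fun u hu => hD.contDiffAt (hW.mem_nhds hu)
  have hD' : HasFDerivAt D ((T.trans L.symm : E ≃L[ℝ] E) : E →L[ℝ] E) x := by
    have h1 : HasFDerivAt f (fderiv ℝ f x) x :=
      ((hf.contDiffAt (hW.mem_nhds hx)).differentiableAt (by simp)).hasFDerivAt
    have h2 := (L.symm : E' × F →L[ℝ] E).hasFDerivAt.comp x (h1.prodMk q.hasFDerivAt)
    rw [← hT] at h2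
    exact h2
  have hn : (∞ : WithTop ℕ∞) ≠ 0 := by simp
  let d₀ := (hDat x hx).toOpenPartialHomeomorph D hD' hn
  have hxd₀ : x ∈ d₀.source := (hDat x hx).mem_toOpenPartialHomeomorph_source hD' hn
  -- The differential stays invertible near `x`, so that the inverse is smooth.
  let V : Set E := W ∩ (fderiv ℝ D) ⁻¹' (range ((↑) : (E ≃L[ℝ] E) → E →L[ℝ] E))
  have hV : IsOpen V :=
    (hD.continuousOn_fderiv_of_isOpen hW (by simp)).isOpen_inter_preimage hW
      ContinuousLinearEquiv.isOpen
  have hxV : x ∈ V := ⟨hx, T.trans L.symm, hD'.fderiv.symm⟩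
  refine ⟨d₀.restrOpen V hV, ⟨hxd₀, hxV⟩, fun u hu => hu.2.1, ?_, ?_, ?_⟩
  · exact hD.mono fun u hu => hu.2.1
  · intro a ha
    have hs : (d₀.restrOpen V hV).symm a ∈ V := ((d₀.restrOpen V hV).map_target ha).2
    obtain ⟨A, hA⟩ := hs.2
    refine ((d₀.restrOpen V hV).contDiffAt_symm (f₀' := A) ha ?_ (hDat _ hs.1)).contDiffWithinAt
    rw [hA]
    exact ((hDat _ hs.1).differentiableAt (by simp)).hasFDerivAt
  · intro u _
    change (L (L.symm (f u, q u))).1 = f u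
    simp

variable {E : Type*} [NormedAddCommGroup E] [NormedSpace ℝ E]
  {H : Type*} [TopologicalSpace H] {I : ModelWithCorners ℝ E H} [I.Boundaryless]
  {E' : Type*} [NormedAddCommGroup E'] [NormedSpace ℝ E']
  {H' : Type*} [TopologicalSpace H'] {I' : ModelWithCorners ℝ E' H'}
  {N : Type*} [TopologicalSpace N] [ChartedSpace H N]
  {N' : Type*} [TopologicalSpace N'] [ChartedSpace H' N']
  {F : Type*} [NormedAddCommGroup F] [NormedSpace ℝ F]

theorem fderiv_chart_expression_surjective {f : N → N'} (hf : ContMDiff I I' ∞ f) {x : N}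
    (hsurj : Function.Surjective (mfderiv I I' f x)) :
    Function.Surjective (fderiv ℝ (extChartAt I' (f x) ∘ f ∘ (extChartAt I x).symm)
      (extChartAt I x x)) := by
  have h := (hf.mdifferentiable (by simp) x).mfderiv
  rw [writtenInExtChartAt, I.range_eq_univ, fderivWithin_univ] at h
  rwa [h] at hsurj

variable [FiniteDimensional ℝ E] [FiniteDimensional ℝ E'] [FiniteDimensional ℝ F]
  [IsManifold I ∞ N] [IsManifold I' ∞ N']

/-- Normal form of a map near a point where its differential is onto: in suitable charts it is a
linear projection. -/
theorem ContMDiff.exists_chart_fst_eq {f : N → N'} (hf : ContMDiff I I' ∞ f) {x : N}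
    (hsurj : Function.Surjective (mfderiv I I' f x)) (L : E ≃L[ℝ] E' × F) :
    ∃ e ∈ IsManifold.maximalAtlas I ∞ N, x ∈ e.source ∧
      e.source ⊆ f ⁻¹' (chartAt H' (f x)).source ∧
      ∀ m ∈ e.source, (L (I (e m))).1 = extChartAt I' (f x) (f m) := by
  have hx := mem_extChartAt_target (I := I) x
  let W : Set E := (extChartAt I x).target ∩
    (extChartAt I x).symm ⁻¹' (f ⁻¹' (extChartAt I' (f x)).source)
  have hW : IsOpen W :=
    (continuousOn_extChartAt_symm x).isOpen_inter_preimage (isOpen_extChartAt_target x)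
      ((isOpen_extChartAt_source (f x)).preimage hf.continuous)
  have hxW : extChartAt I x x ∈ W := ⟨hx, by simp⟩
  have hF : ContDiffOn ℝ ∞ (extChartAt I' (f x) ∘ f ∘ (extChartAt I x).symm) W :=
    fun u hu => (contDiffAt_chart_expression hf hu.1 hu.2).contDiffWithinAt
  obtain ⟨d, hxd, hdW, hd, hd', hdf⟩ :=
    hF.exists_straightening hW hxW (fderiv_chart_expression_surjective hf hsurj) L
  let e : OpenPartialHomeomorph N H :=
    (((chartAt H x).trans I.toHomeomorph.toOpenPartialHomeomorph).trans d).trans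
      I.toHomeomorph.symm.toOpenPartialHomeomorph
  have he_mem : ∀ m, m ∈ e.source ↔ m ∈ (chartAt H x).source ∧ extChartAt I x m ∈ d.source := by
    intro m
    simp [e, extChartAt, ModelWithCorners.toHomeomorph]
  have he_apply : ∀ m, e m = I.symm (d (extChartAt I x m)) := fun m => rfl
  have hIe : ∀ m, I (e m) = d (extChartAt I x m) := fun m =>
    I.right_inv (by rw [I.range_eq_univ]; trivial)
  have he_symm : ∀ h, e.symm h = (extChartAt I x).symm (d.symm (I h)) := fun h => rfl
  have he_target : ∀ h ∈ e.target, I h ∈ d.target := by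
    intro h hh
    have h1 := (he_mem _).1 (e.map_target hh)
    have h2 : I h = d (extChartAt I x (e.symm h)) := by rw [← hIe, e.right_inv hh]
    rw [h2]
    exact d.map_source h1.2
  refine ⟨e, ?_, (he_mem x).2 ⟨mem_chart_source H x, hxd⟩, ?_, ?_⟩
  · apply OpenPartialHomeomorph.mem_maximalAtlas_of_contMDiffOn
    · have h1 : ContMDiffOn I 𝓘(ℝ, E) ∞ (fun m => d (extChartAt I x m)) e.source :=
        hd.contMDiffOn.comp ((contMDiffOn_extChartAt (x := x)).mono fun m hm => ((he_mem m).1 hm).1)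
          fun m hm => ((he_mem m).1 hm).2
      exact (I.contMDiffOn_symm.comp h1 fun m _ => by rw [I.range_eq_univ]; trivial)
    · have h1 : ContMDiffOn I 𝓘(ℝ, E) ∞ (fun h => d.symm (I h)) e.target :=
        hd'.contMDiffOn.comp I.contMDiff.contMDiffOn he_target
      exact (contMDiffOn_extChartAt_symm x).comp h1 fun h hh =>
        (hdW (d.map_target (he_target h hh))).1
  · intro m hm
    have h1 := (he_mem m).1 hm
    have h2 := (hdW h1.2).2
    simpa [(chartAt H x).left_inv h1.1] using h2
  · intro m hm
    have h1 := (he_mem m).1 hm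
    rw [hIe, hdf _ h1.2]
    simp [(chartAt H x).left_inv h1.1]

/-- A map of finite-dimensional manifolds whose differential is everywhere onto is a submersion. -/
theorem ContMDiff.isSubmersion_of_surjective_mfderiv {f : N → N'} (hf : ContMDiff I I' ∞ f)
    (hsurj : ∀ x, Function.Surjective (mfderiv I I' f x)) (L : E ≃L[ℝ] E' × F) :
    IsSubmersion I I' ∞ f := by
  apply IsSubmersionOfComplement.isSubmersion (F := F)
  intro x
  obtain ⟨e, he, hxe, hsub, hfe⟩ := hf.exists_chart_fst_eq (hsurj x) L
  refine IsSubmersionAtOfComplement.mk_of_charts L e (chartAt H' (f x)) hxe (mem_chart_source _ _)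
    he (IsManifold.chart_mem_maximalAtlas _) hsub ?_
  intro u hu
  rw [OpenPartialHomeomorph.extend_target] at hu
  have h1 := hfe _ (e.map_target hu.1)
  have h2 : I (e (e.symm (I.symm u))) = u := by
    rw [e.right_inv hu.1, I.right_inv (by rw [I.range_eq_univ]; trivial)]
  rw [h2] at h1
  exact h1.symm

/-- A smooth map whose differential is everywhere onto is open. -/
theorem ContMDiff.isOpenMap_of_surjective_mfderiv [I'.Boundaryless] {f : N → N'}
    (hf : ContMDiff I I' ∞ f)
    (hsurj : ∀ x, Function.Surjective (mfderiv I I' f x)) : IsOpenMap f := by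
  rw [isOpenMap_iff_nhds_le]
  intro x
  have : CompleteSpace E := FiniteDimensional.complete ℝ E
  have : CompleteSpace E' := FiniteDimensional.complete ℝ E'
  have hx := mem_extChartAt_target (I := I) x
  have hx₁ : f ((extChartAt I x).symm (extChartAt I x x)) ∈ (extChartAt I' (f x)).source := by simp
  have hF := contDiffAt_chart_expression hf hx hx₁
  have hmap := (hF.hasStrictFDerivAt (by simp)).map_nhds_eq_of_surj
    (LinearMap.range_eq_top.2 (fderiv_chart_expression_surjective hf (hsurj x)))
  have hFx : (extChartAt I' (f x) ∘ f ∘ (extChartAt I x).symm) (extChartAt I x x) =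
      extChartAt I' (f x) (f x) := by simp
  rw [hFx] at hmap
  have h1 : map (extChartAt I' (f x)).symm (𝓝 (extChartAt I' (f x) (f x))) = 𝓝 (f x) := by
    have := map_extChartAt_symm_nhdsWithin_range (I := I') (f x)
    rwa [I'.range_eq_univ, nhdsWithin_univ] at this
  have h2 : map (extChartAt I x).symm (𝓝 (extChartAt I x x)) = 𝓝 x := by
    have := map_extChartAt_symm_nhdsWithin_range (I := I) x
    rwa [I.range_eq_univ, nhdsWithin_univ] at this
  have h3 : map f (𝓝 x) = map (f ∘ (extChartAt I x).symm) (𝓝 (extChartAt I x x)) := by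
    rw [← Filter.map_map, h2]
  rw [h3, ← h1, ← hmap, Filter.map_map]
  apply le_of_eq
  apply Filter.map_congr
  have hc : ContinuousAt (f ∘ (extChartAt I x).symm) (extChartAt I x x) :=
    hf.continuous.continuousAt.comp (continuousAt_extChartAt_symm x)
  have := hc.eventually_mem ((isOpen_extChartAt_source (f x)).mem_nhds hx₁)
  filter_upwards [this] with u hu
  simp only [Function.comp_apply]
  exact (extChartAt I' (f x)).left_inv hu

end Submersion

section LevelSet

open Filter Topology Set Manifold

/-- An immersion has injective differentials: its normal form has a smooth left inverse. -/
theorem Manifold.IsImmersionAt.mfderiv_injective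
    {E : Type*} [NormedAddCommGroup E] [NormedSpace ℝ E]
    {H : Type*} [TopologicalSpace H] {I : ModelWithCorners ℝ E H} [I.Boundaryless]
    {E' : Type*} [NormedAddCommGroup E'] [NormedSpace ℝ E']
    {H' : Type*} [TopologicalSpace H'] {I' : ModelWithCorners ℝ E' H'}
    {N : Type*} [TopologicalSpace N] [ChartedSpace H N] [IsManifold I ∞ N]
    {N' : Type*} [TopologicalSpace N'] [ChartedSpace H' N'] [IsManifold I' ∞ N']
    {f : N → N'} {x : N} (h : IsImmersionAt I I' ∞ f x) :
    Function.Injective (mfderiv I I' f x) := by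
  let r : N' → N := fun y =>
    (h.domChart.extend I).symm (h.equiv.symm (h.codChart.extend I' y)).1
  have hx := h.mem_domChart_source
  have hrf : ∀ z ∈ h.domChart.source, r (f z) = z := by
    intro z hz
    have hz' : z ∈ (h.domChart.extend I).source := by simpa using hz
    have h1 := h.writtenInCharts ((h.domChart.extend I).map_source hz')
    simp only [Function.comp_apply, (h.domChart.extend I).left_inv hz'] at h1
    simp only [r, h1, ContinuousLinearEquiv.symm_apply_apply]
    exact (h.domChart.extend I).left_inv hz'
  have hfx := h.mem_codChart_source
  have hpt : (h.equiv.symm (h.codChart.extend I' (f x))).1 = h.domChart.extend I x := by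
    have hz' : x ∈ (h.domChart.extend I).source := by simpa using hx
    have h1 := h.writtenInCharts ((h.domChart.extend I).map_source hz')
    simp only [Function.comp_apply, (h.domChart.extend I).left_inv hz'] at h1
    rw [h1]; simp
  have hr : MDifferentiableAt I' I r (f x) := by
    have h1 : MDifferentiableAt I' 𝓘(ℝ, E') (h.codChart.extend I') (f x) :=
      (h.codChart.contMDiffAt_extend h.codChart_mem_maximalAtlas hfx).mdifferentiableAt (by simp)
    have h2 : MDifferentiableAt 𝓘(ℝ, E) I (h.domChart.extend I).symm (h.domChart.extend I x) := by
      refine ContMDiffAt.mdifferentiableAt (n := ∞) ?_ (by simp)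
      refine ((contMDiffOn_extend_symm h.domChart_mem_maximalAtlas).contMDiffAt ?_)
      have hopen : IsOpen (h.domChart.extend I).target := by
        rw [OpenPartialHomeomorph.extend_target, I.range_eq_univ, inter_univ]
        exact h.domChart.open_target.preimage I.continuous_symm
      have himg : I '' h.domChart.target = (h.domChart.extend I).target := by
        rw [OpenPartialHomeomorph.extend_target_eq_image_source,
          ← h.domChart.image_source_eq_target, image_image]
        rfl
      rw [himg]
      exact hopen.mem_nhds ((h.domChart.extend I).map_source (by simpa using hx))
    have h3 : MDifferentiableAt 𝓘(ℝ, E') 𝓘(ℝ, E) (fun u => (h.equiv.symm u).1)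
        (h.codChart.extend I' (f x)) :=
      DifferentiableAt.mdifferentiableAt (by fun_prop)
    rw [← hpt] at h2
    exact MDifferentiableAt.comp (f x) h2 (h3.comp (f x) h1)
  have hf : MDifferentiableAt I I' f x := h.contMDiffAt.mdifferentiableAt (by simp)
  have hid : r ∘ f =ᶠ[𝓝 x] id := by
    filter_upwards [h.domChart.open_source.mem_nhds hx] with z hz using hrf z hz
  intro v w hvw
  have h1 : mfderiv I I (r ∘ f) x = mfderiv I I id x := hid.mfderiv_eq
  have h2 : mfderiv I I (r ∘ f) x v = mfderiv I I (r ∘ f) x w := by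
    rw [mfderiv_comp_apply x hr hf, mfderiv_comp_apply x hr hf, hvw]
  rw [h1, mfderiv_id] at h2
  exact h2

variable {E : Type*} [NormedAddCommGroup E] [NormedSpace ℝ E]
  {M : Type*} [TopologicalSpace M]
  {P F : Type*} [NormedAddCommGroup P] [NormedSpace ℝ P]
  [NormedAddCommGroup F] [NormedSpace ℝ F]

/-- The chart of a subset `S` obtained from a chart `e` of the ambient manifold in which `S` is
the slice where the first coordinate vanishes. Outside its target, the inverse of the chart takes
the value `s`. -/
noncomputable def sliceChart {q : M → Prop} (L : E ≃L[ℝ] P × F) (e : OpenPartialHomeomorph M E)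
    (he : ∀ m ∈ e.source, q m ↔ (L (e m)).1 = 0) (s : {m // q m}) :
    OpenPartialHomeomorph {m // q m} F := by
  classical
  exact
  { toFun := fun z => (L (e z)).2
    invFun := fun w => if h : q (e.symm (L.symm (0, w))) then ⟨_, h⟩ else s
    source := Subtype.val ⁻¹' e.source
    target := {w | L.symm (0, w) ∈ e.target}
    map_source' := by
      intro z hz
      have h1 : L (e z) = (0, (L (e z)).2) := Prod.ext ((he z hz).1 z.2) rfl
      change L.symm (0, (L (e z)).2) ∈ e.target
      rw [← h1, L.symm_apply_apply]
      exact e.map_source hz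
    map_target' := by
      intro w hw
      have hw' := e.map_target hw
      have h : q (e.symm (L.symm (0, w))) := by
        rw [he _ hw', e.right_inv hw]; simp
      simp only [dif_pos h]
      exact hw'
    left_inv' := by
      intro z hz
      have h1 : L (e z) = (0, (L (e z)).2) := Prod.ext ((he z hz).1 z.2) rfl
      have h2 : e.symm (L.symm (0, (L (e z)).2)) = z := by
        rw [← h1, L.symm_apply_apply, e.left_inv hz]
      have h : q (e.symm (L.symm (0, (L (e z)).2))) := by rw [h2]; exact z.2
      simp only [dif_pos h]
      exact Subtype.ext h2
    right_inv' := by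
      intro w hw
      have hw' := e.map_target hw
      have h : q (e.symm (L.symm (0, w))) := by
        rw [he _ hw', e.right_inv hw]; simp
      simp only [dif_pos h]
      rw [e.right_inv hw]; simp
    open_source := e.open_source.preimage continuous_subtype_val
    open_target := e.open_target.preimage (by fun_prop)
    continuousOn_toFun := by
      have h1 : ContinuousOn (fun z : {m // q m} => e z) (Subtype.val ⁻¹' e.source) :=
        e.continuousOn.comp continuous_subtype_val.continuousOn fun _ h => h
      exact (continuous_snd.comp L.continuous).comp_continuousOn h1
    continuousOn_invFun := by
      refine Topology.IsInducing.subtypeVal.continuousOn_iff.2 ?_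
      have h1 : ContinuousOn (fun w => e.symm (L.symm ((0 : P), w)))
          {w | L.symm ((0 : P), w) ∈ e.target} :=
        e.symm.continuousOn.comp (by fun_prop) fun _ h => h
      refine h1.congr fun w hw => ?_
      have h : q (e.symm (L.symm (0, w))) := by
        rw [he _ (e.map_target hw), e.right_inv hw]; simp
      simp only [Function.comp_apply, dif_pos h] }

theorem sliceChart_symm_val {q : M → Prop} (L : E ≃L[ℝ] P × F) (e : OpenPartialHomeomorph M E)
    (he : ∀ m ∈ e.source, q m ↔ (L (e m)).1 = 0) (s : {m // q m}) {w : F}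
    (hw : w ∈ (sliceChart L e he s).target) :
    (((sliceChart L e he s).symm w : {m // q m}) : M) = e.symm (L.symm (0, w)) := by
  classical
  have h : q (e.symm (L.symm (0, w))) := by
    rw [he _ (e.map_target hw), e.right_inv hw]; simp
  change (((if h : q (e.symm (L.symm (0, w))) then ⟨_, h⟩ else s) : {m // q m}) : M) = _
  rw [dif_pos h]

variable [ChartedSpace E M]

/-- A subset that is locally a slice of the ambient manifold is an embedded submanifold. -/
theorem exists_submanifold_of_slices {q : M → Prop} (L : E ≃L[ℝ] P × F)
    (h : ∀ s : {m // q m}, ∃ e ∈ IsManifold.maximalAtlas 𝓘(ℝ, E) ∞ M, (s : M) ∈ e.source ∧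
      ∀ m ∈ e.source, q m ↔ (L (e m)).1 = 0) :
    ∃ (_ : ChartedSpace F {m // q m}) (_ : IsManifold 𝓘(ℝ, F) ∞ {m // q m}),
      IsSmoothEmbedding 𝓘(ℝ, F) 𝓘(ℝ, E) ∞ (Subtype.val : {m // q m} → M) := by
  choose e heA hes heq using h
  let c : {m // q m} → OpenPartialHomeomorph {m // q m} F := fun s => sliceChart L (e s) (heq s) s
  let cs : ChartedSpace F {m // q m} :=
    { atlas := range c
      chartAt := c
      mem_chart_source := hes
      chart_mem_atlas := fun s => mem_range_self s }
  have hM : IsManifold 𝓘(ℝ, F) ∞ {m // q m} := by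
    apply isManifold_of_contDiffOn
    rintro _ _ ⟨s, rfl⟩ ⟨t, rfl⟩
    have hst : ContDiffOn ℝ ∞ ((e s).symm.trans (e t)) ((e s).symm.trans (e t)).source := by
      have := (IsManifold.compatible_of_mem_maximalAtlas (heA s) (heA t))
      exact (contMDiffOn_of_mem_contDiffGroupoid this).contDiffOn
    have h0 : ContDiff ℝ ∞ (fun w : F => L.symm ((0 : P), w)) :=
      L.symm.contDiff.comp (contDiff_const.prodMk contDiff_id)
    have h1 : ContDiffOn ℝ ∞ (fun w : F => (L (((e s).symm.trans (e t)) (L.symm ((0 : P), w)))).2)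
        ((c s).symm.trans (c t)).source := by
      refine (contDiff_snd.comp L.contDiff).comp_contDiffOn (hst.comp h0.contDiffOn ?_)
      intro w hw
      have hw2 : (((c s).symm w : {m // q m}) : M) ∈ (e t).source := hw.2
      rw [sliceChart_symm_val L (e s) (heq s) s hw.1] at hw2
      exact ⟨hw.1, hw2⟩
    have h2 := h1.congr (f₁ := (c s).symm.trans (c t)) (by
      intro w hw
      change (L ((e t) (((c s).symm w : {m // q m}) : M))).2 = _
      rw [sliceChart_symm_val L (e s) (heq s) s hw.1]
      rfl)
    refine (h2.mono ?_).congr ?_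
    · intro w hw; simpa using hw
    · intro w hw; simp
  refine ⟨cs, hM, ?_, Topology.IsEmbedding.subtypeVal⟩
  apply IsImmersionOfComplement.isImmersion (F := P)
  intro s
  let eq : (F × P) ≃L[ℝ] E := (ContinuousLinearEquiv.prodComm ℝ F P).trans L.symm
  refine IsImmersionAtOfComplement.mk_of_charts eq (c s) (e s) (hes s) (hes s)
    (IsManifold.subset_maximalAtlas (mem_range_self s)) (heA s) (fun _ h => h) ?_
  intro w hw
  have hw' : w ∈ (c s).target := by simpa using hw
  change e s (((c s).symm w : {m // q m}) : M) = L.symm (0, w)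
  rw [sliceChart_symm_val L (e s) (heq s) s hw', (e s).right_inv hw']

variable [IsManifold 𝓘(ℝ, E) ∞ M] [FiniteDimensional ℝ E] [FiniteDimensional ℝ P]
  [FiniteDimensional ℝ F]

/-- The regular level set theorem. -/
theorem exists_submanifold_levelSet {q : M → Prop} {f : M → P}
    (hf : ContMDiff 𝓘(ℝ, E) 𝓘(ℝ, P) ∞ f) (hq : ∀ m, q m ↔ f m = 0)
    (hsurj : ∀ m, q m → Function.Surjective (mfderiv 𝓘(ℝ, E) 𝓘(ℝ, P) f m))
    (L : E ≃L[ℝ] P × F) :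
    ∃ (_ : ChartedSpace F {m // q m}) (_ : IsManifold 𝓘(ℝ, F) ∞ {m // q m}),
      IsSmoothEmbedding 𝓘(ℝ, F) 𝓘(ℝ, E) ∞ (Subtype.val : {m // q m} → M) := by
  apply exists_submanifold_of_slices L
  intro s
  obtain ⟨e, he, hse, -, hfe⟩ := hf.exists_chart_fst_eq (hsurj s s.2) L
  refine ⟨e, he, hse, fun m hm => ?_⟩
  have h := hfe m hm
  rw [hq]
  simp only [extChartAt_model_space_eq_id, PartialEquiv.refl_coe, id_eq] at h
  rw [← h]
  rfl

/-- The tangent space of a regular level set is the kernel of the differential. -/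
theorem mem_range_mfderiv_val_of_levelSet {q : M → Prop} [ChartedSpace F {m // q m}]
    [IsManifold 𝓘(ℝ, F) ∞ {m // q m}]
    (hemb : IsSmoothEmbedding 𝓘(ℝ, F) 𝓘(ℝ, E) ∞ (Subtype.val : {m // q m} → M)) {f : M → P}
    (hf : ContMDiff 𝓘(ℝ, E) 𝓘(ℝ, P) ∞ f) (hq : ∀ m, q m → f m = 0) (L : E ≃L[ℝ] P × F)
    (y : {m // q m}) (hsurj : Function.Surjective (mfderiv 𝓘(ℝ, E) 𝓘(ℝ, P) f (y : M))) (u : E) :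
    (mfderiv 𝓘(ℝ, E) 𝓘(ℝ, P) f (y : M) u : P) = 0 ↔
    ∃ v : F, (mfderiv 𝓘(ℝ, F) 𝓘(ℝ, E) (Subtype.val : {m // q m} → M) y v : E) = u := by
  let A' : E →L[ℝ] P := mfderiv 𝓘(ℝ, E) 𝓘(ℝ, P) f (y : M)
  let B' : F →L[ℝ] E := mfderiv 𝓘(ℝ, F) 𝓘(ℝ, E) (Subtype.val : {m // q m} → M) y
  let A : E →ₗ[ℝ] P := A'
  let B : F →ₗ[ℝ] E := B'
  have hA : Function.Surjective A := hsurj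
  have hB : Function.Injective B := (hemb.isImmersion.isImmersionAt y).mfderiv_injective
  have hval : MDifferentiableAt 𝓘(ℝ, F) 𝓘(ℝ, E) (Subtype.val : {m // q m} → M) y :=
    hemb.contMDiff.mdifferentiable (by simp) y
  have hAB : ∀ v, A (B v) = 0 := by
    intro v
    have h1 := mfderiv_comp_apply y (hf.mdifferentiable (by simp) (y : M)) hval v
    have h2 : f ∘ (Subtype.val : {m // q m} → M) = fun _ => 0 := funext fun z => hq z z.2
    rw [h2, mfderiv_const] at h1
    exact h1.symm
  have hle : LinearMap.range B ≤ LinearMap.ker A := by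
    rintro _ ⟨v, rfl⟩; exact hAB v
  have hdim : Module.finrank ℝ (LinearMap.range B) = Module.finrank ℝ (LinearMap.ker A) := by
    rw [LinearMap.finrank_range_of_inj hB]
    have h1 := LinearMap.finrank_range_add_finrank_ker A
    rw [LinearMap.range_eq_top.2 hA, finrank_top] at h1
    have h2 := L.toLinearEquiv.finrank_eq
    rw [Module.finrank_prod] at h2
    omega
  have heq := Submodule.eq_of_le_of_finrank_eq hle hdim
  have : u ∈ LinearMap.ker A ↔ u ∈ LinearMap.range B := by rw [heq]
  exact this

end LevelSet

/-! ### One-parameter subgroups and the adjoint action -/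

section OneParam

open Filter Topology Set

variable {E : Type*} [NormedAddCommGroup E] [NormedSpace ℝ E]
  {E' : Type*} [NormedAddCommGroup E'] [NormedSpace ℝ E']
  {G : Type*} [TopologicalSpace G] [ChartedSpace E G]

theorem mfderiv_comp_curve {H : Type*} [TopologicalSpace H] {I : ModelWithCorners ℝ E H}
    {H' : Type*} [TopologicalSpace H'] {I' : ModelWithCorners ℝ E' H'}
    {N : Type*} [TopologicalSpace N] [ChartedSpace H N]
    {N' : Type*} [TopologicalSpace N'] [ChartedSpace H' N']
    {f : N → N'} {γ : ℝ → N} {t : ℝ} {p : N} {X : E} (hp : γ t = p)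
    (hf : MDifferentiableAt I I' f p) (hγ : MDifferentiableAt 𝓘(ℝ, ℝ) I γ t)
    (hX : (mfderiv 𝓘(ℝ, ℝ) I γ t (1 : ℝ) : E) = X) :
    (mfderiv 𝓘(ℝ, ℝ) I' (f ∘ γ) t (1 : ℝ) : E') = (mfderiv I I' f p X : E') := by
  subst hp hX
  exact mfderiv_comp_apply t hf hγ 1

variable [Group G]

theorem HamReductive.IsOneParam.map_zero {γ : ℝ → G} {X : E} (h : IsOneParam γ X) : γ 0 = 1 := by
  have := h.map_add 0 0
  simpa using this

theorem HamReductive.IsOneParam.map_neg {γ : ℝ → G} {X : E} (h : IsOneParam γ X) (t : ℝ) :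
    γ (-t) = (γ t)⁻¹ := by
  have := h.map_add (-t) t
  rw [neg_add_cancel, h.map_zero] at this
  exact eq_inv_of_mul_eq_one_left this.symm

theorem HamReductive.IsOneParam.mdifferentiableAt {γ : ℝ → G} {X : E} (h : IsOneParam γ X) (t : ℝ) :
    MDifferentiableAt 𝓘(ℝ, ℝ) 𝓘(ℝ, E) γ t :=
  h.smooth.mdifferentiable (by simp) t

theorem HamReductive.IsOneParam.comp_mul {γ : ℝ → G} {X : E} (h : IsOneParam γ X) (s : ℝ) :
    IsOneParam (fun t => γ (s * t)) (s • X) := by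
  have hs : ContMDiff 𝓘(ℝ, ℝ) 𝓘(ℝ, ℝ) ∞ (fun t : ℝ => s * t) :=
    (contDiff_const.mul contDiff_id).contMDiff
  refine ⟨fun t t' => by rw [mul_add, h.map_add], h.smooth.comp hs, ?_⟩
  have h1 := mfderiv_comp_apply_of_eq (x := (0 : ℝ)) (f := fun t : ℝ => s * t) (g := γ) (y := 0)
    (h.mdifferentiableAt _) (hs.mdifferentiable (by simp) 0) (by simp) (1 : ℝ)
  have h2 : (mfderiv 𝓘(ℝ, ℝ) 𝓘(ℝ, ℝ) (fun t : ℝ => s * t) 0 (1 : ℝ) : ℝ) = s • (1 : ℝ) := by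
    rw [mfderiv_eq_fderiv]
    have : HasFDerivAt (fun t : ℝ => s * t) (s • ContinuousLinearMap.id ℝ ℝ) 0 :=
      (hasFDerivAt_id (𝕜 := ℝ) (0 : ℝ)).const_mul s
    rw [this.fderiv]
    rfl
  refine Eq.trans h1 ?_
  have h3 : (mfderiv 𝓘(ℝ, ℝ) 𝓘(ℝ, E) γ 0 (s • (1 : ℝ)) : E) = s • X := by
    rw [← h.velocity]
    exact (mfderiv 𝓘(ℝ, ℝ) 𝓘(ℝ, E) γ 0).map_smul s (1 : ℝ)
  exact (congrArg (fun r : ℝ => (mfderiv 𝓘(ℝ, ℝ) 𝓘(ℝ, E) γ 0 r : E)) h2).trans h3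

theorem isOneParam_one : IsOneParam (fun _ => (1 : G)) (0 : E) :=
  ⟨fun _ _ => by simp, contMDiff_const, by rw [mfderiv_const]; rfl⟩

theorem HamReductive.IsOneParam.map_hom {γ : ℝ → G} {X : E} (h : IsOneParam γ X) {Θ : G →* G}
    (hΘ : ContMDiff 𝓘(ℝ, E) 𝓘(ℝ, E) ∞ Θ) : IsOneParam (Θ ∘ γ) (lieDeriv (E := E) Θ X) :=
  ⟨fun s t => by simp [h.map_add], hΘ.comp h.smooth,
    mfderiv_comp_curve h.map_zero (hΘ.mdifferentiable (by simp) 1) (h.mdifferentiableAt 0)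
      h.velocity⟩

theorem Ad_one (X : E) : Ad (1 : G) X = X := by
  have h1 : (fun x : G => 1 * x * (1 : G)⁻¹) = id := by funext x; simp
  have h2 : (mfderiv 𝓘(ℝ, E) 𝓘(ℝ, E) (fun x : G => 1 * x * (1 : G)⁻¹) 1 X : E) =
      (mfderiv 𝓘(ℝ, E) 𝓘(ℝ, E) (id : G → G) 1 X : E) := by rw [h1]; rfl
  rw [mfderiv_id] at h2
  exact h2

variable [LieGroup 𝓘(ℝ, E) ∞ G]

theorem mdifferentiable_mul_left_const (g : G) :
    MDifferentiable 𝓘(ℝ, E) 𝓘(ℝ, E) (fun h : G => g * h) :=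
  (contMDiff_mul_left (I := 𝓘(ℝ, E)) (n := ∞)).mdifferentiable (by simp)

theorem mdifferentiable_conj (g : G) :
    MDifferentiable 𝓘(ℝ, E) 𝓘(ℝ, E) (fun h : G => g * h * g⁻¹) :=
  ((contMDiff_mul_right (I := 𝓘(ℝ, E)) (n := ∞) (a := g⁻¹)).comp
    (contMDiff_mul_left (I := 𝓘(ℝ, E)) (n := ∞) (a := g))).mdifferentiable (by simp)

theorem HamReductive.IsOneParam.isMIntegralCurve {γ : ℝ → G} {X : E} (h : IsOneParam γ X) :
    IsMIntegralCurve γ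
      (mulInvariantVectorField (I := 𝓘(ℝ, E)) (G := G) (X : GroupLieAlgebra 𝓘(ℝ, E) G)) := by
  intro t
  have h1 := (h.mdifferentiableAt t).hasMFDerivAt
  have hs : ContMDiff 𝓘(ℝ, ℝ) 𝓘(ℝ, ℝ) ∞ (fun r : ℝ => r - t) :=
    (contDiff_id.sub contDiff_const).contMDiff
  have h2 : γ = (fun g => γ t * g) ∘ (γ ∘ fun r => r - t) := by
    funext r
    simp only [Function.comp_apply]
    rw [← h.map_add]; congr 1; ring
  have hv : (mfderiv 𝓘(ℝ, ℝ) 𝓘(ℝ, E) (γ ∘ fun r => r - t) t (1 : ℝ) : E) = X := by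
    have h3 := mfderiv_comp_apply_of_eq (x := t) (f := fun r : ℝ => r - t) (g := γ) (y := 0)
      (h.mdifferentiableAt _) (hs.mdifferentiable (by simp) t) (by simp) (1 : ℝ)
    have h4 : (mfderiv 𝓘(ℝ, ℝ) 𝓘(ℝ, ℝ) (fun r : ℝ => r - t) t (1 : ℝ) : ℝ) = 1 := by
      have h5 : HasFDerivAt (fun r : ℝ => r - t) (ContinuousLinearMap.id ℝ ℝ) t :=
        (hasFDerivAt_id (𝕜 := ℝ) t).sub_const t
      rw [mfderiv_eq_fderiv, h5.fderiv]
      rfl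
    refine Eq.trans h3 ?_
    rw [← h.velocity]
    exact congrArg (fun r : ℝ => (mfderiv 𝓘(ℝ, ℝ) 𝓘(ℝ, E) γ 0 r : E)) h4
  have h5 := mfderiv_comp_curve (p := (1 : G)) (t := t) (γ := γ ∘ fun r => r - t)
    (f := fun g => γ t * g) (by simp [h.map_zero]) (mdifferentiable_mul_left_const (γ t) 1)
    ((h.smooth.comp hs).mdifferentiable (by simp) t) hv
  rw [← h2] at h5
  have h6 : (mfderiv 𝓘(ℝ, ℝ) 𝓘(ℝ, E) γ t : ℝ →L[ℝ] E) = ContinuousLinearMap.smulRight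
      (1 : ℝ →L[ℝ] ℝ) (mulInvariantVectorField (I := 𝓘(ℝ, E)) (G := G)
        (X : GroupLieAlgebra 𝓘(ℝ, E) G) (γ t) : E) := by
    refine ContinuousLinearMap.ext_ring ?_
    exact h5.trans (one_smul ℝ (_ : E)).symm
  exact h6 ▸ h1

/-- One-parameter subgroups are determined by their velocities: both are integral curves of the
left-invariant vector field. -/
theorem HamReductive.IsOneParam.unique [T2Space G] {γ γ' : ℝ → G} {X : E} (h : IsOneParam γ X)
    (h' : IsOneParam γ' X) : γ = γ' := by
  have : IsManifold 𝓘(ℝ, E) 1 G := IsManifold.of_le (n := ∞) (by simp)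
  have hv := contMDiff_mulInvariantVectorField (I := 𝓘(ℝ, E)) (G := G)
    (X : GroupLieAlgebra 𝓘(ℝ, E) G)
  exact isMIntegralCurve_Ioo_eq_of_contMDiff_boundaryless (t₀ := 0)
    (hv.of_le (by rw [minSmoothness_of_isRCLikeNormedField]; norm_num))
    h.isMIntegralCurve h'.isMIntegralCurve
    (by rw [h.map_zero, h'.map_zero])

theorem HamReductive.IsOneParam.lieExp_eq [T2Space G] {γ : ℝ → G} {X : E} (h : IsOneParam γ X) :
    lieExp X = γ 1 := by
  have hex : ∃ γ : ℝ → G, IsOneParam γ X := ⟨γ, h⟩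
  unfold lieExp
  rw [dif_pos hex, hex.choose_spec.unique h]

theorem HamReductive.IsOneParam.lieExp_smul [T2Space G] {γ : ℝ → G} {X : E} (h : IsOneParam γ X)
    (t : ℝ) : lieExp (t • X) = γ t := by
  rw [(h.comp_mul t).lieExp_eq, mul_one]

theorem lieExp_zero [T2Space G] : lieExp (0 : E) = (1 : G) := isOneParam_one.lieExp_eq

theorem Ad_mul (g h : G) (X : E) : Ad (g * h) X = Ad g (Ad h X) := by
  have h1 : (fun x : G => g * h * x * (g * h)⁻¹) =
      (fun x : G => g * x * g⁻¹) ∘ (fun x : G => h * x * h⁻¹) := by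
    funext x; simp [mul_assoc]
  have h2 := mfderiv_comp_apply_of_eq (x := (1 : G)) (y := 1) (f := fun x : G => h * x * h⁻¹)
    (g := fun x : G => g * x * g⁻¹) (mdifferentiable_conj (E := E) g 1)
    (mdifferentiable_conj (E := E) h 1) (by simp) X
  rw [← h1] at h2
  exact h2

theorem Ad_Ad_inv (g : G) (X : E) : Ad g (Ad g⁻¹ X) = X := by
  rw [← Ad_mul, mul_inv_cancel, Ad_one]

theorem lieDeriv_Ad {Θ : G →* G} (hΘ : ContMDiff 𝓘(ℝ, E) 𝓘(ℝ, E) ∞ Θ) (g : G) (X : E) :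
    lieDeriv Θ (Ad g X) = Ad (Θ g) (lieDeriv Θ X) := by
  have hΘ' := hΘ.mdifferentiable (by simp)
  have h1 : Θ ∘ (fun x : G => g * x * g⁻¹) = (fun x : G => Θ g * x * (Θ g)⁻¹) ∘ Θ := by
    funext x; simp
  have h2 := mfderiv_comp_apply_of_eq (x := (1 : G)) (y := 1) (f := fun x : G => g * x * g⁻¹)
    (g := Θ) (hΘ' 1) (mdifferentiable_conj (E := E) g 1) (by simp) X
  have h3 := mfderiv_comp_apply_of_eq (x := (1 : G)) (y := 1) (f := Θ)
    (g := fun x : G => Θ g * x * (Θ g)⁻¹) (mdifferentiable_conj (E := E) (Θ g) 1)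
    (hΘ' 1) (by simp) X
  rw [h1] at h2
  exact h2.symm.trans h3

theorem HamReductive.IsOneParam.Ad_self {γ : ℝ → G} {X : E} (h : IsOneParam γ X) (t : ℝ) :
    Ad (γ t) X = X := by
  have h1 : (fun x : G => γ t * x * (γ t)⁻¹) ∘ γ = γ := by
    funext s
    simp only [Function.comp_apply]
    rw [← h.map_add, ← h.map_neg, ← h.map_add]; congr 1; ring
  have h2 := mfderiv_comp_curve (f := fun x : G => γ t * x * (γ t)⁻¹) h.map_zero
    (mdifferentiable_conj (E := E) (γ t) 1) (h.mdifferentiableAt 0) h.velocity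
  rw [h1, h.velocity] at h2
  exact h2.symm

end OneParam

/-! ### The Cartan decomposition -/

section Cartan

open Filter Topology Set

variable {E : Type*} [NormedAddCommGroup E] [NormedSpace ℝ E]
  {G : Type*} [TopologicalSpace G] [ChartedSpace E G] [Group G]
  {EK : Type*} [NormedAddCommGroup EK] [NormedSpace ℝ EK]
  {K : Subgroup G} [ChartedSpace EK K] {Θ : G →* G} {b : LinearMap.BilinForm ℝ E}

theorem mem_pSubspace_iff {X : E} : X ∈ pSubspace (E := E) Θ ↔ lieDeriv Θ X = -X := by
  unfold pSubspace
  rw [LinearMap.mem_ker]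
  exact add_eq_zero_iff_eq_neg

namespace HamReductive.IsRealReductive

variable [CompleteSpace E] [LieGroup 𝓘(ℝ, E) ∞ G]
variable (hG : IsRealReductive (EK := EK) K Θ b)
include hG

theorem lieExp_injOn {X Z : E} (hX : X ∈ pSubspace (E := E) Θ) (hZ : Z ∈ pSubspace (E := E) Θ)
    (h : lieExp X = (lieExp Z : G)) : X = Z := by
  obtain ⟨C, hC⟩ := hG.cartan
  have h1 : C (1, ⟨X, hX⟩) = C (1, ⟨Z, hZ⟩) := by rw [hC, hC]; simp [h]
  exact congrArg (fun p : K × pSubspace (E := E) Θ => (p.2 : E)) (C.injective h1)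

/-- The map `exp : 𝔭 → G` is proper. -/
theorem eq_zero_of_lieExp_mem_compact {X : E} (hX : X ∈ pSubspace (E := E) Θ) {A : Set G}
    (hA : IsCompact A) (h : ∀ n : ℕ, lieExp ((n : ℝ) • X) ∈ A) : X = 0 := by
  obtain ⟨C, hC⟩ := hG.cartan
  have h1 : IsCompact ((fun g => ((C.symm g).2 : E)) '' A) :=
    hA.image (continuous_subtype_val.comp (continuous_snd.comp C.symm.continuous))
  obtain ⟨R, hR⟩ := h1.isBounded.exists_norm_le
  have h2 : ∀ n : ℕ, (n : ℝ) * ‖X‖ ≤ R := by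
    intro n
    have h3 : C.symm (lieExp ((n : ℝ) • X)) = (1, ⟨(n : ℝ) • X, Submodule.smul_mem _ _ hX⟩) := by
      have h4 := hC 1 ⟨(n : ℝ) • X, Submodule.smul_mem _ _ hX⟩
      rw [OneMemClass.coe_one, one_mul] at h4
      rw [← h4, C.symm_apply_apply]
    have h5 := hR _ ⟨_, h n, rfl⟩
    simp only [h3] at h5
    rwa [norm_smul, Real.norm_natCast] at h5
  by_contra hne
  obtain ⟨n, hn⟩ := exists_nat_gt (R / ‖X‖)
  rw [div_lt_iff₀ (norm_pos_iff.2 hne)] at hn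
  exact absurd (h2 n) (not_le.2 hn)

theorem lieDeriv_lieDeriv (X : E) : lieDeriv Θ (lieDeriv Θ X) = X := by
  have hΘ' := hG.smooth_involution.mdifferentiable (by simp)
  have h2 := mfderiv_comp_apply_of_eq (x := (1 : G)) (y := 1) (f := Θ) (g := Θ)
    (hΘ' 1) (hΘ' 1) (by simp) X
  have h1 : Θ ∘ Θ = id := funext hG.involutive
  rw [h1, mfderiv_id] at h2
  exact h2.symm

theorem sub_lieDeriv_mem_pSubspace (X : E) : X - lieDeriv Θ X ∈ pSubspace (E := E) Θ := by
  rw [mem_pSubspace_iff, map_sub, hG.lieDeriv_lieDeriv]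
  abel

theorem lieDeriv_kProj (X : E) : lieDeriv Θ (kProj Θ X) = kProj Θ X := by
  simp [kProj, hG.lieDeriv_lieDeriv, add_comm]

theorem sub_kProj_mem_pSubspace (X : E) : X - kProj Θ X ∈ pSubspace (E := E) Θ := by
  have h : X - kProj Θ X = (2⁻¹ : ℝ) • (X - lieDeriv Θ X) := by
    simp only [kProj, smul_apply, add_apply,
      ContinuousLinearMap.id_apply]
    module
  rw [h]
  exact Submodule.smul_mem _ _ (hG.sub_lieDeriv_mem_pSubspace X)

variable [T2Space G]

/-- The exponential map is injective on `𝔭`, and its value is `1` where there is no one-parameter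
subgroup; so all one-parameter subgroups in the directions of `𝔭` exist. -/
theorem exists_isOneParam {X : E} (hX : X ∈ pSubspace (E := E) Θ) :
    ∃ γ : ℝ → G, IsOneParam γ X := by
  by_contra hne
  have h1 : lieExp X = (1 : G) := by unfold lieExp; rw [dif_neg hne]
  have h2 : X = 0 := hG.lieExp_injOn hX (Submodule.zero_mem _) (by rw [h1, lieExp_zero])
  exact hne (h2 ▸ ⟨_, isOneParam_one⟩)

theorem involution_lieExp {X : E} (hX : X ∈ pSubspace (E := E) Θ) :
    Θ (lieExp X) = (lieExp X)⁻¹ := by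
  obtain ⟨γ, hγ⟩ := hG.exists_isOneParam hX
  have h1 := hγ.map_hom hG.smooth_involution
  have h2 := hγ.comp_mul (-1)
  rw [mem_pSubspace_iff.1 hX] at h1
  rw [neg_one_smul] at h2
  have h3 := congrFun (h1.unique h2) 1
  rw [hγ.lieExp_eq, ← hγ.map_neg]
  simpa using h3

end HamReductive.IsRealReductive

end Cartan

/-! ### The moment map along orbits -/

section AlternatingTwo

variable {E : Type*} [NormedAddCommGroup E] [NormedSpace ℝ E] (α : E [⋀^Fin 2]→L[ℝ] ℝ)

theorem alternatingTwo_add_left (u v w : E) : α ![u + v, w] = α ![u, w] + α ![v, w] :=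
  α.toMultilinearMap.cons_add ![w] u v

theorem alternatingTwo_smul_left (c : ℝ) (u w : E) : α ![c • u, w] = c * α ![u, w] :=
  α.toMultilinearMap.cons_smul ![w] c u

theorem alternatingTwo_swap (u v : E) : α ![u, v] = -α ![v, u] := by
  have h := α.toAlternatingMap.map_swap ![v, u] (i := 0) (j := 1) (by decide)
  have h2 : (![v, u] ∘ Equiv.swap (0 : Fin 2) 1) = ![u, v] := by
    funext i; fin_cases i <;> simp
  rw [h2] at h
  exact h

theorem alternatingTwo_neg_left (u w : E) : α ![-u, w] = -α ![u, w] := by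
  rw [← neg_one_smul ℝ u, alternatingTwo_smul_left]; ring

theorem alternatingTwo_neg_right (u w : E) : α ![u, -w] = -α ![u, w] := by
  rw [alternatingTwo_swap, alternatingTwo_neg_left, ← alternatingTwo_swap]

theorem alternatingTwo_add_right (u v w : E) : α ![u, v + w] = α ![u, v] + α ![u, w] := by
  rw [alternatingTwo_swap, alternatingTwo_add_left, alternatingTwo_swap α v u,
    alternatingTwo_swap α w u]
  ring

end AlternatingTwo

section MomentMap

open Filter Topology Set

variable {E : Type*} [NormedAddCommGroup E] [NormedSpace ℝ E]
  {G : Type*} [TopologicalSpace G] [ChartedSpace E G] [Group G]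
  {F : Type*} [NormedAddCommGroup F] [NormedSpace ℝ F]
  {M : Type*} [TopologicalSpace M] [ChartedSpace F M] [MulAction G M]

theorem generator_add (X Z : E) (m : M) :
    (generator (L := G) (F := F) (X + Z) m : F) =
      (generator (L := G) (F := F) X m : F) + (generator (L := G) (F := F) Z m : F) := by
  have h := (mfderiv 𝓘(ℝ, E) 𝓘(ℝ, F) (fun g : G => g • m) (1 : G)).map_add X Z
  exact (congrArg (fun v : F => -v) h).trans (neg_add (_ : F) (_ : F))

variable {Ω : DForm 𝓘(ℝ, F) M 2} {Φ : M → StrongDual ℝ E}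

theorem symplectic_generator_add (X Z : E) (m : M) (v : TangentSpace 𝓘(ℝ, F) m) :
    Ω m ![generator (L := G) (X + Z) m, v] =
      Ω m ![generator (L := G) X m, v] + Ω m ![generator (L := G) Z m, v] :=
  (congrArg (fun u : F => Ω m ![(u : TangentSpace 𝓘(ℝ, F) m), v])
    (generator_add (G := G) X Z m)).trans (alternatingTwo_add_left (E := F) (Ω m) _ _ v)

namespace HamReductive.IsHamiltonian

variable (hM : IsHamiltonian G Ω Φ)
include hM

theorem contMDiff_smul_prod : ContMDiff (𝓘(ℝ, E).prod 𝓘(ℝ, F)) 𝓘(ℝ, F) ∞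
    (fun p : G × M => p.1 • p.2) := by
  have := hM.smooth_action
  exact ContMDiffSMul.contMDiff_smul

theorem contMDiff_orbit (m : M) : ContMDiff 𝓘(ℝ, E) 𝓘(ℝ, F) ∞ (fun g : G => g • m) :=
  hM.contMDiff_smul_prod.comp (contMDiff_id.prodMk contMDiff_const)

theorem contMDiff_const_smul (g : G) : ContMDiff 𝓘(ℝ, F) 𝓘(ℝ, F) ∞ (fun m : M => g • m) :=
  hM.contMDiff_smul_prod.comp (contMDiff_const.prodMk contMDiff_id)

theorem contMDiff_moment_apply (W : E) : ContMDiff 𝓘(ℝ, F) 𝓘(ℝ, ℝ) ∞ (fun m : M => Φ m W) :=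
  (ContinuousLinearMap.apply ℝ ℝ W).contDiff.contMDiff.comp hM.smooth_moment

/-- The derivative of the moment map along the orbit of a one-parameter subgroup. -/
theorem exists_hasDerivAt_moment {γ : ℝ → G} {X : E} (hγ : IsOneParam γ X) (m : M) :
    ∃ δ : StrongDual ℝ E, HasDerivAt (fun t => Φ (γ t • m)) δ 0 ∧
      ∀ W, δ W = Ω m ![generator (L := G) W m, generator (L := G) X m] := by
  have h1 : ContMDiff 𝓘(ℝ, ℝ) 𝓘(ℝ, StrongDual ℝ E) ∞ (fun t => Φ (γ t • m)) :=
    hM.smooth_moment.comp ((hM.contMDiff_orbit m).comp hγ.smooth)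
  have h2 := ((h1.contDiff.differentiable (by simp)) 0).hasDerivAt
  refine ⟨_, h2, fun W => ?_⟩
  have h3 : HasDerivAt (fun t => Φ (γ t • m) W) (deriv (fun t => Φ (γ t • m)) 0 W) 0 :=
    (ContinuousLinearMap.apply ℝ ℝ W).hasFDerivAt.comp_hasDerivAt 0 h2
  have ho : MDifferentiableAt 𝓘(ℝ, E) 𝓘(ℝ, F) (fun g : G => g • m) 1 :=
    (hM.contMDiff_orbit m).mdifferentiable (by simp) 1
  have h4 := mfderiv_comp_curve (f := fun g : G => Φ (g • m) W) hγ.map_zero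
    (((hM.contMDiff_moment_apply W).comp (hM.contMDiff_orbit m)).mdifferentiable (by simp) 1)
    (hγ.mdifferentiableAt 0) hγ.velocity
  have h5 := mfderiv_comp_apply_of_eq (x := (1 : G)) (y := m) (f := fun g : G => g • m)
    (g := fun m' => Φ m' W) ((hM.contMDiff_moment_apply W).mdifferentiable (by simp) m) ho
    (one_smul G m) X
  have h6 : (mfderiv 𝓘(ℝ, ℝ) 𝓘(ℝ, ℝ) (fun t => Φ (γ t • m) W) 0 (1 : ℝ) : ℝ) =
      deriv (fun t => Φ (γ t • m)) 0 W := by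
    rw [mfderiv_eq_fderiv, h3.hasFDerivAt.fderiv]
    exact one_smul ℝ (_ : ℝ)
  rw [hM.moment, ← h6]
  refine (h4.trans h5).trans ?_
  have h7 := (mfderiv 𝓘(ℝ, F) 𝓘(ℝ, ℝ) (fun m' => Φ m' W) m).map_neg
    (mfderiv 𝓘(ℝ, E) 𝓘(ℝ, F) (fun g : G => g • m) (1 : G) X)
  exact (neg_eq_iff_eq_neg.1 h7.symm)

theorem moment_smul_apply (g : G) (m : M) (W : E) : Φ (g • m) W = Φ m (Ad g⁻¹ W) := by
  rw [hM.equivariant]; rfl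

/-- If the moment map is stationary at time `0` along the orbit of a one-parameter subgroup, then it
is constant along that orbit. -/
theorem moment_const_of_symplectic_eq_zero {γ : ℝ → G} {X : E} (hγ : IsOneParam γ X) {m : M}
    (h : ∀ W : E, Ω m ![generator (L := G) W m, generator (L := G) X m] = 0) (t : ℝ) :
    Φ (γ t • m) = Φ m := by
  obtain ⟨δ, hδ, hδW⟩ := hM.exists_hasDerivAt_moment hγ m
  have hδ0 : δ = 0 := by
    ext W; rw [hδW, h]; rfl
  rw [hδ0] at hδ
  ext W
  have hderiv : ∀ t, HasDerivAt (fun s => Φ (γ s • m) W) 0 t := by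
    intro t
    have h1 : HasDerivAt (fun s => Φ (γ s • m) (Ad (γ t)⁻¹ W)) 0 (t - t) := by
      rw [sub_self]
      exact (ContinuousLinearMap.apply ℝ ℝ (Ad (γ t)⁻¹ W)).hasFDerivAt.comp_hasDerivAt 0 hδ
    have h2 := h1.comp_sub_const t t
    refine h2.congr_of_eventuallyEq (Eventually.of_forall fun s => ?_)
    simp only
    rw [← hM.moment_smul_apply, smul_smul, ← hγ.map_add]
    congr 4; ring
  have h1 := is_const_of_deriv_eq_zero (f := fun s => Φ (γ s • m) W)
    (fun t => (hderiv t).differentiableAt) (fun t => (hderiv t).deriv) t 0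
  simpa [hγ.map_zero] using h1

end HamReductive.IsHamiltonian

end MomentMap

section Reductive

open Filter Topology Set

variable {E : Type*} [NormedAddCommGroup E] [NormedSpace ℝ E] [CompleteSpace E]
  {G : Type*} [TopologicalSpace G] [ChartedSpace E G] [Group G] [LieGroup 𝓘(ℝ, E) ∞ G] [T2Space G]
  {EK : Type*} [NormedAddCommGroup EK] [NormedSpace ℝ EK]
  {K : Subgroup G} [ChartedSpace EK K] {Θ : G →* G} {b : LinearMap.BilinForm ℝ E}
  {F : Type*} [NormedAddCommGroup F] [NormedSpace ℝ F]
  {M : Type*} [TopologicalSpace M] [ChartedSpace F M] [MulAction G M]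
  {Ω : DForm 𝓘(ℝ, F) M 2} {Φ : M → StrongDual ℝ E}

theorem HasDerivAt.eq_zero_of_even {f : ℝ → ℝ} {c : ℝ} (h : HasDerivAt f c 0)
    (hf : ∀ t, f (-t) = f t) : c = 0 := by
  have h1 : HasDerivAt (fun t => f (-t)) (-c) 0 := by
    have h' : HasDerivAt f c (-0) := by rwa [neg_zero]
    simpa [Function.comp_def] using h'.scomp (0 : ℝ) (hasDerivAt_neg (0 : ℝ))
  have h2 : (fun t => f (-t)) = f := funext hf
  rw [h2] at h1
  linarith [h.unique h1]

namespace HamReductive.IsRealReductive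

variable (hG : IsRealReductive (EK := EK) K Θ b) (hM : IsHamiltonian G Ω Φ)
include hG hM

/-- An element of `exp 𝔭` other than `1` moves every value of the moment map: otherwise its powers
would move a point within a compact fibre of the moment map. -/
theorem eq_zero_of_moment_lieExp_smul (hC1 : ProperAction G M) (hC2 : IsProperMap Φ) {X : E}
    (hX : X ∈ pSubspace (E := E) Θ) {m : M} (h : Φ ((lieExp X : G) • m) = Φ m) : X = 0 := by
  obtain ⟨γ, hγ⟩ := hG.exists_isOneParam hX
  have hA : IsCompact (Φ ⁻¹' {Φ m}) := hC2.isCompact_preimage isCompact_singleton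
  refine hG.eq_zero_of_lieExp_mem_compact hX (hC1 _ hA) fun n => ⟨m, rfl, ?_⟩
  rw [hγ.lieExp_eq] at h
  rw [hγ.lieExp_smul]
  change Φ (γ n • m) = Φ m
  induction n with
  | zero => simp [hγ.map_zero]
  | succ n ih =>
    rw [Nat.cast_succ, hγ.map_add, mul_smul, hM.equivariant, h, ← hM.equivariant, ih]

/-- The infinitesimal form of `eq_zero_of_moment_lieExp_smul`. -/
theorem eq_zero_of_symplectic_eq_zero (hC1 : ProperAction G M) (hC2 : IsProperMap Φ) {X : E}
    (hX : X ∈ pSubspace (E := E) Θ) {m : M}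
    (h : ∀ W : E, Ω m ![generator (L := G) W m, generator (L := G) X m] = 0) : X = 0 := by
  obtain ⟨γ, hγ⟩ := hG.exists_isOneParam hX
  apply hG.eq_zero_of_moment_lieExp_smul hM hC1 hC2 hX (m := m)
  rw [hγ.lieExp_eq]
  exact hM.moment_const_of_symplectic_eq_zero hγ h 1

/-- An element `X` of `𝔭` vanishes if the derivative of the moment map along `X` vanishes on `𝔭`
and, for reasons of parity, also on `𝔨`. -/
theorem eq_zero_of_moment_even (hC1 : ProperAction G M) (hC2 : IsProperMap Φ) {X : E}
    (hX : X ∈ pSubspace (E := E) Θ) {m : M} {γ : ℝ → G} (hγ : IsOneParam γ X)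
    (hp : ∀ Z ∈ pSubspace (E := E) Θ,
      Ω m ![generator (L := G) Z m, generator (L := G) X m] = 0)
    (hk : ∀ W, lieDeriv Θ W = W → ∀ t, Φ (γ (-t) • m) W = Φ (γ t • m) W) : X = 0 := by
  apply hG.eq_zero_of_symplectic_eq_zero hM hC1 hC2 hX (m := m)
  intro W
  have h1 : W = kProj Θ W + (W - kProj Θ W) := by abel
  rw [h1, symplectic_generator_add, hp _ (hG.sub_kProj_mem_pSubspace W), add_zero]
  obtain ⟨δ, hδ, hδW⟩ := hM.exists_hasDerivAt_moment hγ m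
  rw [← hδW]
  have h2 : HasDerivAt (fun t => Φ (γ t • m) (kProj Θ W)) (δ (kProj Θ W)) 0 :=
    (ContinuousLinearMap.apply ℝ ℝ (kProj Θ W)).hasFDerivAt.comp_hasDerivAt 0 hδ
  exact h2.eq_zero_of_even (hk _ (hG.lieDeriv_kProj W))

omit hM in
theorem map_oneParam_neg {X : E} (hX : X ∈ pSubspace (E := E) Θ) {γ : ℝ → G}
    (hγ : IsOneParam γ X) (t : ℝ) : Θ (γ t) = γ (-t) := by
  rw [← hγ.lieExp_smul, hG.involution_lieExp (Submodule.smul_mem _ _ hX), hγ.lieExp_smul,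
    hγ.map_neg]

omit hM [T2Space G] in
theorem dual_invariant_of_vanishes {ξ : StrongDual ℝ E}
    (h : ∀ X ∈ pSubspace (E := E) Θ, ξ X = 0) (W : E) : ξ (lieDeriv Θ W) = ξ W := by
  have h1 := h _ (hG.sub_lieDeriv_mem_pSubspace W)
  rw [map_sub] at h1
  linarith

/-- The orbit directions in `𝔭` are transverse to the zero set of the `𝔭`-component of `Φ`. -/
theorem eq_zero_of_symplectic_p_eq_zero (hC1 : ProperAction G M) (hC2 : IsProperMap Φ) {m : M}
    (hm : ∀ Z ∈ pSubspace (E := E) Θ, Φ m Z = 0) {X : E} (hX : X ∈ pSubspace (E := E) Θ)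
    (hp : ∀ Z ∈ pSubspace (E := E) Θ,
      Ω m ![generator (L := G) Z m, generator (L := G) X m] = 0) : X = 0 := by
  obtain ⟨γ, hγ⟩ := hG.exists_isOneParam hX
  refine hG.eq_zero_of_moment_even hM hC1 hC2 hX hγ hp fun W hW t => ?_
  rw [hM.moment_smul_apply, hM.moment_smul_apply, ← hG.dual_invariant_of_vanishes hm,
    lieDeriv_Ad hG.smooth_involution, hW, map_inv, hG.map_oneParam_neg hX hγ, neg_neg]

omit [T2Space G] in
/-- The zero set of the `𝔭`-component of `Φ` is `K`-invariant, since `Ad(K)` preserves `𝔭`. -/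
theorem moment_vanishes_smul (k : K) {m : M} (hm : ∀ Z ∈ pSubspace (E := E) Θ, Φ m Z = 0) :
    ∀ Z ∈ pSubspace (E := E) Θ, Φ ((k : G) • m) Z = 0 := by
  intro Z hZ
  rw [hM.moment_smul_apply]
  apply hm
  have hk : Θ (k : G)⁻¹ = (k : G)⁻¹ := (hG.mem_K _).1 (K.inv_mem k.2)
  rw [mem_pSubspace_iff, lieDeriv_Ad hG.smooth_involution, hk, mem_pSubspace_iff.1 hZ, map_neg]

/-- Each orbit meets the zero set of the `𝔭`-component of `Φ` in at most one `K`-orbit. -/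
theorem mem_of_moment_vanishes_smul (hC1 : ProperAction G M) (hC2 : IsProperMap Φ) {m : M} {g : G}
    (hm : ∀ Z ∈ pSubspace (E := E) Θ, Φ m Z = 0)
    (hgm : ∀ Z ∈ pSubspace (E := E) Θ, Φ (g • m) Z = 0) : g ∈ K := by
  obtain ⟨C, hC⟩ := hG.cartan
  obtain ⟨⟨k, X, hX⟩, hkX⟩ := C.surjective g
  replace hkX : (k : G) * lieExp X = g := (hC k ⟨X, hX⟩).symm.trans hkX
  obtain ⟨γ, hγ⟩ := hG.exists_isOneParam hX
  have hm' : ∀ Z ∈ pSubspace (E := E) Θ, Φ (γ 1 • m) Z = 0 := by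
    have h1 := hG.moment_vanishes_smul hM k⁻¹ hgm
    rwa [← hkX, smul_smul, Subgroup.coe_inv, inv_mul_cancel_left, hγ.lieExp_eq] at h1
  -- The values of `Φ` at `m` and `exp(X) • m` are invariant under `Θ`, which inverts `exp(X)`.
  have h2 : Φ (γ 1 • m) = Φ (γ (-1) • m) := by
    ext W
    rw [← hG.dual_invariant_of_vanishes hm', hM.moment_smul_apply, hM.moment_smul_apply,
      ← hG.dual_invariant_of_vanishes hm, lieDeriv_Ad hG.smooth_involution,
      hG.lieDeriv_lieDeriv, map_inv, hG.map_oneParam_neg hX hγ]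
  -- So `exp(2X) = exp(X) exp(-X)⁻¹` fixes the value of the moment map at `m`.
  have h3 : X + X = 0 := by
    have hX2 : X + X = (2 : ℝ) • X := by module
    apply hG.eq_zero_of_moment_lieExp_smul hM hC1 hC2 (Submodule.add_mem _ hX hX) (m := m)
    rw [hX2, hγ.lieExp_smul, show (2 : ℝ) = 1 + 1 by norm_num, hγ.map_add, mul_smul,
      hM.equivariant, h2, ← hM.equivariant, smul_smul, ← hγ.map_add]
    simp [hγ.map_zero]
  have h4 : X = 0 := by
    have : (2 : ℝ) • X = 0 := by rw [← h3]; module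
    simpa using this
  subst h4
  rw [lieExp_zero, mul_one] at hkX
  rw [← hkX]
  exact k.2

end HamReductive.IsRealReductive

end Reductive

/-! ### Every orbit meets the zero set of the `𝔭`-component of the moment map -/

section Minimum

open Filter Topology Set

/-- The sublevel sets of a positive definite form on a finite-dimensional space are compact. -/
theorem isCompact_sublevel_of_posDef {E : Type*} [NormedAddCommGroup E] [NormedSpace ℝ E]
    [FiniteDimensional ℝ E] (B : LinearMap.BilinForm ℝ E) (hB : ∀ x, x ≠ 0 → 0 < B x x) (c : ℝ) :
    IsCompact {x | B x x ≤ c} := by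
  have : ProperSpace E := FiniteDimensional.proper ℝ E
  have hcont : Continuous fun x => B x x := by
    have h : Continuous fun x => LinearMap.toContinuousLinearMap
        ((LinearMap.toContinuousLinearMap : (E →ₗ[ℝ] ℝ) ≃ₗ[ℝ] (E →L[ℝ] ℝ)).toLinearMap ∘ₗ B) x x :=
      (ContinuousLinearMap.continuous _).clm_apply continuous_id
    exact h
  refine Metric.isCompact_of_isClosed_isBounded (isClosed_le hcont continuous_const) ?_
  rcases (Metric.sphere (0 : E) 1).eq_empty_or_nonempty with hS | hS
  · refine (Metric.isBounded_closedBall (x := (0 : E)) (r := 0)).subset fun x _ => ?_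
    by_contra hx
    have hx0 : x ≠ 0 := by rintro rfl; simp at hx
    have : ‖x‖⁻¹ • x ∈ Metric.sphere (0 : E) 1 := by
      rw [mem_sphere_zero_iff_norm, norm_smul, norm_inv, norm_norm,
        inv_mul_cancel₀ (norm_ne_zero_iff.2 hx0)]
    rw [hS] at this
    exact this
  · obtain ⟨u, hu, hmin⟩ := (isCompact_sphere (0 : E) 1).exists_isMinOn hS hcont.continuousOn
    have hu1 : ‖u‖ = 1 := by simpa using hu
    have hu0 : 0 < B u u := hB u fun h => by simp [h] at hu1
    -- By homogeneity `B u u * ‖x‖ ^ 2 ≤ B x x`, where `u` minimizes the form on the unit sphere.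
    have hbound : ∀ x, B u u * ‖x‖ ^ 2 ≤ B x x := by
      intro x
      rcases eq_or_ne x 0 with rfl | hx0
      · simp
      have hx : ‖x‖ ≠ 0 := norm_ne_zero_iff.2 hx0
      have hmem : ‖x‖⁻¹ • x ∈ Metric.sphere (0 : E) 1 := by
        rw [mem_sphere_zero_iff_norm, norm_smul, norm_inv, norm_norm, inv_mul_cancel₀ hx]
      have h1 : B u u ≤ B (‖x‖⁻¹ • x) (‖x‖⁻¹ • x) := hmin hmem
      simp only [map_smul, LinearMap.smul_apply, smul_eq_mul] at h1
      calc B u u * ‖x‖ ^ 2 ≤ (‖x‖⁻¹ * (‖x‖⁻¹ * B x x)) * ‖x‖ ^ 2 := by gcongr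
        _ = B x x := by field_simp
    refine (Metric.isBounded_closedBall (x := (0 : E)) (r := √(c / B u u))).subset fun x hx => ?_
    rw [mem_closedBall_zero_iff]
    apply Real.le_sqrt_of_sq_le
    rw [le_div_iff₀ hu0]
    have hx' : B x x ≤ c := hx
    linarith [hbound x]

variable {E : Type*} [NormedAddCommGroup E] [NormedSpace ℝ E] [FiniteDimensional ℝ E]
  [CompleteSpace E]
  {G : Type*} [TopologicalSpace G] [ChartedSpace E G] [Group G] [LieGroup 𝓘(ℝ, E) ∞ G] [T2Space G]
  {EK : Type*} [NormedAddCommGroup EK] [NormedSpace ℝ EK]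
  {K : Subgroup G} [ChartedSpace EK K] {Θ : G →* G} {b : LinearMap.BilinForm ℝ E}
  {F : Type*} [NormedAddCommGroup F] [NormedSpace ℝ F]
  {M : Type*} [TopologicalSpace M] [ChartedSpace F M] [MulAction G M]
  {Ω : DForm 𝓘(ℝ, F) M 2} {Φ : M → StrongDual ℝ E}

omit [CompleteSpace E] in
/-- The identification `𝔤^* ≃ 𝔤` given by a non-degenerate form. -/
theorem exists_dual_equiv (hb : b.Nondegenerate) :
    ∃ τ : StrongDual ℝ E ≃L[ℝ] E, ∀ (ξ : StrongDual ℝ E) (Z : E), b (τ ξ) Z = ξ Z := by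
  let e : (E →L[ℝ] ℝ) ≃ₗ[ℝ] E :=
    (LinearMap.toContinuousLinearMap : (E →ₗ[ℝ] ℝ) ≃ₗ[ℝ] (E →L[ℝ] ℝ)).symm.trans
      (b.toDual hb).symm
  refine ⟨e.toContinuousLinearEquiv, fun ξ Z => ?_⟩
  exact LinearMap.BilinForm.apply_toDual_symm_apply (hB := hb) _ _

namespace HamReductive.IsRealReductive

variable (hG : IsRealReductive (EK := EK) K Θ b) (hM : IsHamiltonian G Ω Φ)
include hG

omit [FiniteDimensional ℝ E] [T2Space G] in
/-- `𝔭` and `𝔨` are `b`-orthogonal. -/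
theorem form_p_k_eq_zero {X W : E} (hX : X ∈ pSubspace (E := E) Θ)
    (hW : lieDeriv Θ W = W) : b X W = 0 := by
  have h := hG.involution_form X W
  rw [mem_pSubspace_iff.1 hX, hW, map_neg, LinearMap.neg_apply] at h
  linarith

include hM in
/-- The point of an orbit at which the norm of the moment map is minimal lies in the zero set of
its `𝔭`-component. Here `x = τ (Φ m)` corresponds to `Φ m` under `b`, the norm is that of the scalar
product `-b(X, ΘZ)`, and `X = x - Θx` is twice the `𝔭`-component of `x`. -/
theorem moment_vanishes_of_minimal (hC1 : ProperAction G M) (hC2 : IsProperMap Φ)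
    (τ : StrongDual ℝ E ≃L[ℝ] E) (hτ : ∀ (ξ : StrongDual ℝ E) (Z : E), b (τ ξ) Z = ξ Z) (m : M)
    (hmin : ∀ g : G, -b (τ (Φ m)) (lieDeriv Θ (τ (Φ m))) ≤
      -b (τ (Φ (g • m))) (lieDeriv Θ (τ (Φ (g • m))))) :
    ∀ Z ∈ pSubspace (E := E) Θ, Φ m Z = 0 := by
  set x := τ (Φ m) with hx
  set X := x - lieDeriv Θ x with hXdef
  have hX : X ∈ pSubspace (E := E) Θ := hG.sub_lieDeriv_mem_pSubspace x
  obtain ⟨γ, hγ⟩ := hG.exists_isOneParam hX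
  have hAd : ∀ (g : G), τ (Φ (g • m)) = Ad g x := by
    intro g
    have h1 : ∀ Z, b (τ (Φ (g • m)) - Ad g x) Z = 0 := by
      intro Z
      have h2 := hG.invariant_form g x (Ad g⁻¹ Z)
      rw [Ad_Ad_inv] at h2
      rw [map_sub, LinearMap.sub_apply, hτ, h2, hτ, hM.moment_smul_apply, sub_self]
    exact sub_eq_zero.1 (hG.nondegenerate_form.1 _ h1)
  -- `b(x, x)` is constant along the orbit, so that also the norm of the `𝔭`-component is minimal.
  have hexp : ∀ w, b (w - lieDeriv Θ w) (w - lieDeriv Θ w) =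
      2 * b w w + 2 * (-b w (lieDeriv Θ w)) := by
    intro w
    simp only [map_sub, LinearMap.sub_apply]
    rw [hG.involution_form, hG.symm_form (lieDeriv Θ w) w]
    ring
  have hpmin : ∀ g : G, b X X ≤ b (τ (Φ (g • m)) - lieDeriv Θ (τ (Φ (g • m))))
      (τ (Φ (g • m)) - lieDeriv Θ (τ (Φ (g • m)))) := by
    intro g
    rw [hXdef, hexp, hexp]
    have h1 := hmin g
    have h2 : b (τ (Φ (g • m))) (τ (Φ (g • m))) = b x x := by rw [hAd, hG.invariant_form]
    rw [h2]
    linarith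
  let B : E →L[ℝ] E →L[ℝ] ℝ := LinearMap.toContinuousLinearMap
    ((LinearMap.toContinuousLinearMap : (E →ₗ[ℝ] ℝ) ≃ₗ[ℝ] (E →L[ℝ] ℝ)).toLinearMap ∘ₗ b)
  have hBb : ∀ u v, B u v = b u v := fun _ _ => rfl
  -- Criticality in the direction `Z` reads `b(D_Z x, X) = 0`, where `b(D_Z x, X) = Ω(X_M, Z_M)`.
  have hcrit : ∀ Z ∈ pSubspace (E := E) Θ,
      Ω m ![generator (L := G) Z m, generator (L := G) X m] = 0 := by
    intro Z hZ
    obtain ⟨σ, hσ⟩ := hG.exists_isOneParam hZ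
    obtain ⟨δ, hδ, hδW⟩ := hM.exists_hasDerivAt_moment hσ m
    have h1 : HasDerivAt (fun t => τ (Φ (σ t • m)) - lieDeriv Θ (τ (Φ (σ t • m))))
        (τ δ - lieDeriv Θ (τ δ)) 0 := by
      have h2 : HasDerivAt (fun t => τ (Φ (σ t • m))) (τ δ) 0 :=
        (τ : StrongDual ℝ E →L[ℝ] E).hasFDerivAt.comp_hasDerivAt 0 hδ
      exact h2.sub ((lieDeriv Θ).hasFDerivAt.comp_hasDerivAt 0 h2)
    have h3 := B.hasDerivAt_of_bilinear (fun _ => h1) (fun _ => h1)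
    have h4 : IsLocalMin (fun t => B (τ (Φ (σ t • m)) - lieDeriv Θ (τ (Φ (σ t • m))))
        (τ (Φ (σ t • m)) - lieDeriv Θ (τ (Φ (σ t • m))))) 0 := by
      refine Eventually.of_forall fun t => ?_
      simp only [hBb, hσ.map_zero, one_smul]
      exact hpmin (σ t)
    have h5 := h4.hasDerivAt_eq_zero h3
    simp only [hBb, hσ.map_zero, one_smul] at h5
    change b X (τ δ - lieDeriv Θ (τ δ)) + b (τ δ - lieDeriv Θ (τ δ)) X = 0 at h5
    have h6 : b (lieDeriv Θ (τ δ)) X = -b (τ δ) X := by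
      have h := hG.involution_form (τ δ) X
      rw [mem_pSubspace_iff.1 hX, map_neg] at h
      linarith
    have e : b (τ δ - lieDeriv Θ (τ δ)) X = b (τ δ) X - b (lieDeriv Θ (τ δ)) X := by
      rw [map_sub b, LinearMap.sub_apply]
    rw [hG.symm_form X, e, h6, hτ, hδW] at h5
    have h7 := alternatingTwo_swap (E := F) (Ω m) (generator (L := G) Z m)
      (generator (L := G) X m)
    refine h7.trans ?_
    have h8 : (Ω m ![generator (L := G) X m, generator (L := G) Z m] : ℝ) = 0 := by linarith
    exact neg_eq_zero.2 h8
  have hX0 : X = 0 := by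
    refine hG.eq_zero_of_moment_even hM hC1 hC2 hX hγ hcrit fun W hW t => ?_
    -- `X` is fixed by `Ad(γ)`, so only the `𝔨`-component of `x` contributes; it is fixed by `Θ`,
    -- which inverts `γ`.
    have hzero : ∀ s, b X (Ad (γ s)⁻¹ W) = 0 := by
      intro s
      have h := hG.invariant_form (γ s)⁻¹ X W
      rw [← hγ.map_neg, hγ.Ad_self] at h
      rw [← hγ.map_neg, h, hG.form_p_k_eq_zero hX hW]
    have hx' : x = lieDeriv Θ x + X := by rw [hXdef]; abel
    rw [hM.moment_smul_apply, hM.moment_smul_apply, ← hτ, ← hτ, ← hx]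
    nth_rewrite 1 [hx']
    rw [map_add, LinearMap.add_apply, hzero, add_zero, hγ.map_neg, inv_inv]
    have h := hG.involution_form x (Ad (γ t)⁻¹ W)
    rw [lieDeriv_Ad hG.smooth_involution, hW, map_inv, hG.map_oneParam_neg hX hγ, hγ.map_neg,
      inv_inv] at h
    exact h
  intro Z hZ
  rw [← hτ, hG.symm_form]
  exact hG.form_p_k_eq_zero hZ (sub_eq_zero.1 hX0).symm

include hM in
/-- The norm of the moment map attains a minimum on each orbit: the group elements which do not
increase it form a compact set. -/
theorem exists_smul_moment_vanishes [T2Space M] (hC1 : ProperAction G M) (hC2 : IsProperMap Φ)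
    (m : M) : ∃ g : G, ∀ Z ∈ pSubspace (E := E) Θ, Φ (g • m) Z = 0 := by
  obtain ⟨τ, hτ⟩ := exists_dual_equiv hG.nondegenerate_form
  let Q : LinearMap.BilinForm ℝ E := -b.compRight (lieDeriv Θ : E →L[ℝ] E).toLinearMap
  have hQ : ∀ x, Q x x = -b x (lieDeriv Θ x) := fun x => rfl
  set c := Q (τ (Φ m)) (τ (Φ m)) with hc
  have hcomp := isCompact_sublevel_of_posDef Q hG.pos_form c
  have hA : IsCompact (Φ ⁻¹' (τ ⁻¹' {x | Q x x ≤ c})) :=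
    hC2.isCompact_preimage ((τ.toHomeomorph.isCompact_preimage).2 hcomp)
  have horb : Continuous fun g : G => τ (Φ (g • m)) :=
    τ.continuous.comp (hC2.continuous.comp (hM.contMDiff_orbit m).continuous)
  let S : Set G := (fun g : G => τ (Φ (g • m))) ⁻¹' {x | Q x x ≤ c}
  have hS : IsCompact S :=
    (hC1 _ hA).of_isClosed_subset (hcomp.isClosed.preimage horb) fun g hg =>
      ⟨m, le_of_eq hc.symm, hg⟩
  have hQc : Continuous fun x => Q x x := by
    have h : Continuous fun x => LinearMap.toContinuousLinearMap
        ((LinearMap.toContinuousLinearMap : (E →ₗ[ℝ] ℝ) ≃ₗ[ℝ] (E →L[ℝ] ℝ)).toLinearMap ∘ₗ Q) x x :=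
      (ContinuousLinearMap.continuous _).clm_apply continuous_id
    exact h
  have h1S : (1 : G) ∈ S := by
    change Q (τ (Φ ((1 : G) • m))) (τ (Φ ((1 : G) • m))) ≤ c
    rw [one_smul]
  obtain ⟨g, hg, hgmin⟩ := hS.exists_isMinOn ⟨1, h1S⟩ (hQc.comp horb).continuousOn
  refine ⟨g, hG.moment_vanishes_of_minimal hM hC1 hC2 τ hτ (g • m) fun h => ?_⟩
  rw [smul_smul]
  by_cases hh : h * g ∈ S
  · exact hgmin hh
  · have h1 : c < Q (τ (Φ ((h * g) • m))) (τ (Φ ((h * g) • m))) := not_le.1 hh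
    exact (le_trans (show Q (τ (Φ (g • m))) (τ (Φ (g • m))) ≤ c from hg) h1.le)

end HamReductive.IsRealReductive

end Minimum

/-! ### The exterior derivative of the form `⟨Φ, θ⟩` -/

theorem pullbackForm_two_apply {E : Type*} [NormedAddCommGroup E] [NormedSpace ℝ E] {H : Type*}
    [TopologicalSpace H] {I : ModelWithCorners ℝ E H} {E' : Type*} [NormedAddCommGroup E']
    [NormedSpace ℝ E'] {H' : Type*} [TopologicalSpace H'] {I' : ModelWithCorners ℝ E' H'}
    {N : Type*} [TopologicalSpace N] [ChartedSpace H N]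
    {N' : Type*} [TopologicalSpace N'] [ChartedSpace H' N'] (f : N → N') (α : DForm I' N' 2) (x : N)
    (v w : TangentSpace I x) :
    (pullbackForm I I' f α x ![v, w] : ℝ) =
      α (f x) ![mfderiv I I' f x v, mfderiv I I' f x w] := by
  have e : (fun i => mfderiv I I' f x (![v, w] i)) = ![mfderiv I I' f x v, mfderiv I I' f x w] := by
    funext i; fin_cases i <;> rfl
  exact congrArg (fun u => α (f x) u) e

section Surfaces

open Filter Topology Set

variable {E : Type*} [NormedAddCommGroup E] [NormedSpace ℝ E] [FiniteDimensional ℝ E]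
  {H : Type*} [TopologicalSpace H] {I : ModelWithCorners ℝ E H} [I.Boundaryless]
  {E' : Type*} [NormedAddCommGroup E'] [NormedSpace ℝ E']
  {N : Type*} [TopologicalSpace N] [ChartedSpace H N] [IsManifold I ∞ N]

/-- Every linear map into a tangent space is the differential of a globally defined smooth map:
compose the inverse of a chart with a smooth map which is the identity near the base point and whose
values stay in the range of the chart. -/
theorem exists_contMDiff_mfderiv_eq (x : N) (A : E' →L[ℝ] E) :
    ∃ σ : E' → N, ContMDiff 𝓘(ℝ, E') I ∞ σ ∧ σ 0 = x ∧
      ∀ v : E', (mfderiv 𝓘(ℝ, E') I σ 0 v : E) = A v := by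
  obtain ⟨δ, hδ, hball⟩ := Metric.isOpen_iff.1 (isOpen_extChartAt_target (I := I) x) _
    (mem_extChartAt_target x)
  let f : ContDiffBump (0 : E) := ⟨δ / 2, δ, by positivity, by linarith⟩
  let h : E → E := fun u => extChartAt I x x + f u • u
  have hh : ContDiff ℝ ∞ h := contDiff_const.add (f.contDiff.smul contDiff_id)
  have hmem : ∀ u, h u ∈ (extChartAt I x).target := by
    intro u
    apply hball
    rw [Metric.mem_ball, dist_eq_norm]
    have e : h u - extChartAt I x x = f u • u := by simp [h]
    rw [e, norm_smul, Real.norm_of_nonneg f.nonneg]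
    by_cases hu : δ ≤ ‖u‖
    · rw [f.zero_of_le_dist (by simpa [f] using hu), zero_mul]
      exact hδ
    · exact lt_of_le_of_lt (mul_le_of_le_one_left (norm_nonneg u) f.le_one) (not_le.1 hu)
  have hh0 : h =ᶠ[𝓝 0] fun u => extChartAt I x x + u := by
    filter_upwards [f.eventuallyEq_one] with u hu
    simp [h, hu]
  have hhA : HasFDerivAt (h ∘ A) A 0 := by
    have h1 : HasFDerivAt h (ContinuousLinearMap.id ℝ E) (A 0) := by
      rw [map_zero]
      exact ((hasFDerivAt_id (𝕜 := ℝ) (0 : E)).const_add _).congr_of_eventuallyEq hh0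
    simpa using h1.comp (0 : E') A.hasFDerivAt
  have h0 : (h ∘ A) 0 = extChartAt I x x := by simp [h]
  refine ⟨(extChartAt I x).symm ∘ h ∘ A, ?_, ?_, fun v => ?_⟩
  · rw [← contMDiffOn_univ]
    exact (contMDiffOn_extChartAt_symm x).comp
      (hh.comp A.contDiff).contMDiff.contMDiffOn fun u _ => hmem (A u)
  · simp only [Function.comp_apply] at h0 ⊢
    rw [h0, extChartAt_to_inv]
  · have h1 := mfderiv_comp_apply_of_eq (x := (0 : E')) (y := extChartAt I x x) (f := h ∘ A)
      (g := (extChartAt I x).symm) (I := 𝓘(ℝ, E')) (I' := 𝓘(ℝ, E)) (I'' := I)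
      (mdifferentiableAt_extChartAt_symm_of_mem (mem_extChartAt_target x))
      hhA.differentiableAt.mdifferentiableAt h0 v
    have h2 := mfderivWithin_range_extChartAt_symm (I := I) (x := x)
    rw [I.range_eq_univ, mfderivWithin_univ] at h2
    have h3 : (mfderiv 𝓘(ℝ, E') 𝓘(ℝ, E) (h ∘ A) 0 v : E) = A v := by
      rw [mfderiv_eq_fderiv, hhA.fderiv]; rfl
    refine Eq.trans h1 ?_
    exact (congrArg (fun D : E →L[ℝ] E => D _) h2).trans h3

omit [FiniteDimensional ℝ E] in
theorem localRep_eq_self {k : ℕ} (τ : DForm 𝓘(ℝ, E) E k) (x : E) :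
    localRep 𝓘(ℝ, E) τ x = fun u : E => (τ u : E [⋀^Fin k]→L[ℝ] ℝ) := by
  funext u
  have e : (mfderiv 𝓘(ℝ, E) 𝓘(ℝ, E) (extChartAt 𝓘(ℝ, E) x).symm u : E →L[ℝ] E) =
      ContinuousLinearMap.id ℝ E := by
    rw [mfderiv_eq_fderiv]
    exact fderiv_id
  exact (DForm.compContinuousLinearMap_congr (E := E) τ rfl e).trans (by ext; rfl)

omit [FiniteDimensional ℝ E] in
theorem extD_eq_extDeriv {k : ℕ} (τ : DForm 𝓘(ℝ, E) E k) (x : E) :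
    extD 𝓘(ℝ, E) τ x = extDeriv (fun u : E => (τ u : E [⋀^Fin k]→L[ℝ] ℝ)) x := by
  have e : (mfderiv 𝓘(ℝ, E) 𝓘(ℝ, E) (extChartAt 𝓘(ℝ, E) x) x : E →L[ℝ] E) =
        ContinuousLinearMap.id ℝ E := by
    rw [mfderiv_eq_fderiv]
    exact fderiv_id
  unfold extD
  rw [localRep_eq_self]
  have aux : ∀ (A A' : E [⋀^Fin (k+1)]→L[ℝ] ℝ) (B : E →L[ℝ] E), A = A' →
      B = ContinuousLinearMap.id ℝ E → A.compContinuousLinearMap B = A' := by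
    rintro A _ B rfl rfl; ext; rfl
  exact aux _ _ _ rfl e

omit [FiniteDimensional ℝ E] in
theorem HamReductive.SmoothForm.contDiff {k : ℕ} {τ : DForm 𝓘(ℝ, E) E k}
    (hτ : SmoothForm 𝓘(ℝ, E) τ) :
    ContDiff ℝ ∞ (F := E [⋀^Fin k]→L[ℝ] ℝ) (fun u : E => τ u) := by
  have h3 := hτ 0
  rw [localRep_eq_self] at h3
  have h4 : (extChartAt 𝓘(ℝ, E) (0 : E)).target = univ := by
    rw [extChartAt_model_space_eq_id]; rfl
  rw [h4] at h3
  exact contDiffOn_univ.1 h3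

/-- The exterior derivative of a `1`-form on the plane, in terms of its values on the coordinate
vector fields. -/
theorem extDeriv_plane {τ : ℝ × ℝ → (ℝ × ℝ) [⋀^Fin 1]→L[ℝ] ℝ}
    (hd : DifferentiableAt ℝ τ (0, 0)) {c c' : ℝ}
    (h1 : HasDerivAt (fun s => τ (s, 0) ![(0, 1)]) c 0)
    (h2 : HasDerivAt (fun t => τ (0, t) ![(1, 0)]) c' 0) :
    extDeriv τ (0, 0) ![(1, 0), (0, 1)] = c - c' := by
  have hv : ∀ v : Fin 1 → ℝ × ℝ, HasFDerivAt (fun u : ℝ × ℝ => τ u v)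
      (fderiv ℝ (fun u : ℝ × ℝ => τ u v) (0, 0)) (0, 0) := by
    intro v
    have h : DifferentiableAt ℝ (fun u : ℝ × ℝ => τ u v) (0, 0) :=
      ((ContinuousAlternatingMap.apply ℝ (ℝ × ℝ) ℝ v).differentiableAt).comp _ hd
    exact h.hasFDerivAt
  have h3 : HasDerivAt (fun s : ℝ => ((s, 0) : ℝ × ℝ)) (1, 0) 0 :=
    (hasDerivAt_id (0 : ℝ)).prodMk (hasDerivAt_const (0 : ℝ) (0 : ℝ))
  have h4 : HasDerivAt (fun s : ℝ => ((0, s) : ℝ × ℝ)) (0, 1) 0 :=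
    (hasDerivAt_const (0 : ℝ) (0 : ℝ)).prodMk (hasDerivAt_id (0 : ℝ))
  have h5 := ((hv ![(0, 1)]).comp_hasDerivAt (f := fun s : ℝ => ((s, 0) : ℝ × ℝ)) (0 : ℝ)
    h3).unique h1
  have h6 := ((hv ![(1, 0)]).comp_hasDerivAt (f := fun s : ℝ => ((0, s) : ℝ × ℝ)) (0 : ℝ)
    h4).unique h2
  rw [← h5, ← h6, extDeriv_apply hd, Fin.sum_univ_two]
  have e0 : (0 : Fin 2).removeNth ![((1, 0) : ℝ × ℝ), ((0, 1) : ℝ × ℝ)] = ![(0, 1)] := by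
    funext i; fin_cases i; rfl
  have e1 : (1 : Fin 2).removeNth ![((1, 0) : ℝ × ℝ), ((0, 1) : ℝ × ℝ)] = ![(1, 0)] := by
    funext i; fin_cases i; rfl
  rw [e0, e1]
  simp [sub_eq_add_neg]

end Surfaces

section ThetaForm

open Filter Topology Set

variable {E : Type*} [NormedAddCommGroup E] [NormedSpace ℝ E] [FiniteDimensional ℝ E]
  {G : Type*} [TopologicalSpace G] [ChartedSpace E G] [Group G] [LieGroup 𝓘(ℝ, E) ∞ G]

omit [FiniteDimensional ℝ E] in
/-- Coordinate expression of the left Maurer-Cartan form: `D₂` of the coordinate expression of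
`(g, h) ↦ g⁻¹ h`, on the diagonal. -/
theorem maurerCartan_chart_eq {g₀ : G} {u : E} (hu : u ∈ (extChartAt 𝓘(ℝ, E) g₀).target) (v : E) :
    maurerCartan (E := E) ((extChartAt 𝓘(ℝ, E) g₀).symm u)
      (mfderiv 𝓘(ℝ, E) 𝓘(ℝ, E) (extChartAt 𝓘(ℝ, E) g₀).symm u v : E) =
    fderiv ℝ (fun w => extChartAt 𝓘(ℝ, E) (1 : G) (((extChartAt 𝓘(ℝ, E) g₀).symm u)⁻¹ *
      (extChartAt 𝓘(ℝ, E) g₀).symm w)) u v := by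
  set g := (extChartAt 𝓘(ℝ, E) g₀).symm u with hg
  have h1 := mdifferentiableAt_extChartAt_symm_of_mem hu
  have h2 := mfderiv_comp_apply_of_eq (x := u) (y := g) (f := (extChartAt 𝓘(ℝ, E) g₀).symm)
    (g := fun h : G => g⁻¹ * h) (mdifferentiable_mul_left_const (E := E) g⁻¹ g) h1 hg.symm v
  have h3 : MDifferentiableAt 𝓘(ℝ, E) 𝓘(ℝ, E)
      ((fun h : G => g⁻¹ * h) ∘ (extChartAt 𝓘(ℝ, E) g₀).symm) u :=
    (mdifferentiable_mul_left_const (E := E) g⁻¹ _).comp u h1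
  have h4 : ((fun h : G => g⁻¹ * h) ∘ (extChartAt 𝓘(ℝ, E) g₀).symm) u = 1 := by
    rw [Function.comp_apply, ← hg, inv_mul_cancel]
  have h5 := mfderiv_comp_apply_of_eq (x := u) (y := 1) (g := extChartAt 𝓘(ℝ, E) (1 : G))
    (mdifferentiableAt_extChartAt (mem_chart_source E (1 : G))) h3 h4 v
  rw [mfderiv_extChartAt_self, mfderiv_eq_fderiv] at h5
  exact h2.symm.trans h5.symm

variable {K : Subgroup G} {Θ : G →* G} {M : Type*} [MulAction G M] [TopologicalSpace M]
  {F : Type*} [NormedAddCommGroup F] [NormedSpace ℝ F] [FiniteDimensional ℝ F]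
  {Y : SubMulAction K M} [ChartedSpace F Y] [IsManifold 𝓘(ℝ, F) ∞ Y] {Φ : M → StrongDual ℝ E}

theorem smoothForm_thetaForm (hΦ : ContMDiff 𝓘(ℝ, F) 𝓘(ℝ, StrongDual ℝ E) ∞ fun y : Y => Φ y) :
    SmoothForm (𝓘(ℝ, E).prod 𝓘(ℝ, F)) (thetaForm Θ Y Φ) := by
  rintro ⟨g₀, y₀⟩ u hu
  apply ContDiffAt.contDiffWithinAt
  apply contDiffAt_alternating_of_apply
  intro v
  have htgt : (extChartAt (𝓘(ℝ, E).prod 𝓘(ℝ, F)) (g₀, y₀)).target =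
      (extChartAt 𝓘(ℝ, E) g₀).target ×ˢ (extChartAt 𝓘(ℝ, F) y₀).target := by
    rw [extChartAt_prod]; rfl
  have hloc : ∀ w ∈ (extChartAt (𝓘(ℝ, E).prod 𝓘(ℝ, F)) (g₀, y₀)).target,
      localRep (𝓘(ℝ, E).prod 𝓘(ℝ, F)) (thetaForm Θ Y Φ) (g₀, y₀) w v =
      Φ ((extChartAt 𝓘(ℝ, F) y₀).symm w.2) (kProj Θ (fderiv ℝ (fun w' =>
        extChartAt 𝓘(ℝ, E) (1 : G) (((extChartAt 𝓘(ℝ, E) g₀).symm w.1)⁻¹ *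
          (extChartAt 𝓘(ℝ, E) g₀).symm w')) w.1 (v 0).1)) := by
    intro w hw
    have hw1 : w.1 ∈ (extChartAt 𝓘(ℝ, E) g₀).target := by
      rw [htgt] at hw; exact hw.1
    rw [← maurerCartan_chart_eq hw1]
    have h1 : MDifferentiableAt 𝓘(ℝ, E × F) (𝓘(ℝ, E).prod 𝓘(ℝ, F))
        (extChartAt (𝓘(ℝ, E).prod 𝓘(ℝ, F)) (g₀, y₀)).symm w :=
      mdifferentiableAt_extChartAt_symm_of_mem hw
    have h2 := mfderiv_comp_apply (I' := 𝓘(ℝ, E).prod 𝓘(ℝ, F)) (I'' := 𝓘(ℝ, E)) w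
      (g := (Prod.fst : G × Y → G)) mdifferentiableAt_fst h1 (v 0)
    have h3 : (Prod.fst : G × Y → G) ∘ (extChartAt (𝓘(ℝ, E).prod 𝓘(ℝ, F)) (g₀, y₀)).symm =
        (extChartAt 𝓘(ℝ, E) g₀).symm ∘ Prod.fst := by
      rw [extChartAt_prod]; rfl
    have h4 := mfderiv_comp_apply (I := 𝓘(ℝ, E × F)) (I' := 𝓘(ℝ, E)) (I'' := 𝓘(ℝ, E)) w
      (g := (extChartAt 𝓘(ℝ, E) g₀).symm) (f := (Prod.fst : E × F → E))
      (mdifferentiableAt_extChartAt_symm_of_mem hw1)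
      (contDiff_fst.contMDiff.mdifferentiable (n := ∞) (by simp) w) (v 0)
    rw [h3] at h2
    have h5 : ((mfderiv 𝓘(ℝ, E × F) 𝓘(ℝ, E) ((extChartAt 𝓘(ℝ, E) g₀).symm ∘ Prod.fst) w (v 0) :
        E)) = mfderiv 𝓘(ℝ, E) 𝓘(ℝ, E) (extChartAt 𝓘(ℝ, E) g₀).symm w.1 (v 0).1 := by
      rw [mfderiv_eq_fderiv, fderiv_fst] at h4
      exact h4
    have h6 := h2.symm.trans h5
    rw [mfderiv_fst] at h6
    have h7 : (extChartAt (𝓘(ℝ, E).prod 𝓘(ℝ, F)) (g₀, y₀)).symm w =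
      ((extChartAt 𝓘(ℝ, E) g₀).symm w.1, (extChartAt 𝓘(ℝ, F) y₀).symm w.2) := by
      rw [extChartAt_prod]; rfl
    have key : ∀ (q : G × Y) (V V' : E),
        q = ((extChartAt 𝓘(ℝ, E) g₀).symm w.1, (extChartAt 𝓘(ℝ, F) y₀).symm w.2) → V = V' →
        Φ (q.2 : M) (kProj Θ (maurerCartan q.1 V)) =
          Φ ((extChartAt 𝓘(ℝ, F) y₀).symm w.2) (kProj Θ (maurerCartan (E := E)
            ((extChartAt 𝓘(ℝ, E) g₀).symm w.1) V')) := by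
      rintro _ _ _ rfl rfl; rfl
    exact key _ _ _ h7 h6
  have hu' := hu
  rw [htgt] at hu'
  have hA : ContDiffAt ℝ ∞ (fun w : E × F => Φ ((extChartAt 𝓘(ℝ, F) y₀).symm w.2)) u := by
    have h1 : ContMDiffAt 𝓘(ℝ, F) 𝓘(ℝ, StrongDual ℝ E) ∞
        ((fun y : Y => Φ y) ∘ (extChartAt 𝓘(ℝ, F) y₀).symm) u.2 :=
      hΦ.contMDiffAt.comp _ ((contMDiffOn_extChartAt_symm y₀).contMDiffAt
        ((isOpen_extChartAt_target y₀).mem_nhds hu'.2))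
    exact h1.contDiffAt.comp u contDiffAt_snd
  have hB : ContDiffAt ℝ ∞ (fun w : E × F => fderiv ℝ (fun w' =>
        extChartAt 𝓘(ℝ, E) (1 : G) (((extChartAt 𝓘(ℝ, E) g₀).symm w.1)⁻¹ *
          (extChartAt 𝓘(ℝ, E) g₀).symm w')) w.1) u := by
    refine ContDiffAt.fderiv (n := ∞) (f := fun (w : E × F) (w' : E) =>
        extChartAt 𝓘(ℝ, E) (1 : G) (((extChartAt 𝓘(ℝ, E) g₀).symm w.1)⁻¹ *
          (extChartAt 𝓘(ℝ, E) g₀).symm w')) ?_ contDiffAt_fst (by simp)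
    have hs : ContMDiffAt 𝓘(ℝ, E) 𝓘(ℝ, E) ∞ (extChartAt 𝓘(ℝ, E) g₀).symm u.1 :=
      (contMDiffOn_extChartAt_symm g₀).contMDiffAt ((isOpen_extChartAt_target g₀).mem_nhds hu'.1)
    have h1 : ContMDiffAt 𝓘(ℝ, (E × F) × E) 𝓘(ℝ, E) ∞
        (fun z : (E × F) × E => (extChartAt 𝓘(ℝ, E) g₀).symm z.1.1) (u, u.1) :=
      hs.comp (u, u.1) (f := fun z : (E × F) × E => z.1.1)
        (contDiff_fst.comp contDiff_fst).contMDiff.contMDiffAt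
    have h2 : ContMDiffAt 𝓘(ℝ, (E × F) × E) 𝓘(ℝ, E) ∞
        (fun z : (E × F) × E => (extChartAt 𝓘(ℝ, E) g₀).symm z.2) (u, u.1) :=
      hs.comp (u, u.1) (f := fun z : (E × F) × E => z.2) contDiff_snd.contMDiff.contMDiffAt
    have h3 := h1.inv.mul h2
    have h4 : ContMDiffAt 𝓘(ℝ, E) 𝓘(ℝ, E) ∞ (extChartAt 𝓘(ℝ, E) (1 : G))
        (((extChartAt 𝓘(ℝ, E) g₀).symm u.1)⁻¹ * (extChartAt 𝓘(ℝ, E) g₀).symm u.1) := by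
      rw [inv_mul_cancel]
      exact contMDiffAt_extChartAt
    exact (h4.comp (u, u.1) h3).contDiffAt
  have hC := hA.clm_apply ((kProj Θ).contDiff.contDiffAt.comp u
    (hB.clm_apply (contDiffAt_const (c := (v 0).1))))
  refine hC.congr_of_eventuallyEq ?_
  filter_upwards [(isOpen_extChartAt_target _).mem_nhds hu] with w hw using hloc w hw

end ThetaForm

section ThetaFormDerivative

open Filter Topology Set

variable {E : Type*} [NormedAddCommGroup E] [NormedSpace ℝ E] [FiniteDimensional ℝ E]
  {G : Type*} [TopologicalSpace G] [ChartedSpace E G] [Group G] [LieGroup 𝓘(ℝ, E) ∞ G]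

theorem mfderiv_line {E' : Type*} [NormedAddCommGroup E'] [NormedSpace ℝ E'] (a e : E') (t : ℝ) :
    MDifferentiableAt 𝓘(ℝ, ℝ) 𝓘(ℝ, E') (fun s : ℝ => a + s • e) t ∧
      (mfderiv 𝓘(ℝ, ℝ) 𝓘(ℝ, E') (fun s : ℝ => a + s • e) t (1 : ℝ) : E') = e := by
  have h : HasDerivAt (fun s : ℝ => a + s • e) e t := by
    simpa using ((hasDerivAt_id t).smul_const e).const_add a
  refine ⟨h.differentiableAt.mdifferentiableAt, ?_⟩
  rw [mfderiv_eq_fderiv, h.hasFDerivAt.fderiv]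
  exact one_smul ℝ e

omit [FiniteDimensional ℝ E] in
/-- The left Maurer-Cartan form measures the velocity of a curve after translation to `1`. -/
theorem maurerCartan_mfderiv_line {E' : Type*} [NormedAddCommGroup E'] [NormedSpace ℝ E']
    {f : E' → G} (hf : MDifferentiable 𝓘(ℝ, E') 𝓘(ℝ, E) f) (z e : E') :
    maurerCartan (E := E) (f z) (mfderiv 𝓘(ℝ, E') 𝓘(ℝ, E) f z e : E) =
      mfderiv 𝓘(ℝ, ℝ) 𝓘(ℝ, E) (fun s : ℝ => (f z)⁻¹ * f (z + s • e)) 0 (1 : ℝ) := by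
  have h0 : z + (0 : ℝ) • e = z := by simp
  have h1 := mfderiv_comp_curve (f := fun w => (f z)⁻¹ * f w) h0
    ((mdifferentiable_mul_left_const (E := E) (f z)⁻¹ _).comp z (hf z)) (mfderiv_line z e 0).1
    (mfderiv_line z e 0).2
  have h2 := mfderiv_comp_apply (I := 𝓘(ℝ, E')) z
    (mdifferentiable_mul_left_const (E := E) (f z)⁻¹ (f z)) (hf z) e
  exact h2.symm.trans h1.symm

variable {K : Subgroup G} {Θ : G →* G} {M : Type*} [MulAction G M] [TopologicalSpace M]
  {F : Type*} [NormedAddCommGroup F] [NormedSpace ℝ F] [FiniteDimensional ℝ F]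
  {Y : SubMulAction K M} [ChartedSpace F Y] [IsManifold 𝓘(ℝ, F) ∞ Y] {Φ : M → StrongDual ℝ E}

/-- The exterior derivative of `⟨Φ, θ⟩` on the tangent vectors `(V₁, v)` and `(V₂, w)`, where `V₁`
and `V₂` are the values of a right-invariant and a left-invariant vector field: it is read off from
the surface `(s, t) ↦ (κ(s) g η(t), υ(s, t))`, on which the form is given by `Φ(υ(s, t))` evaluated
at velocities which depend on `t` only. -/
theorem extD_thetaForm_apply
    (hΦ : ContMDiff 𝓘(ℝ, F) 𝓘(ℝ, StrongDual ℝ E) ∞ fun y : Y => Φ y)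
    (hk : ∀ (y : Y) (X : E), Φ (y : M) X = Φ (y : M) (kProj Θ X))
    (heq : ∀ (g : G) (y : Y) (X : E), Φ (g • (y : M)) X = Φ (y : M) (Ad g⁻¹ X))
    {g : G} {y : Y} {X W V₁ V₂ : E} {v w : F} {c c' : ℝ}
    (hV₁ : (mfderiv 𝓘(ℝ, E) 𝓘(ℝ, E) (fun h : G => h * g) 1 X : E) = V₁)
    (hV₂ : (mfderiv 𝓘(ℝ, E) 𝓘(ℝ, E) (fun h : G => g * h) 1 W : E) = V₂)
    (hc : (mfderiv 𝓘(ℝ, F) 𝓘(ℝ, ℝ) (fun y' : Y => Φ y' W) y v : ℝ) = c)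
    (hf : MDifferentiableAt (𝓘(ℝ, E).prod 𝓘(ℝ, F)) 𝓘(ℝ, ℝ)
      (fun p : G × Y => Φ (p.1 • (p.2 : M)) X) (g, y))
    (hc' : (mfderiv (𝓘(ℝ, E).prod 𝓘(ℝ, F)) 𝓘(ℝ, ℝ) (fun p : G × Y => Φ (p.1 • (p.2 : M)) X) (g, y)
      ((V₂, w) : E × F) : ℝ) = c') :
    (extD (𝓘(ℝ, E).prod 𝓘(ℝ, F)) (thetaForm Θ Y Φ) (g, y)
      ![((V₁, v) : E × F), ((V₂, w) : E × F)] : ℝ) = c - c' := by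
  obtain ⟨κ, hκ, hκ0, hκX⟩ := exists_contMDiff_mfderiv_eq (I := 𝓘(ℝ, E)) (1 : G)
    (ContinuousLinearMap.smulRight (1 : ℝ →L[ℝ] ℝ) X)
  obtain ⟨η, hη, hη0, hηW⟩ := exists_contMDiff_mfderiv_eq (I := 𝓘(ℝ, E)) (1 : G)
    (ContinuousLinearMap.smulRight (1 : ℝ →L[ℝ] ℝ) W)
  obtain ⟨υ, hυ, hυ0, hυA⟩ := exists_contMDiff_mfderiv_eq (I := 𝓘(ℝ, F)) y
    ((ContinuousLinearMap.fst ℝ ℝ ℝ).smulRight v + (ContinuousLinearMap.snd ℝ ℝ ℝ).smulRight w)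
  replace hκX : (mfderiv 𝓘(ℝ, ℝ) 𝓘(ℝ, E) κ 0 (1 : ℝ) : E) = X := (hκX 1).trans (one_smul ℝ X)
  replace hηW : (mfderiv 𝓘(ℝ, ℝ) 𝓘(ℝ, E) η 0 (1 : ℝ) : E) = W := (hηW 1).trans (one_smul ℝ W)
  have hυv : (mfderiv 𝓘(ℝ, ℝ × ℝ) 𝓘(ℝ, F) υ (0, 0) ((1, 0) : ℝ × ℝ) : F) = v :=
    (hυA (1, 0)).trans (show (1 : ℝ) • v + (0 : ℝ) • w = v by simp)
  have hυw : (mfderiv 𝓘(ℝ, ℝ × ℝ) 𝓘(ℝ, F) υ (0, 0) ((0, 1) : ℝ × ℝ) : F) = w :=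
    (hυA (0, 1)).trans (show (0 : ℝ) • v + (1 : ℝ) • w = w by simp)
  replace hυ0 : υ (0, 0) = y := hυ0
  let f : ℝ × ℝ → G := fun z => κ z.1 * g * η z.2
  have hfs : ContMDiff 𝓘(ℝ, ℝ × ℝ) 𝓘(ℝ, E) ∞ f :=
    ((hκ.comp contDiff_fst.contMDiff).mul contMDiff_const).mul (hη.comp contDiff_snd.contMDiff)
  have hfd := hfs.mdifferentiable (by simp)
  have hs : ContMDiff 𝓘(ℝ, ℝ × ℝ) (𝓘(ℝ, E).prod 𝓘(ℝ, F)) ∞ (fun z => (f z, υ z)) :=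
    hfs.prodMk hυ
  have hυd := hυ.mdifferentiable (by simp)
  have hDc : ∀ z e, (mfderiv 𝓘(ℝ, ℝ × ℝ) (𝓘(ℝ, E).prod 𝓘(ℝ, F)) (fun z => (f z, υ z)) z e : E × F) =
      ((mfderiv 𝓘(ℝ, ℝ × ℝ) 𝓘(ℝ, E) f z e : E), (mfderiv 𝓘(ℝ, ℝ × ℝ) 𝓘(ℝ, F) υ z e : F)) := by
    intro z e
    rw [mfderiv_prodMk (hfd z) (hυd z)]
    rfl
  -- The velocities of the surface along the coordinate lines, translated to `1`.
  have hmc1 : ∀ s : ℝ, maurerCartan (E := E) (f (s, 0))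
      (mfderiv 𝓘(ℝ, ℝ × ℝ) 𝓘(ℝ, E) f (s, 0) ((0, 1) : ℝ × ℝ) : E) = W := by
    intro s
    refine (maurerCartan_mfderiv_line hfd (s, 0) (0, 1)).trans ?_
    have e : (fun t : ℝ => (f (s, 0))⁻¹ * f ((s, 0) + t • ((0, 1) : ℝ × ℝ))) = η := by
      funext t
      simp [f, hη0, mul_assoc]
    rw [e]
    exact hηW
  have hmc2 : ∀ t : ℝ, maurerCartan (E := E) (f (0, t))
      (mfderiv 𝓘(ℝ, ℝ × ℝ) 𝓘(ℝ, E) f (0, t) ((1, 0) : ℝ × ℝ) : E) = Ad (g * η t)⁻¹ X := by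
    intro t
    refine (maurerCartan_mfderiv_line hfd (0, t) (1, 0)).trans ?_
    have e : (fun s : ℝ => (f (0, t))⁻¹ * f ((0, t) + s • ((1, 0) : ℝ × ℝ))) =
        (fun h : G => (g * η t)⁻¹ * h * (g * η t)⁻¹⁻¹) ∘ κ := by
      funext s
      simp [f, hκ0, mul_assoc]
    rw [e]
    exact mfderiv_comp_curve hκ0 (mdifferentiable_conj (E := E) _ 1)
      (hκ.mdifferentiable (by simp) 0) hκX
  have hpull := extD_pullbackForm (smoothForm_thetaForm (Θ := Θ) hΦ) hs
  have hsm := (smoothForm_thetaForm (Θ := Θ) hΦ).pullbackForm hs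
  set τ := pullbackForm 𝓘(ℝ, ℝ × ℝ) (𝓘(ℝ, E).prod 𝓘(ℝ, F)) (fun z => (f z, υ z)) (thetaForm Θ Y Φ)
    with hτ
  have hτe : ∀ z e : ℝ × ℝ, (τ z ![e] : ℝ) = Φ (υ z : M) (maurerCartan (E := E) (f z)
      (mfderiv 𝓘(ℝ, ℝ × ℝ) 𝓘(ℝ, E) f z e : E)) := by
    intro z e
    rw [hk]
    have h1 : (τ z ![e] : ℝ) = Φ (υ z : M) (kProj Θ (maurerCartan (E := E) (f z)
      (mfderiv 𝓘(ℝ, ℝ × ℝ) (𝓘(ℝ, E).prod 𝓘(ℝ, F)) (fun z => (f z, υ z)) z e : E × F).1)) := rfl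
    exact h1.trans (congrArg (fun V : E × F =>
      Φ (υ z : M) (kProj Θ (maurerCartan (E := E) (f z) V.1))) (hDc z e))
  have hline : ∀ (z e : ℝ × ℝ) (u : F), (mfderiv 𝓘(ℝ, ℝ × ℝ) 𝓘(ℝ, F) υ z e : F) = u →
      MDifferentiableAt 𝓘(ℝ, ℝ) 𝓘(ℝ, F) (fun s : ℝ => υ (z + s • e)) 0 ∧
      (mfderiv 𝓘(ℝ, ℝ) 𝓘(ℝ, F) (fun s : ℝ => υ (z + s • e)) 0 (1 : ℝ) : F) = u := by
    intro z e u hu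
    have h0 : z + (0 : ℝ) • e = z := by simp
    refine ⟨(hυd _).comp (0 : ℝ) (mfderiv_line z e 0).1, Eq.trans ?_ hu⟩
    exact mfderiv_comp_curve h0 (hυd z) (mfderiv_line z e 0).1 (mfderiv_line z e 0).2
  have hreal : ∀ (r : ℝ → ℝ) (a : ℝ), MDifferentiableAt 𝓘(ℝ, ℝ) 𝓘(ℝ, ℝ) r 0 →
      (mfderiv 𝓘(ℝ, ℝ) 𝓘(ℝ, ℝ) r 0 (1 : ℝ) : ℝ) = a → HasDerivAt r a 0 := by
    intro r a hr ha
    rw [mfderiv_eq_fderiv] at ha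
    have h1 := hr.differentiableAt.hasDerivAt
    rw [← fderiv_apply_one_eq_deriv] at h1
    exact ha ▸ h1
  have hd1 : HasDerivAt (fun s => (τ (s, 0) ![((0, 1) : ℝ × ℝ)] : ℝ)) c 0 := by
    have e : (fun s : ℝ => (τ (s, 0) ![((0, 1) : ℝ × ℝ)] : ℝ)) =
        (fun y' : Y => Φ (y' : M) W) ∘ fun s : ℝ => υ ((0, 0) + s • ((1, 0) : ℝ × ℝ)) := by
      funext s
      rw [hτe, hmc1]
      simp
    have hΦW : MDifferentiableAt 𝓘(ℝ, F) 𝓘(ℝ, ℝ) (fun y' : Y => Φ (y' : M) W) y :=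
      ((ContinuousLinearMap.apply ℝ ℝ W).contDiff.contMDiff.comp hΦ).mdifferentiable
        (n := ∞) (by simp) y
    have h0 : υ ((0, 0) + (0 : ℝ) • ((1, 0) : ℝ × ℝ)) = y := by simp [hυ0]
    obtain ⟨h1, h2⟩ := hline (0, 0) (1, 0) v hυv
    rw [e]
    refine hreal _ _ (MDifferentiableAt.comp (0 : ℝ) (h0.symm ▸ hΦW) h1) ?_
    exact (mfderiv_comp_curve h0 hΦW h1 h2).trans hc
  have hd2 : HasDerivAt (fun t => (τ (0, t) ![((1, 0) : ℝ × ℝ)] : ℝ)) c' 0 := by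
    have e : (fun t : ℝ => (τ (0, t) ![((1, 0) : ℝ × ℝ)] : ℝ)) =
        (fun p : G × Y => Φ (p.1 • (p.2 : M)) X) ∘
          fun t : ℝ => (g * η t, υ ((0, 0) + t • ((0, 1) : ℝ × ℝ))) := by
      funext t
      rw [hτe, hmc2, ← heq]
      simp
    have h0 : (g * η 0, υ ((0, 0) + (0 : ℝ) • ((0, 1) : ℝ × ℝ))) = (g, y) := by simp [hυ0, hη0]
    obtain ⟨h1, h2⟩ := hline (0, 0) (0, 1) w hυw
    have h3 : MDifferentiableAt 𝓘(ℝ, ℝ) 𝓘(ℝ, E) (fun t : ℝ => g * η t) 0 :=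
      (mdifferentiable_mul_left_const (E := E) g _).comp (0 : ℝ) (hη.mdifferentiable (by simp) 0)
    have h4 : (mfderiv 𝓘(ℝ, ℝ) 𝓘(ℝ, E) (fun t : ℝ => g * η t) 0 (1 : ℝ) : E) = V₂ :=
      (mfderiv_comp_curve hη0 (mdifferentiable_mul_left_const (E := E) g _)
        (hη.mdifferentiable (by simp) 0) hηW).trans hV₂
    have h5 : (mfderiv 𝓘(ℝ, ℝ) (𝓘(ℝ, E).prod 𝓘(ℝ, F))
        (fun t : ℝ => (g * η t, υ ((0, 0) + t • ((0, 1) : ℝ × ℝ)))) 0 (1 : ℝ) : E × F) =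
        (V₂, w) := by
      rw [mfderiv_prodMk h3 h1]
      exact Prod.ext h4 h2
    rw [e]
    refine hreal _ _ (MDifferentiableAt.comp (0 : ℝ) (h0.symm ▸ hf) (h3.prodMk h1)) ?_
    exact (mfderiv_comp_curve h0 hf (h3.prodMk h1) h5).trans hc'
  have h1 : (extD 𝓘(ℝ, ℝ × ℝ) τ (0, 0) ![((1, 0) : ℝ × ℝ), ((0, 1) : ℝ × ℝ)] : ℝ) = c - c' := by
    refine (congrArg (fun B : (ℝ × ℝ) [⋀^Fin 2]→L[ℝ] ℝ => B ![(1, 0), (0, 1)])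
      (extD_eq_extDeriv τ (0, 0))).trans ?_
    exact extDeriv_plane (hsm.contDiff.differentiable (by simp) (0, 0)) hd1 hd2
  have hf1 : (mfderiv 𝓘(ℝ, ℝ × ℝ) 𝓘(ℝ, E) f (0, 0) ((1, 0) : ℝ × ℝ) : E) = V₁ := by
    have h0 : ((0, 0) : ℝ × ℝ) + (0 : ℝ) • ((1, 0) : ℝ × ℝ) = (0, 0) := by simp
    refine (mfderiv_comp_curve (t := 0)
      (γ := fun s : ℝ => ((0, 0) : ℝ × ℝ) + s • ((1, 0) : ℝ × ℝ)) h0 (hfd _) (mfderiv_line _ _ 0).1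
      (mfderiv_line _ _ 0).2).symm.trans ?_
    have e : f ∘ (fun s : ℝ => ((0, 0) : ℝ × ℝ) + s • ((1, 0) : ℝ × ℝ)) =
        (fun h : G => h * g) ∘ κ := by
      funext s
      simp [f, hη0]
    rw [e, ← hV₁]
    exact mfderiv_comp_curve hκ0
      ((contMDiff_mul_right (I := 𝓘(ℝ, E)) (n := ∞) (a := g)).mdifferentiable (by simp) _)
      (hκ.mdifferentiable (by simp) 0) hκX
  have hf2 : (mfderiv 𝓘(ℝ, ℝ × ℝ) 𝓘(ℝ, E) f (0, 0) ((0, 1) : ℝ × ℝ) : E) = V₂ := by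
    have h0 : ((0, 0) : ℝ × ℝ) + (0 : ℝ) • ((0, 1) : ℝ × ℝ) = (0, 0) := by simp
    refine (mfderiv_comp_curve (t := 0)
      (γ := fun s : ℝ => ((0, 0) : ℝ × ℝ) + s • ((0, 1) : ℝ × ℝ)) h0 (hfd _) (mfderiv_line _ _ 0).1
      (mfderiv_line _ _ 0).2).symm.trans ?_
    have e : f ∘ (fun s : ℝ => ((0, 0) : ℝ × ℝ) + s • ((0, 1) : ℝ × ℝ)) =
        (fun h : G => g * h) ∘ η := by
      funext s
      simp [f, hκ0]
    rw [e, ← hV₂]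
    exact mfderiv_comp_curve hη0 (mdifferentiable_mul_left_const (E := E) g _)
      (hη.mdifferentiable (by simp) 0) hηW
  have key : ∀ (q : G × Y) (ξ₁ ξ₂ : E × F), q = (g, y) → ξ₁ = (V₁, v) → ξ₂ = (V₂, w) →
      (extD (𝓘(ℝ, E).prod 𝓘(ℝ, F)) (thetaForm Θ Y Φ) (g, y)
        ![((V₁, v) : E × F), ((V₂, w) : E × F)] : ℝ) =
      (extD (𝓘(ℝ, E).prod 𝓘(ℝ, F)) (thetaForm Θ Y Φ) q ![ξ₁, ξ₂] : ℝ) := by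
    rintro _ _ _ rfl rfl rfl; rfl
  have h2 := congrArg (fun B : (ℝ × ℝ) [⋀^Fin 2]→L[ℝ] ℝ => B ![(1, 0), (0, 1)])
    (congrFun hpull (0, 0))
  have h3 := pullbackForm_two_apply (I := 𝓘(ℝ, ℝ × ℝ)) (fun z => (f z, υ z))
    (extD (𝓘(ℝ, E).prod 𝓘(ℝ, F)) (thetaForm Θ Y Φ)) (0, 0) ((1, 0) : ℝ × ℝ) ((0, 1) : ℝ × ℝ)
  have h4 : (f (0, 0), υ (0, 0)) = (g, y) := by simp [f, hκ0, hη0, hυ0]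
  have h5 := key _ _ _ h4 ((hDc (0, 0) (1, 0)).trans (Prod.ext hf1 hυv))
    ((hDc (0, 0) (0, 1)).trans (Prod.ext hf2 hυw))
  exact h5.trans (h3.symm.trans (h2.symm.trans h1))

end ThetaFormDerivative

/-! ### The pull-back of the symplectic form under the action map -/

section ActionMap

open Filter Topology Set

variable {E : Type*} [NormedAddCommGroup E] [NormedSpace ℝ E]
  {G : Type*} [TopologicalSpace G] [ChartedSpace E G] [Group G] [LieGroup 𝓘(ℝ, E) ∞ G]
  {E' : Type*} [NormedAddCommGroup E'] [NormedSpace ℝ E']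
  {M : Type*} [TopologicalSpace M] [ChartedSpace E' M] [MulAction G M]
  {Ω : DForm 𝓘(ℝ, E') M 2} {Φ : M → StrongDual ℝ E}
  {K : Subgroup G} {Θ : G →* G}
  {F : Type*} [NormedAddCommGroup F] [NormedSpace ℝ F]
  {Y : SubMulAction K M} [ChartedSpace F Y]

omit [LieGroup 𝓘(ℝ, E) ∞ G] in
theorem neg_generator (X : E) (m : M) : -(generator (L := G) (F := E') X m : E') =
    (mfderiv 𝓘(ℝ, E) 𝓘(ℝ, E') (fun g : G => g • m) (1 : G) X : E') :=
  neg_neg (_ : E')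

namespace HamReductive.IsHamiltonian

variable (hM : IsHamiltonian G Ω Φ)
include hM

/-- The action map sends right-invariant vector fields to generators of the action, up to sign. -/
theorem mfderiv_orbit_right (g : G) (m : M) (X : E) :
    (mfderiv 𝓘(ℝ, E) 𝓘(ℝ, E') (fun h : G => h • m) g
      (mfderiv 𝓘(ℝ, E) 𝓘(ℝ, E) (fun h : G => h * g) 1 X : E) : E') =
      -(generator (L := G) (F := E') X (g • m) : E') := by
  rw [neg_generator]
  have h1 := mfderiv_comp_apply_of_eq (x := (1 : G)) (y := g) (f := fun h : G => h * g)
    (g := fun h : G => h • m) ((hM.contMDiff_orbit m).mdifferentiable (by simp) g)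
    ((contMDiff_mul_right (I := 𝓘(ℝ, E)) (n := ∞) (a := g)).mdifferentiable (by simp) 1)
    (one_mul g) X
  have e : (fun h : G => h • m) ∘ (fun h : G => h * g) = fun h : G => h • (g • m) := by
    funext h; exact mul_smul h g m
  rw [e] at h1
  exact h1.symm

/-- The action map sends left-invariant vector fields to translates of generators, up to sign. -/
theorem mfderiv_orbit_left (g : G) (m : M) (W : E) :
    (mfderiv 𝓘(ℝ, E) 𝓘(ℝ, E') (fun h : G => h • m) g
      (mfderiv 𝓘(ℝ, E) 𝓘(ℝ, E) (fun h : G => g * h) 1 W : E) : E') =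
      mfderiv 𝓘(ℝ, E') 𝓘(ℝ, E') (fun m' : M => g • m') m
        (-(generator (L := G) (F := E') W m : E') : E') := by
  rw [neg_generator]
  have h1 := mfderiv_comp_apply_of_eq (x := (1 : G)) (y := g) (f := fun h : G => g * h)
    (g := fun h : G => h • m) ((hM.contMDiff_orbit m).mdifferentiable (by simp) g)
    (mdifferentiable_mul_left_const (E := E) g 1) (mul_one g) W
  have h2 := mfderiv_comp_apply_of_eq (x := (1 : G)) (y := m) (f := fun h : G => h • m)
    (g := fun m' : M => g • m') ((hM.contMDiff_const_smul g).mdifferentiable (by simp) m)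
    ((hM.contMDiff_orbit m).mdifferentiable (by simp) 1) (one_smul G m) W
  have e : (fun h : G => h • m) ∘ (fun h : G => g * h) =
      (fun m' : M => g • m') ∘ fun h : G => h • m := by
    funext h; exact mul_smul g h m
  rw [e] at h1
  exact h1.symm.trans h2

omit [LieGroup 𝓘(ℝ, E) ∞ G] in
theorem contMDiff_smul_val (hval : ContMDiff 𝓘(ℝ, F) 𝓘(ℝ, E') ∞ (Subtype.val : Y → M)) :
    ContMDiff (𝓘(ℝ, E).prod 𝓘(ℝ, F)) 𝓘(ℝ, E') ∞ (fun p : G × Y => p.1 • (p.2 : M)) :=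
  hM.contMDiff_smul_prod.comp (contMDiff_fst.prodMk (hval.comp contMDiff_snd))

omit [LieGroup 𝓘(ℝ, E) ∞ G] in
theorem mfderiv_smul_val (hval : ContMDiff 𝓘(ℝ, F) 𝓘(ℝ, E') ∞ (Subtype.val : Y → M)) (g : G) (y : Y)
    (V : E) (v : F) :
    (mfderiv (𝓘(ℝ, E).prod 𝓘(ℝ, F)) 𝓘(ℝ, E') (fun p : G × Y => p.1 • (p.2 : M)) (g, y)
      ((V, v) : E × F) : E') =
    (mfderiv 𝓘(ℝ, E) 𝓘(ℝ, E') (fun h : G => h • (y : M)) g V : E') +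
      (mfderiv 𝓘(ℝ, E') 𝓘(ℝ, E') (fun m : M => g • m) (y : M)
        (mfderiv 𝓘(ℝ, F) 𝓘(ℝ, E') (Subtype.val : Y → M) y v : E') : E') := by
  have h1 := mfderiv_prod_eq_add_apply (p := ((g, y) : G × Y)) (v := ((V, v) : E × F))
    ((hM.contMDiff_smul_val hval).mdifferentiable (by simp) (g, y))
  have h2 := mfderiv_comp_apply y ((hM.contMDiff_const_smul g).mdifferentiable (by simp) (y : M))
    (hval.mdifferentiable (by simp) y) v
  let a : E' := mfderiv 𝓘(ℝ, E) 𝓘(ℝ, E') (fun h : G => h • (y : M)) g V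
  exact h1.trans (congrArg (fun u : E' => a + u) h2)

omit [LieGroup 𝓘(ℝ, E) ∞ G] in
theorem symplectic_smul (g : G) (m : M) (u v : E') :
    (Ω (g • m) ![(mfderiv 𝓘(ℝ, E') 𝓘(ℝ, E') (fun m : M => g • m) m u : E'),
      (mfderiv 𝓘(ℝ, E') 𝓘(ℝ, E') (fun m : M => g • m) m v : E')] : ℝ) = Ω m ![u, v] := by
  have h1 := pullbackForm_two_apply (I := 𝓘(ℝ, E')) (fun m : M => g • m) Ω m u v
  have h2 := congrArg (fun B : E' [⋀^Fin 2]→L[ℝ] ℝ => B ![u, v]) (congrFun (hM.invariant g) m)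
  exact h1.symm.trans h2

end HamReductive.IsHamiltonian

/-- Translations by `g` from either side identify the tangent spaces at `1` and at `g`. -/
theorem exists_mfderiv_mul_right_eq (g : G) (V : E) :
    ∃ X : E, (mfderiv 𝓘(ℝ, E) 𝓘(ℝ, E) (fun h : G => h * g) 1 X : E) = V := by
  have hr : ∀ a : G, MDifferentiable 𝓘(ℝ, E) 𝓘(ℝ, E) (fun h : G => h * a) := fun a =>
    (contMDiff_mul_right (I := 𝓘(ℝ, E)) (n := ∞) (a := a)).mdifferentiable (by simp)
  refine ⟨mfderiv 𝓘(ℝ, E) 𝓘(ℝ, E) (fun h : G => h * g⁻¹) g V, ?_⟩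
  have h1 := mfderiv_comp_apply_of_eq (x := g) (y := 1) (f := fun h : G => h * g⁻¹)
    (g := fun h : G => h * g) (hr g 1) (hr g⁻¹ g) (mul_inv_cancel g) V
  have e : (fun h : G => h * g) ∘ (fun h : G => h * g⁻¹) = id := by funext h; simp
  rw [e, mfderiv_id] at h1
  exact h1.symm

theorem exists_mfderiv_mul_left_eq (g : G) (V : E) :
    ∃ X : E, (mfderiv 𝓘(ℝ, E) 𝓘(ℝ, E) (fun h : G => g * h) 1 X : E) = V := by
  refine ⟨mfderiv 𝓘(ℝ, E) 𝓘(ℝ, E) (fun h : G => g⁻¹ * h) g V, ?_⟩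
  have h1 := mfderiv_comp_apply_of_eq (x := g) (y := 1) (f := fun h : G => g⁻¹ * h)
    (g := fun h : G => g * h) (mdifferentiable_mul_left_const (E := E) g 1)
    (mdifferentiable_mul_left_const (E := E) g⁻¹ g) (inv_mul_cancel g) V
  have e : (fun h : G => g * h) ∘ (fun h : G => g⁻¹ * h) = id := by funext h; simp
  rw [e, mfderiv_id] at h1
  exact h1.symm

/-- The action map `G × Y → M` pulls the symplectic form back to `Ω_Y - d⟨Φ, θ⟩`. -/
theorem HamReductive.IsHamiltonian.pullbackForm_smul_val [FiniteDimensional ℝ E]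
    [FiniteDimensional ℝ F] [IsManifold 𝓘(ℝ, F) ∞ Y] (hM : IsHamiltonian G Ω Φ)
    (hval : ContMDiff 𝓘(ℝ, F) 𝓘(ℝ, E') ∞ (Subtype.val : Y → M))
    (hk : ∀ (y : Y) (X : E), Φ (y : M) X = Φ (y : M) (kProj Θ X)) :
    pullbackForm (𝓘(ℝ, E).prod 𝓘(ℝ, F)) 𝓘(ℝ, E') (fun p : G × Y => p.1 • (p.2 : M)) Ω =
      pullbackForm (𝓘(ℝ, E).prod 𝓘(ℝ, F)) 𝓘(ℝ, F) (Prod.snd : G × Y → Y)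
        (pullbackForm 𝓘(ℝ, F) 𝓘(ℝ, E') (Subtype.val : Y → M) Ω) -
      extD (𝓘(ℝ, E).prod 𝓘(ℝ, F)) (thetaForm Θ Y Φ) := by
  funext p
  obtain ⟨g, y⟩ := p
  suffices h : ∀ (V₁ V₂ : E) (v w : F),
      (pullbackForm (𝓘(ℝ, E).prod 𝓘(ℝ, F)) 𝓘(ℝ, E') (fun p : G × Y => p.1 • (p.2 : M)) Ω (g, y)
        ![((V₁, v) : E × F), ((V₂, w) : E × F)] : ℝ) =
      (pullbackForm (𝓘(ℝ, E).prod 𝓘(ℝ, F)) 𝓘(ℝ, F) (Prod.snd : G × Y → Y)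
        (pullbackForm 𝓘(ℝ, F) 𝓘(ℝ, E') (Subtype.val : Y → M) Ω) (g, y)
          ![((V₁, v) : E × F), ((V₂, w) : E × F)] : ℝ) -
      (extD (𝓘(ℝ, E).prod 𝓘(ℝ, F)) (thetaForm Θ Y Φ) (g, y)
        ![((V₁, v) : E × F), ((V₂, w) : E × F)] : ℝ) by
    refine ContinuousAlternatingMap.ext fun ξ => ?_
    have e : ξ = ![(((ξ 0 : E × F).1, (ξ 0 : E × F).2) : E × F),
        (((ξ 1 : E × F).1, (ξ 1 : E × F).2) : E × F)] := by
      funext i; fin_cases i <;> rfl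
    rw [e]
    exact h _ _ _ _
  intro V₁ V₂ v w
  obtain ⟨X, hX⟩ := exists_mfderiv_mul_right_eq g V₁
  obtain ⟨W, hW⟩ := exists_mfderiv_mul_left_eq g V₂
  have hvd := hval.mdifferentiable (by simp)
  have had := (hM.contMDiff_smul_val hval).mdifferentiable (by simp) (g, y)
  have hΦd := fun X m => (hM.contMDiff_moment_apply X).mdifferentiable (by simp) m
  let ι : F → E' := fun v => mfderiv 𝓘(ℝ, F) 𝓘(ℝ, E') (Subtype.val : Y → M) y v
  let A : E' → E' := fun u => mfderiv 𝓘(ℝ, E') 𝓘(ℝ, E') (fun m : M => g • m) (y : M) u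
  let gen : E → M → E' := fun X m => generator (L := G) (F := E') X m
  let D : E' := mfderiv (𝓘(ℝ, E).prod 𝓘(ℝ, F)) 𝓘(ℝ, E') (fun p : G × Y => p.1 • (p.2 : M)) (g, y)
    ((V₂, w) : E × F)
  have hD1 : (mfderiv (𝓘(ℝ, E).prod 𝓘(ℝ, F)) 𝓘(ℝ, E') (fun p : G × Y => p.1 • (p.2 : M)) (g, y)
      ((V₁, v) : E × F) : E') = -gen X (g • (y : M)) + A (ι v) := by
    refine (hM.mfderiv_smul_val hval g y V₁ v).trans ?_
    rw [← hX]
    exact congrArg (fun u : E' => u + A (ι v)) (hM.mfderiv_orbit_right g y X)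
  have hD2 : D = A (-gen W y + ι w) := by
    refine (hM.mfderiv_smul_val hval g y V₂ w).trans ?_
    rw [← hW]
    refine (congrArg (fun u : E' => u + A (ι w)) (hM.mfderiv_orbit_left g y W)).trans ?_
    exact ((mfderiv 𝓘(ℝ, E') 𝓘(ℝ, E') (fun m : M => g • m) (y : M)).map_add _ _).symm
  have hc : (mfderiv 𝓘(ℝ, F) 𝓘(ℝ, ℝ) (fun y' : Y => Φ (y' : M) W) y v : ℝ) =
      -Ω y ![gen W y, ι v] := by
    refine (mfderiv_comp_apply y (hΦd W y) (hvd y) v).trans ?_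
    exact neg_eq_iff_eq_neg.1 (hM.moment W y (ι v)).symm
  have hc' : (mfderiv (𝓘(ℝ, E).prod 𝓘(ℝ, F)) 𝓘(ℝ, ℝ) (fun p : G × Y => Φ (p.1 • (p.2 : M)) X) (g, y)
      ((V₂, w) : E × F) : ℝ) = -Ω (g • (y : M)) ![gen X (g • (y : M)), D] := by
    refine (mfderiv_comp_apply (I := 𝓘(ℝ, E).prod 𝓘(ℝ, F)) (g, y)
      (hΦd X (g • (y : M))) had ((V₂, w) : E × F)).trans ?_
    exact neg_eq_iff_eq_neg.1 (hM.moment X (g • (y : M)) D).symm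
  have hext := extD_thetaForm_apply (Θ := Θ) (hM.smooth_moment.comp hval) hk
    (fun g y X => hM.moment_smul_apply g y X) hX hW hc
    ((hΦd X (g • (y : M))).comp (g, y) had) hc'
  rw [hext]
  have e1 := pullbackForm_two_apply (I := 𝓘(ℝ, E).prod 𝓘(ℝ, F))
    (fun p : G × Y => p.1 • (p.2 : M)) Ω (g, y) ((V₁, v) : E × F) ((V₂, w) : E × F)
  have e2 := pullbackForm_two_apply (I := 𝓘(ℝ, E).prod 𝓘(ℝ, F)) (Prod.snd : G × Y → Y)
    (pullbackForm 𝓘(ℝ, F) 𝓘(ℝ, E') (Subtype.val : Y → M) Ω) (g, y) ((V₁, v) : E × F)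
    ((V₂, w) : E × F)
  rw [mfderiv_snd] at e2
  have e3 := pullbackForm_two_apply (I := 𝓘(ℝ, F)) (Subtype.val : Y → M) Ω y v w
  have e4 := e2.trans e3
  refine e1.trans (Eq.trans ?_ (congrArg (fun r : ℝ => r - _) e4).symm)
  let B : E' [⋀^Fin 2]→L[ℝ] ℝ := Ω (g • (y : M))
  let C : E' [⋀^Fin 2]→L[ℝ] ℝ := Ω (y : M)
  have hBC : ∀ u v : E', B ![A u, A v] = C ![u, v] := hM.symplectic_smul g y
  have h1 : B ![-gen X (g • (y : M)) + A (ι v), D] =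
      C ![ι v, ι w] - (-C ![gen W y, ι v] - -B ![gen X (g • (y : M)), D]) := by
    rw [alternatingTwo_add_left, alternatingTwo_neg_left]
    nth_rewrite 2 [hD2]
    rw [hBC, alternatingTwo_add_right, alternatingTwo_neg_right,
      alternatingTwo_swap C (ι v) (gen W y)]
    ring
  exact (congrArg (fun u : E' => B ![u, D]) hD1).trans h1

end ActionMap

/-! ### Geometry of the zero set of the `𝔭`-component of the moment map -/

section ZeroSet

open Filter Topology Set

variable {E : Type*} [NormedAddCommGroup E] [NormedSpace ℝ E]
  {G : Type*} [TopologicalSpace G] [ChartedSpace E G] [Group G]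
  {M : Type*} {Θ : G →* G} {Φ : M → StrongDual ℝ E}

/-- The `𝔭`-component `Φ^𝔭 : M → 𝔭^*` of the moment map. -/
noncomputable def momentP (Θ : G →* G) (Φ : M → StrongDual ℝ E) (m : M) :
    StrongDual ℝ (pSubspace (E := E) Θ) :=
  (Φ m).comp (pSubspace Θ).subtypeL

theorem momentP_eq_zero_iff {m : M} :
    momentP Θ Φ m = 0 ↔ ∀ X ∈ pSubspace (E := E) Θ, Φ m X = 0 :=
  ⟨fun h X hX => DFunLike.congr_fun h (⟨X, hX⟩ : pSubspace (E := E) Θ),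
    fun h => ContinuousLinearMap.ext fun X => h X X.2⟩

variable {F : Type*} [NormedAddCommGroup F] [NormedSpace ℝ F] [TopologicalSpace M]
  [ChartedSpace F M] [MulAction G M] {Ω : DForm 𝓘(ℝ, F) M 2}

namespace HamReductive.IsHamiltonian

variable (hM : IsHamiltonian G Ω Φ)
include hM

theorem contMDiff_momentP (Θ : G →* G) :
    ContMDiff 𝓘(ℝ, F) 𝓘(ℝ, StrongDual ℝ (pSubspace (E := E) Θ)) ∞ (momentP Θ Φ) :=
  ((ContinuousLinearMap.compL ℝ (pSubspace (E := E) Θ) E ℝ).flip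
    (pSubspace Θ).subtypeL).contDiff.contMDiff.comp hM.smooth_moment

theorem mfderiv_momentP_apply (m : M) (u : F) (Z : pSubspace (E := E) Θ) :
    DFunLike.coe (F := StrongDual ℝ (pSubspace (E := E) Θ))
      (mfderiv 𝓘(ℝ, F) 𝓘(ℝ, StrongDual ℝ (pSubspace (E := E) Θ)) (momentP Θ Φ) m u) Z =
      -(Ω m ![(generator (L := G) (F := F) (Z : E) m : F), u] : ℝ) := by
  let ev := ContinuousLinearMap.apply ℝ ℝ Z
  have h1 := mfderiv_comp_apply m (g := ev) (I'' := 𝓘(ℝ, ℝ))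
    (ev.contDiff.contMDiff.mdifferentiable (n := ∞) (by simp) (momentP Θ Φ m))
    ((hM.contMDiff_momentP Θ).mdifferentiable (by simp) m) u
  have h2 := hM.moment (Z : E) m u
  rw [mfderiv_eq_fderiv, ev.fderiv] at h1
  exact h1.symm.trans (neg_eq_iff_eq_neg.1 h2.symm)

end HamReductive.IsHamiltonian

variable [CompleteSpace E] [LieGroup 𝓘(ℝ, E) ∞ G] [T2Space G] [FiniteDimensional ℝ E]
  {EK : Type*} [NormedAddCommGroup EK] [NormedSpace ℝ EK]
  {K : Subgroup G} [ChartedSpace EK K] {b : LinearMap.BilinForm ℝ E}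

namespace HamReductive.IsRealReductive

variable (hG : IsRealReductive (EK := EK) K Θ b) (hM : IsHamiltonian G Ω Φ)
include hG hM

/-- Along the zero set, the derivatives of `Φ^𝔭` in the orbit directions of `𝔭` already
exhaust `𝔭^*`. -/
theorem exists_mfderiv_momentP_generator_eq (hC1 : ProperAction G M) (hC2 : IsProperMap Φ) {m : M}
    (hm : ∀ Z ∈ pSubspace (E := E) Θ, Φ m Z = 0) (ξ : StrongDual ℝ (pSubspace (E := E) Θ)) :
    ∃ X ∈ pSubspace (E := E) Θ,
      (mfderiv 𝓘(ℝ, F) 𝓘(ℝ, StrongDual ℝ (pSubspace (E := E) Θ)) (momentP Θ Φ) m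
        (generator (L := G) (F := F) X m) : StrongDual ℝ (pSubspace (E := E) Θ)) = ξ := by
  let D : F →L[ℝ] StrongDual ℝ (pSubspace (E := E) Θ) :=
    mfderiv 𝓘(ℝ, F) 𝓘(ℝ, StrongDual ℝ (pSubspace (E := E) Θ)) (momentP Θ Φ) m
  let O : E →L[ℝ] F := mfderiv 𝓘(ℝ, E) 𝓘(ℝ, F) (fun g : G => g • m) (1 : G)
  let T : pSubspace (E := E) Θ →ₗ[ℝ] StrongDual ℝ (pSubspace (E := E) Θ) :=
    ((D.comp (-O)).comp (pSubspace (E := E) Θ).subtypeL).toLinearMap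
  have hT : ∀ X : pSubspace (E := E) Θ, T X = D (generator (L := G) (F := F) (X : E) m) :=
    fun X => rfl
  have hinj : Function.Injective T := by
    rw [injective_iff_map_eq_zero]
    intro X hX
    rw [hT] at hX
    apply Subtype.ext
    refine hG.eq_zero_of_symplectic_p_eq_zero hM hC1 hC2 hm X.2 fun Z hZ => ?_
    have h1 := hM.mfderiv_momentP_apply m (generator (L := G) (F := F) (X : E) m) ⟨Z, hZ⟩
    have h2 := DFunLike.congr_fun hX (⟨Z, hZ⟩ : pSubspace (E := E) Θ)
    exact neg_eq_zero.1 (h1.symm.trans h2)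
  have hdim : Module.finrank ℝ (pSubspace (E := E) Θ) =
      Module.finrank ℝ (StrongDual ℝ (pSubspace (E := E) Θ)) := by
    rw [← Subspace.dual_finrank_eq]
    exact (LinearMap.toContinuousLinearMap : (pSubspace (E := E) Θ →ₗ[ℝ] ℝ) ≃ₗ[ℝ] _).finrank_eq
  obtain ⟨X, hX⟩ := (LinearMap.injective_iff_surjective_of_finrank_eq_finrank hdim).1 hinj ξ
  exact ⟨X, X.2, hX⟩

theorem surjective_mfderiv_momentP (hC1 : ProperAction G M) (hC2 : IsProperMap Φ) {m : M}
    (hm : ∀ Z ∈ pSubspace (E := E) Θ, Φ m Z = 0) : Function.Surjective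
      (mfderiv 𝓘(ℝ, F) 𝓘(ℝ, StrongDual ℝ (pSubspace (E := E) Θ)) (momentP Θ Φ) m) := fun ξ => by
  obtain ⟨X, -, hX⟩ := hG.exists_mfderiv_momentP_generator_eq hM hC1 hC2 hm ξ
  exact ⟨_, hX⟩

end HamReductive.IsRealReductive

end ZeroSet

section LieSubgroup

variable {E : Type*} [NormedAddCommGroup E] [NormedSpace ℝ E]
  {G : Type*} [TopologicalSpace G] [ChartedSpace E G] [Group G] [LieGroup 𝓘(ℝ, E) ∞ G]
  {EK : Type*} [NormedAddCommGroup EK] [NormedSpace ℝ EK]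
  {K : Subgroup G} [ChartedSpace EK K] [LieGroup 𝓘(ℝ, EK) ∞ K]

/-- The adjoint representations of a group and of a subgroup are compatible. -/
theorem lieIncl_Ad (hK : ContMDiff 𝓘(ℝ, EK) 𝓘(ℝ, E) ∞ (Subtype.val : K → G)) (k : K) (X : EK) :
    lieIncl (E := E) K (Ad k X) = Ad (k : G) (lieIncl K X) := by
  have hd := hK.mdifferentiable (by simp)
  have h1 := mfderiv_comp_apply_of_eq (x := (1 : K)) (y := 1) (f := fun x : K => k * x * k⁻¹)
    (g := (Subtype.val : K → G)) (hd 1) (mdifferentiable_conj (E := EK) k 1) (by simp) X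
  have h2 := mfderiv_comp_apply_of_eq (x := (1 : K)) (y := (1 : G)) (f := (Subtype.val : K → G))
    (g := fun x : G => (k : G) * x * (k : G)⁻¹) (mdifferentiable_conj (E := E) (k : G) 1) (hd 1)
    (by simp) X
  have e : (Subtype.val : K → G) ∘ (fun x : K => k * x * k⁻¹) =
      (fun x : G => (k : G) * x * (k : G)⁻¹) ∘ (Subtype.val : K → G) := by
    funext x; simp
  rw [e] at h1
  exact h1.symm.trans h2

end LieSubgroup

section ZeroSetHamiltonian

open Filter Topology Set

variable {E : Type*} [NormedAddCommGroup E] [NormedSpace ℝ E] [FiniteDimensional ℝ E]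
  [CompleteSpace E]
  {G : Type*} [TopologicalSpace G] [ChartedSpace E G] [Group G] [LieGroup 𝓘(ℝ, E) ∞ G] [T2Space G]
  {EK : Type*} [NormedAddCommGroup EK] [NormedSpace ℝ EK]
  {K : Subgroup G} [ChartedSpace EK K] {Θ : G →* G} {b : LinearMap.BilinForm ℝ E}
  {E' : Type*} [NormedAddCommGroup E'] [NormedSpace ℝ E'] [FiniteDimensional ℝ E']
  {M : Type*} [TopologicalSpace M] [ChartedSpace E' M] [IsManifold 𝓘(ℝ, E') ∞ M] [MulAction G M]
  {Ω : DForm 𝓘(ℝ, E') M 2} {Φ : M → StrongDual ℝ E}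
  {F : Type*} [NormedAddCommGroup F] [NormedSpace ℝ F] [FiniteDimensional ℝ F]
  {Y : SubMulAction K M} [ChartedSpace F Y] [IsManifold 𝓘(ℝ, F) ∞ Y]

namespace HamReductive.IsRealReductive

variable (hG : IsRealReductive (EK := EK) K Θ b) (hM : IsHamiltonian G Ω Φ)
  (hY : ∀ m, m ∈ Y ↔ ∀ X ∈ pSubspace (E := E) Θ, Φ m X = 0)
  (hemb : Manifold.IsSmoothEmbedding 𝓘(ℝ, F) 𝓘(ℝ, E') ∞ (Subtype.val : Y → M))
include hG hM hY hemb

/-- The tangent spaces of the zero set are the `Ω`-orthogonals of the orbit directions of `𝔭`. -/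
theorem mem_range_mfderiv_val_iff (hC1 : ProperAction G M) (hC2 : IsProperMap Φ)
    (L : E' ≃L[ℝ] StrongDual ℝ (pSubspace (E := E) Θ) × F) (y : Y) (u : E') :
    (∀ Z ∈ pSubspace (E := E) Θ,
        (Ω y ![(generator (L := G) (F := E') Z (y : M) : E'), u] : ℝ) = 0) ↔
      ∃ v : F, (mfderiv 𝓘(ℝ, F) 𝓘(ℝ, E') (Subtype.val : Y → M) y v : E') = u := by
  have h := mem_range_mfderiv_val_of_levelSet (q := fun m => m ∈ Y) hemb (hM.contMDiff_momentP Θ)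
    (fun m hm => momentP_eq_zero_iff.2 ((hY m).1 hm)) L y
    (hG.surjective_mfderiv_momentP hM hC1 hC2 ((hY y).1 y.2)) u
  refine Iff.trans ?_ h
  constructor
  · intro h1
    refine ContinuousLinearMap.ext fun Z => ?_
    exact (hM.mfderiv_momentP_apply (y : M) u Z).trans (neg_eq_zero.2 (h1 Z Z.2))
  · intro h1 Z hZ
    have h2 := hM.mfderiv_momentP_apply (y : M) u (⟨Z, hZ⟩ : pSubspace (E := E) Θ)
    exact neg_eq_zero.1 (h2.symm.trans (DFunLike.congr_fun
      (F := StrongDual ℝ (pSubspace (E := E) Θ)) h1 ⟨Z, hZ⟩))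

/-- `T_y M` is spanned by `T_y Y` and the orbit directions of `𝔭`. -/
theorem exists_generator_add_mfderiv_val_eq (hC1 : ProperAction G M) (hC2 : IsProperMap Φ)
    (L : E' ≃L[ℝ] StrongDual ℝ (pSubspace (E := E) Θ) × F) (y : Y) (u : E') :
    ∃ X ∈ pSubspace (E := E) Θ, ∃ v : F, u = (generator (L := G) (F := E') X (y : M) : E') +
      (mfderiv 𝓘(ℝ, F) 𝓘(ℝ, E') (Subtype.val : Y → M) y v : E') := by
  obtain ⟨X, hX, hXu⟩ := hG.exists_mfderiv_momentP_generator_eq hM hC1 hC2 ((hY y).1 y.2)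
    (mfderiv 𝓘(ℝ, E') 𝓘(ℝ, StrongDual ℝ (pSubspace (E := E) Θ)) (momentP Θ Φ) (y : M) u)
  let x : E' := generator (L := G) (F := E') X (y : M)
  have h := mem_range_mfderiv_val_of_levelSet (q := fun m => m ∈ Y) hemb (hM.contMDiff_momentP Θ)
    (fun m hm => momentP_eq_zero_iff.2 ((hY m).1 hm)) L y
    (hG.surjective_mfderiv_momentP hM hC1 hC2 ((hY y).1 y.2)) (u - x)
  obtain ⟨v, hv⟩ := h.1 <| by
    refine ((mfderiv 𝓘(ℝ, E') 𝓘(ℝ, StrongDual ℝ (pSubspace (E := E) Θ)) (momentP Θ Φ)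
      (y : M)).map_sub u x).trans ?_
    exact sub_eq_zero.2 hXu.symm
  exact ⟨X, hX, v, (congrArg (fun u' : E' => x + u') hv |>.trans (add_sub_cancel x u)).symm⟩

/-- The zero set is symplectic: a vector in the radical of the restricted form is `Ω`-orthogonal to
the tangent space as well as to the orbit directions of `𝔭`, which span a complement. -/
theorem isSymplecticForm_pullback_val (hC1 : ProperAction G M) (hC2 : IsProperMap Φ)
    (L : E' ≃L[ℝ] StrongDual ℝ (pSubspace (E := E) Θ) × F) :
    IsSymplecticForm 𝓘(ℝ, F) (pullbackForm 𝓘(ℝ, F) 𝓘(ℝ, E') (Subtype.val : Y → M) Ω) := by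
  have hval := hemb.isImmersion.contMDiff
  refine ⟨hM.symplectic.smooth.pullbackForm hval, fun x => ?_, fun y v hv => ?_⟩
  · rw [extD_pullbackForm hM.symplectic.smooth hval]
    exact (DForm.compContinuousLinearMap_congr (E := F) (fun z => extD 𝓘(ℝ, E') Ω z) rfl rfl).trans
      (by
        have h := hM.symplectic.closed (x : M)
        exact congrArg (fun B : E' [⋀^Fin 3]→L[ℝ] ℝ => B.compContinuousLinearMap
          (mfderiv 𝓘(ℝ, F) 𝓘(ℝ, E') (Subtype.val : Y → M) x : F →L[ℝ] E')) h)
  · have hinj := (hemb.isImmersion.isImmersionAt y).mfderiv_injective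
    apply hinj
    refine Eq.trans ?_ (map_zero _).symm
    refine hM.symplectic.nondegenerate (y : M) _ fun u => ?_
    obtain ⟨X, hX, w, hu⟩ := hG.exists_generator_add_mfderiv_val_eq hM hY hemb hC1 hC2 L y u
    let ι : F → E' := fun v => mfderiv 𝓘(ℝ, F) 𝓘(ℝ, E') (Subtype.val : Y → M) y v
    have h1 : (Ω y ![ι v, ι w] : ℝ) = 0 :=
      (pullbackForm_two_apply (Subtype.val : Y → M) Ω y v w).symm.trans (hv w)
    have h2 := (hG.mem_range_mfderiv_val_iff hM hY hemb hC1 hC2 L y (ι v)).2 ⟨v, rfl⟩ X hX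
    let C : E' [⋀^Fin 2]→L[ℝ] ℝ := Ω (y : M)
    have h3 : ∀ a c d : E', C ![c, a] = 0 → C ![a, d] = 0 → C ![a, c + d] = 0 := by
      intro a c d hca had
      rw [alternatingTwo_add_right, alternatingTwo_swap C a c, hca, had]
      simp
    exact (congrArg (fun z : E' => C ![ι v, z]) hu).trans (h3 _ _ _ h2 h1)

end HamReductive.IsRealReductive

end ZeroSetHamiltonian

section SubgroupAction

open Filter Topology Set

variable {E : Type*} [NormedAddCommGroup E] [NormedSpace ℝ E]
  {G : Type*} [TopologicalSpace G] [ChartedSpace E G] [Group G] [LieGroup 𝓘(ℝ, E) ∞ G]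
  {EK : Type*} [NormedAddCommGroup EK] [NormedSpace ℝ EK]
  {K : Subgroup G} [ChartedSpace EK K] [LieGroup 𝓘(ℝ, EK) ∞ K]
  {E' : Type*} [NormedAddCommGroup E'] [NormedSpace ℝ E']
  {M : Type*} [TopologicalSpace M] [ChartedSpace E' M] [MulAction G M]
  {Ω : DForm 𝓘(ℝ, E') M 2} {Φ : M → StrongDual ℝ E}
  {F : Type*} [NormedAddCommGroup F] [NormedSpace ℝ F]
  {Y : SubMulAction K M} [ChartedSpace F Y]

namespace HamReductive.IsHamiltonian

variable (hM : IsHamiltonian G Ω Φ)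
  (hK : ContMDiff 𝓘(ℝ, EK) 𝓘(ℝ, E) ∞ (Subtype.val : K → G))
  (hemb : Manifold.IsSmoothEmbedding 𝓘(ℝ, F) 𝓘(ℝ, E') ∞ (Subtype.val : Y → M))
include hM hK hemb

omit [LieGroup 𝓘(ℝ, E) ∞ G] [LieGroup 𝓘(ℝ, EK) ∞ K] in
theorem contMDiffSMul_subMulAction : ContMDiffSMul 𝓘(ℝ, EK) 𝓘(ℝ, F) ∞ K Y := by
  have hval := hemb.isImmersion.contMDiff
  have h : ContMDiff (𝓘(ℝ, EK).prod 𝓘(ℝ, F)) 𝓘(ℝ, E') ∞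
      ((Subtype.val : Y → M) ∘ fun p : K × Y => p.1 • p.2) :=
    hM.contMDiff_smul_prod.comp ((hK.comp contMDiff_fst).prodMk (hval.comp contMDiff_snd))
  refine ⟨(ContMDiff.iff_comp_isImmersion hemb.isImmersion).2 ⟨?_, h⟩⟩
  exact hemb.isEmbedding.continuous_iff.2 h.continuous

omit [LieGroup 𝓘(ℝ, E) ∞ G] [LieGroup 𝓘(ℝ, EK) ∞ K] in
theorem mfderiv_val_generator (X : EK) (y : Y) :
    (mfderiv 𝓘(ℝ, F) 𝓘(ℝ, E') (Subtype.val : Y → M) y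
      (generator (L := K) (F := F) X y : F) : E') =
      generator (L := G) (F := E') (lieIncl (E := E) K X) (y : M) := by
  have := hM.contMDiffSMul_subMulAction hK hemb
  have hval := hemb.isImmersion.contMDiff.mdifferentiable (by simp)
  have horb : ContMDiff 𝓘(ℝ, EK) 𝓘(ℝ, F) ∞ (fun k : K => k • y) :=
    (ContMDiffSMul.contMDiff_smul (I := 𝓘(ℝ, EK)) (I' := 𝓘(ℝ, F)) (n := ∞) (G := K) (M := Y)).comp
      (contMDiff_id.prodMk contMDiff_const)
  have h1 := mfderiv_comp_apply_of_eq (x := (1 : K)) (y := y) (f := fun k : K => k • y)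
    (g := (Subtype.val : Y → M)) (hval y) (horb.mdifferentiable (by simp) 1) (one_smul K y) X
  have h2 := mfderiv_comp_apply_of_eq (x := (1 : K)) (y := (1 : G)) (f := (Subtype.val : K → G))
    (g := fun g : G => g • (y : M)) ((hM.contMDiff_orbit (y : M)).mdifferentiable (by simp) 1)
    (hK.mdifferentiable (by simp) 1) rfl X
  have e : (Subtype.val : Y → M) ∘ (fun k : K => k • y) =
      (fun g : G => g • (y : M)) ∘ (Subtype.val : K → G) := rfl
  rw [e] at h1
  refine ((mfderiv 𝓘(ℝ, F) 𝓘(ℝ, E') (Subtype.val : Y → M) y).map_neg _).trans ?_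
  exact congrArg (fun u : E' => -u) (h1.symm.trans h2)

/-- A symplectic submanifold which is invariant under a Lie subgroup is a Hamiltonian manifold for
it. -/
theorem isHamiltonian_momentK
    (hsymp : IsSymplecticForm 𝓘(ℝ, F) (pullbackForm 𝓘(ℝ, F) 𝓘(ℝ, E') (Subtype.val : Y → M) Ω)) :
    IsHamiltonian K (pullbackForm 𝓘(ℝ, F) 𝓘(ℝ, E') (Subtype.val : Y → M) Ω)
      (fun y : Y => momentK (EK := EK) K Φ (y : M)) := by
  have hval := hemb.isImmersion.contMDiff
  have hvd := hval.mdifferentiable (by simp)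
  have hact := hM.contMDiffSMul_subMulAction hK hemb
  refine ⟨hsymp, hact, fun k => ?_, ?_, fun X y v => ?_, fun k y => ?_⟩
  · funext y
    have hk : ContMDiff 𝓘(ℝ, F) 𝓘(ℝ, F) ∞ (fun y : Y => k • y) :=
      (ContMDiffSMul.contMDiff_smul (I := 𝓘(ℝ, EK)) (I' := 𝓘(ℝ, F)) (n := ∞) (G := K) (M := Y)).comp
        (contMDiff_const.prodMk contMDiff_id)
    rw [← pullbackForm_comp_apply Ω (hvd _) (hk.mdifferentiable (by simp) y)]
    have e : (Subtype.val : Y → M) ∘ (fun y : Y => k • y) =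
        (fun m : M => (k : G) • m) ∘ (Subtype.val : Y → M) := rfl
    rw [e, pullbackForm_comp_apply Ω ((hM.contMDiff_const_smul (k : G)).mdifferentiable (by simp) _)
      (hvd y), hM.invariant]
  · exact ((ContinuousLinearMap.compL ℝ EK E ℝ).flip (lieIncl K)).contDiff.contMDiff.comp
      (hM.smooth_moment.comp hval)
  · have h1 := pullbackForm_two_apply (Subtype.val : Y → M) Ω y (generator (L := K) (F := F) X y) v
    refine h1.trans ?_
    let ι : F → E' := fun v => mfderiv 𝓘(ℝ, F) 𝓘(ℝ, E') (Subtype.val : Y → M) y v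
    refine (congrArg (fun u : E' => (Ω y ![u, ι v] : ℝ))
      (hM.mfderiv_val_generator hK hemb X y)).trans ?_
    refine (hM.moment (lieIncl (E := E) K X) (y : M) (ι v)).trans ?_
    have h2 := mfderiv_comp_apply y
      ((hM.contMDiff_moment_apply (lieIncl (E := E) K X)).mdifferentiable (by simp) (y : M))
      (hvd y) v
    exact congrArg (fun r : ℝ => -r) h2.symm
  · ext X
    change Φ ((k : G) • (y : M)) (lieIncl K X) = Φ (y : M) (lieIncl K (Ad k⁻¹ X))
    rw [hM.moment_smul_apply, lieIncl_Ad hK]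
    rfl

end HamReductive.IsHamiltonian

end SubgroupAction

/-! ### Properness and connectedness -/

section ZeroSetTopology

open Filter Topology Set

variable {E : Type*} [NormedAddCommGroup E] [NormedSpace ℝ E] [CompleteSpace E]
  {G : Type*} [TopologicalSpace G] [ChartedSpace E G] [Group G] [LieGroup 𝓘(ℝ, E) ∞ G]
  {EK : Type*} [NormedAddCommGroup EK] [NormedSpace ℝ EK]
  {K : Subgroup G} [ChartedSpace EK K] {Θ : G →* G} {b : LinearMap.BilinForm ℝ E}
  {E' : Type*} [NormedAddCommGroup E'] [NormedSpace ℝ E']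
  {M : Type*} [TopologicalSpace M] [ChartedSpace E' M] [MulAction G M]
  {Ω : DForm 𝓘(ℝ, E') M 2} {Φ : M → StrongDual ℝ E} {Y : SubMulAction K M}

namespace HamReductive.IsRealReductive

variable (hG : IsRealReductive (EK := EK) K Θ b)
  (hY : ∀ m, m ∈ Y ↔ ∀ X ∈ pSubspace (E := E) Θ, Φ m X = 0)

include hG hY in
omit [TopologicalSpace M] in
/-- On the zero set, `Φ` takes values in the annihilator of `𝔭`. -/
theorem moment_kProj (y : Y) (X : E) : Φ (y : M) X = Φ (y : M) (kProj Θ X) := by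
  have h := (hY y).1 y.2 _ (hG.sub_kProj_mem_pSubspace X)
  rw [map_sub] at h
  exact sub_eq_zero.1 h

omit [CompleteSpace E] [LieGroup 𝓘(ℝ, E) ∞ G] in
include hY in
theorem isProperMap_moment_zeroSet (hC2 : IsProperMap Φ) :
    IsProperMap (fun y : Y => Φ (y : M)) := by
  have hcl : IsClosed {m | m ∈ Y} := by
    have e : {m | m ∈ Y} = ⋂ X ∈ pSubspace (E := E) Θ, {m | Φ m X = 0} := by
      ext m
      simp [hY]
    rw [e]
    refine isClosed_biInter fun X _ => isClosed_eq ?_ continuous_const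
    exact (ContinuousLinearMap.apply ℝ ℝ X).continuous.comp hC2.continuous
  exact hC2.comp hcl.isClosedEmbedding_subtypeVal.isProperMap

include hG hY in
/-- On the zero set of its `𝔭`-component, the moment map is determined by its restriction to `𝔨`;
hence this restriction is proper, too. -/
theorem isProperMap_momentK [FiniteDimensional ℝ E] [IsManifold 𝓘(ℝ, EK) ∞ K]
    (hC2 : IsProperMap Φ) :
    IsProperMap (fun y : Y => momentK (EK := EK) K Φ (y : M)) := by
  let ι : EK →L[ℝ] E := lieIncl K
  have hinj : LinearMap.ker (ι : EK →ₗ[ℝ] E) = ⊥ :=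
    LinearMap.ker_eq_bot.2 (hG.embedding_K.isImmersion.isImmersionAt 1).mfderiv_injective
  obtain ⟨s, hs⟩ := LinearMap.exists_leftInverse_of_injective (ι : EK →ₗ[ℝ] E) hinj
  let r : E →L[ℝ] EK := LinearMap.toContinuousLinearMap (s ∘ₗ (kProj Θ : E →L[ℝ] E).toLinearMap)
  have hr : ∀ X, lieIncl (E := E) K (r X) = kProj Θ X := by
    intro X
    obtain ⟨Z, hZ⟩ := (hG.lie_K (kProj Θ X)).2 (hG.lieDeriv_kProj X)
    have h1 : r X = Z := by
      change s (kProj Θ X) = Z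
      rw [← hZ]
      exact LinearMap.congr_fun hs Z
    rw [h1, hZ]
  have hcont : Continuous fun y : Y => Φ (y : M) := hC2.continuous.comp continuous_subtype_val
  refine isProperMap_of_comp_of_t2 (g := fun ξ : StrongDual ℝ EK => ξ.comp r)
    (((ContinuousLinearMap.compL ℝ EK E ℝ).flip (lieIncl K)).continuous.comp hcont)
    ((ContinuousLinearMap.compL ℝ E EK ℝ).flip r).continuous ?_
  have e : (fun ξ : StrongDual ℝ EK => ξ.comp r) ∘ (fun y : Y => momentK (EK := EK) K Φ (y : M)) =
      fun y : Y => Φ (y : M) := by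
    funext y
    ext X
    change Φ (y : M) (lieIncl K (r X)) = Φ (y : M) X
    rw [hr, ← hG.moment_kProj hY]
  rw [e]
  exact isProperMap_moment_zeroSet hY hC2

include hG in
/-- The `K`-component of the decomposition `G = exp(𝔭) K`, obtained from `G = K exp(𝔭)` by
inversion. -/
theorem exists_kComponent [T2Space G] : ∃ κ : G → K, Continuous κ ∧ κ 1 = 1 ∧
    ∀ (g : G) (k : K), κ (g * (k : G)⁻¹) = κ g * k⁻¹ := by
  obtain ⟨C, hC⟩ := hG.cartan
  have hKinv : Continuous fun k : K => k⁻¹ := by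
    have : IsTopologicalGroup G := topologicalGroup_of_lieGroup 𝓘(ℝ, E) ∞
    exact continuous_inv
  have : ContinuousInv G := ⟨(contMDiff_inv 𝓘(ℝ, E) (∞ : WithTop ℕ∞) (G := G)).continuous⟩
  refine ⟨fun g => (C.symm g⁻¹).1⁻¹, ?_, ?_, fun g k => ?_⟩
  · exact hKinv.comp (continuous_fst.comp (C.symm.continuous.comp continuous_inv))
  · have h1 : C (1, 0) = (1 : G)⁻¹ := by
      rw [hC]
      simp [lieExp_zero]
    simp only
    rw [← h1, C.symm_apply_apply, inv_one]
  · have h1 : C.symm (g * (k : G)⁻¹)⁻¹ = (k * (C.symm g⁻¹).1, (C.symm g⁻¹).2) := by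
      rw [← C.symm_apply_apply (k * (C.symm g⁻¹).1, (C.symm g⁻¹).2), hC]
      congr 1
      have h2 : C ((C.symm g⁻¹).1, (C.symm g⁻¹).2) = g⁻¹ := C.apply_symm_apply g⁻¹
      rw [hC] at h2
      rw [Subgroup.coe_mul, mul_assoc, h2, mul_inv_rev, inv_inv]
    simp only
    rw [h1, mul_inv_rev]

include hG in
/-- `Y` is the image of `G ×_K Y` under the retraction `[g, y] ↦ κ(g) • y`. -/
theorem isConnected_of_connectedSpace_assoc [T2Space G] (hM : IsHamiltonian G Ω Φ)
    [ConnectedSpace (Assoc Y)] : IsConnected (Y : Set M) := by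
  obtain ⟨κ, hκ, hκ1, hκk⟩ := hG.exists_kComponent
  let ρ : Assoc Y → M := Quotient.lift (fun p : G × Y => ((κ p.1 • p.2 : Y) : M)) (by
    rintro p q ⟨k, h1, h2⟩
    simp only [h1, h2, hκk]
    rw [smul_smul, inv_mul_cancel_right])
  have hρ : Continuous ρ := by
    refine Continuous.quotient_lift ?_ _
    have h1 : Continuous fun p : G × Y => ((κ p.1 : G), (p.2 : M)) :=
      (continuous_subtype_val.comp (hκ.comp continuous_fst)).prodMk
        (continuous_subtype_val.comp continuous_snd)
    exact hM.contMDiff_smul_prod.continuous.comp h1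
  have hrange : range ρ = (Y : Set M) := by
    ext m
    constructor
    · rintro ⟨⟨p⟩, rfl⟩
      exact (κ p.1 • p.2 : Y).2
    · intro hm
      refine ⟨Assoc.mk Y (1, ⟨m, hm⟩), ?_⟩
      change ((κ 1 • (⟨m, hm⟩ : Y) : Y) : M) = m
      rw [hκ1, one_smul]
  rw [← hrange]
  exact isConnected_range hρ

end HamReductive.IsRealReductive

end ZeroSetTopology

/-! ### Transport of structure along homeomorphisms and diffeomorphisms -/

section Transport

open Filter Topology Set

variable {E' : Type*} [NormedAddCommGroup E'] [NormedSpace ℝ E']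
  {M : Type*} [TopologicalSpace M] [ChartedSpace E' M] [IsManifold 𝓘(ℝ, E') ∞ M]
  {Q : Type*} [TopologicalSpace Q]

/-- A manifold structure can be transported along a homeomorphism. -/
theorem Homeomorph.exists_chartedSpace_diffeomorph (h : Q ≃ₜ M) :
    ∃ (_ : ChartedSpace E' Q) (_ : IsManifold 𝓘(ℝ, E') ∞ Q)
      (D : Diffeomorph 𝓘(ℝ, E') 𝓘(ℝ, E') Q M ∞), ∀ q, D q = h q := by
  let c : ChartedSpace E' Q :=
    { atlas := {e | ∃ c ∈ atlas E' M, e = h.toOpenPartialHomeomorph.trans c}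
      chartAt := fun q => h.toOpenPartialHomeomorph.trans (chartAt E' (h q))
      mem_chart_source := fun q => by simp
      chart_mem_atlas := fun q => ⟨_, chart_mem_atlas E' (h q), rfl⟩ }
  have hc : ∀ q : Q, chartAt E' q = h.toOpenPartialHomeomorph.trans (chartAt E' (h q)) :=
    fun q => rfl
  have hm : IsManifold 𝓘(ℝ, E') ∞ Q := by
    refine { compatible := ?_ }
    rintro _ _ ⟨c₁, hc₁, rfl⟩ ⟨c₂, hc₂, rfl⟩
    refine (contDiffGroupoid ∞ 𝓘(ℝ, E')).mem_of_eqOnSource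
      ((contDiffGroupoid ∞ 𝓘(ℝ, E')).compatible hc₁ hc₂) ⟨?_, fun u hu => ?_⟩
    · ext u; simp
    · simp
  have h1 : ContMDiff 𝓘(ℝ, E') 𝓘(ℝ, E') ∞ h := by
    intro q
    have h2 : ContMDiffAt 𝓘(ℝ, E') 𝓘(ℝ, E') ∞ (chartAt E' q) q :=
      contMDiffAt_of_mem_maximalAtlas (IsManifold.chart_mem_maximalAtlas q) (mem_chart_source E' q)
    have h3 : ContMDiffAt 𝓘(ℝ, E') 𝓘(ℝ, E') ∞ (chartAt E' (h q)).symm (chartAt E' q q) :=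
      contMDiffAt_symm_of_mem_maximalAtlas (IsManifold.chart_mem_maximalAtlas (h q)) (by simp [hc])
    refine (h3.comp q h2).congr_of_eventuallyEq ?_
    filter_upwards [(chartAt E' q).open_source.mem_nhds (mem_chart_source E' q)] with z hz
    rw [hc] at hz ⊢
    simp at hz
    simp [(chartAt E' (h q)).left_inv hz]
  have h2 : ContMDiff 𝓘(ℝ, E') 𝓘(ℝ, E') ∞ h.symm := by
    intro m
    have h2 : ContMDiffAt 𝓘(ℝ, E') 𝓘(ℝ, E') ∞ (chartAt E' m) m :=
      contMDiffAt_of_mem_maximalAtlas (IsManifold.chart_mem_maximalAtlas m) (mem_chart_source E' m)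
    have h3 : ContMDiffAt 𝓘(ℝ, E') 𝓘(ℝ, E') ∞ (chartAt E' (h.symm m)).symm (chartAt E' m m) :=
      contMDiffAt_symm_of_mem_maximalAtlas (IsManifold.chart_mem_maximalAtlas (h.symm m))
        (by simp [hc])
    refine (h3.comp m h2).congr_of_eventuallyEq ?_
    filter_upwards [(chartAt E' m).open_source.mem_nhds (mem_chart_source E' m)] with z hz
    simp [hc, (chartAt E' m).left_inv hz]
  exact ⟨c, hm, ⟨h.toEquiv, h1, h2⟩, fun _ => rfl⟩

end Transport

section HamiltonianTransport

open Filter Topology Set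

variable {E : Type*} [NormedAddCommGroup E] [NormedSpace ℝ E]
  {G : Type*} [TopologicalSpace G] [ChartedSpace E G] [Group G]
  {E' : Type*} [NormedAddCommGroup E'] [NormedSpace ℝ E'] [FiniteDimensional ℝ E']
  {M : Type*} [TopologicalSpace M] [ChartedSpace E' M] [IsManifold 𝓘(ℝ, E') ∞ M] [MulAction G M]
  {Q : Type*} [TopologicalSpace Q] [ChartedSpace E' Q] [IsManifold 𝓘(ℝ, E') ∞ Q] [MulAction G Q]
  {Ω : DForm 𝓘(ℝ, E') M 2} {Φ : M → StrongDual ℝ E}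

/-- Hamiltonian structures can be pulled back along equivariant diffeomorphisms. -/
theorem HamReductive.IsHamiltonian.pullback_diffeomorph (hM : IsHamiltonian G Ω Φ)
    (D : Diffeomorph 𝓘(ℝ, E') 𝓘(ℝ, E') Q M ∞) (hD : ∀ (g : G) (q : Q), D (g • q) = g • D q) :
    IsHamiltonian G (pullbackForm 𝓘(ℝ, E') 𝓘(ℝ, E') D Ω) (Φ ∘ D) := by
  have hd := D.contMDiff.mdifferentiable (by simp)
  have hs := D.symm.contMDiff.mdifferentiable (by simp)
  have hact : ContMDiff (𝓘(ℝ, E).prod 𝓘(ℝ, E')) 𝓘(ℝ, E') ∞ (fun p : G × Q => p.1 • p.2) := by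
    have h1 : (fun p : G × Q => p.1 • p.2) = D.symm ∘ fun p : G × Q => p.1 • D p.2 := by
      funext p
      simp [← hD]
    rw [h1]
    exact D.symm.contMDiff.comp
      (hM.contMDiff_smul_prod.comp (contMDiff_fst.prodMk (D.contMDiff.comp contMDiff_snd)))
  have horb : ∀ q : Q, MDifferentiableAt 𝓘(ℝ, E) 𝓘(ℝ, E') (fun g : G => g • q) 1 := fun q =>
    (hact.comp (contMDiff_id.prodMk (contMDiff_const (c := q)))).mdifferentiable (by simp) 1
  have hleft : ∀ (q : Q) (v : E'), (mfderiv 𝓘(ℝ, E') 𝓘(ℝ, E') D.symm (D q)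
      (mfderiv 𝓘(ℝ, E') 𝓘(ℝ, E') D q v : E') : E') = v := by
    intro q v
    have h1 := mfderiv_comp_apply q (hs (D q)) (hd q) v
    have e : D.symm ∘ D = id := funext D.symm_apply_apply
    rw [e, mfderiv_id] at h1
    exact h1.symm
  have hright : ∀ (q : Q) (u : E'), ∃ v : E', (mfderiv 𝓘(ℝ, E') 𝓘(ℝ, E') D q v : E') = u := by
    intro q u
    refine ⟨mfderiv 𝓘(ℝ, E') 𝓘(ℝ, E') D.symm (D q) u, ?_⟩
    have h1 := mfderiv_comp_apply_of_eq (x := D q) (y := q) (f := D.symm) (g := D) (hd q) (hs (D q))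
      (D.symm_apply_apply q) u
    have e : D ∘ D.symm = id := funext D.apply_symm_apply
    rw [e, mfderiv_id] at h1
    exact h1.symm
  refine ⟨⟨hM.symplectic.smooth.pullbackForm D.contMDiff, fun q => ?_, fun q v hv => ?_⟩, ⟨hact⟩,
    fun g => ?_, hM.smooth_moment.comp D.contMDiff, fun X q v => ?_, fun g q => ?_⟩
  · rw [extD_pullbackForm hM.symplectic.smooth D.contMDiff]
    exact congrArg (fun B : E' [⋀^Fin 3]→L[ℝ] ℝ => B.compContinuousLinearMap
      (mfderiv 𝓘(ℝ, E') 𝓘(ℝ, E') D q : E' →L[ℝ] E')) (hM.symplectic.closed (D q))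
  · have h1 : (mfderiv 𝓘(ℝ, E') 𝓘(ℝ, E') D q v : E') = 0 := by
      refine hM.symplectic.nondegenerate (D q) _ fun u => ?_
      obtain ⟨w, hw⟩ := hright q u
      have h2 := (pullbackForm_two_apply D Ω q v w).symm.trans (hv w)
      let a : E' := mfderiv 𝓘(ℝ, E') 𝓘(ℝ, E') D q v
      exact (congrArg (fun z : E' => (Ω (D q) ![a, z] : ℝ)) hw.symm).trans h2
    refine (hleft q v).symm.trans ?_
    exact (congrArg (fun z : E' => (mfderiv 𝓘(ℝ, E') 𝓘(ℝ, E') D.symm (D q) z : E')) h1).trans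
      (map_zero _)
  · funext q
    have hg : MDifferentiable 𝓘(ℝ, E') 𝓘(ℝ, E') (fun q : Q => g • q) :=
      (hact.comp (contMDiff_const.prodMk contMDiff_id)).mdifferentiable (by simp)
    rw [← pullbackForm_comp_apply Ω (hd _) (hg q)]
    have e : D ∘ (fun q : Q => g • q) = (fun m : M => g • m) ∘ D := funext fun q => hD g q
    rw [e, pullbackForm_comp_apply Ω
      ((hM.contMDiff_const_smul g).mdifferentiable (by simp) _) (hd q), hM.invariant]
  · have h1 := pullbackForm_two_apply D Ω q (generator (L := G) X q) v
    refine h1.trans ?_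
    let ι : E' → E' := fun v => mfderiv 𝓘(ℝ, E') 𝓘(ℝ, E') D q v
    have h2 : ι (generator (L := G) (F := E') X q) = generator (L := G) (F := E') X (D q) := by
      refine ((mfderiv 𝓘(ℝ, E') 𝓘(ℝ, E') D q).map_neg _).trans ?_
      have h3 := mfderiv_comp_apply_of_eq (x := (1 : G)) (y := q) (f := fun g : G => g • q)
        (g := D) (hd q) (horb q) (one_smul G q) X
      have e : D ∘ (fun g : G => g • q) = fun g : G => g • D q := funext fun g => hD g q
      rw [e] at h3
      exact congrArg (fun u : E' => -u) h3.symm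
    refine (congrArg (fun u : E' => (Ω (D q) ![u, ι v] : ℝ)) h2).trans ?_
    refine (hM.moment X (D q) (ι v)).trans ?_
    have h4 := mfderiv_comp_apply q ((hM.contMDiff_moment_apply X).mdifferentiable (by simp) (D q))
      (hd q) v
    exact congrArg (fun r : ℝ => -r) h4.symm
  · change Φ (D (g • q)) = coAd g (Φ (D q))
    rw [hD, hM.equivariant]

end HamiltonianTransport

/-! ### The bundle `G ×_K Y` -/

section AssociatedBundle

open Filter Topology Set

variable {E : Type*} [NormedAddCommGroup E] [NormedSpace ℝ E] [FiniteDimensional ℝ E]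
  [CompleteSpace E]
  {G : Type*} [TopologicalSpace G] [ChartedSpace E G] [Group G] [LieGroup 𝓘(ℝ, E) ∞ G] [T2Space G]
  {EK : Type*} [NormedAddCommGroup EK] [NormedSpace ℝ EK]
  {K : Subgroup G} [ChartedSpace EK K] {Θ : G →* G} {b : LinearMap.BilinForm ℝ E}
  {E' : Type*} [NormedAddCommGroup E'] [NormedSpace ℝ E'] [FiniteDimensional ℝ E']
  {M : Type*} [TopologicalSpace M] [ChartedSpace E' M] [IsManifold 𝓘(ℝ, E') ∞ M] [MulAction G M]
  {Ω : DForm 𝓘(ℝ, E') M 2} {Φ : M → StrongDual ℝ E}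
  {F : Type*} [NormedAddCommGroup F] [NormedSpace ℝ F] [FiniteDimensional ℝ F]
  {Y : SubMulAction K M} [ChartedSpace F Y] [IsManifold 𝓘(ℝ, F) ∞ Y]

namespace HamReductive.IsRealReductive

variable (hG : IsRealReductive (EK := EK) K Θ b) (hM : IsHamiltonian G Ω Φ)
  (hY : ∀ m, m ∈ Y ↔ ∀ X ∈ pSubspace (E := E) Θ, Φ m X = 0)
include hG hM hY

/-- The action map `G × Y → M` is a submersion, as the orbit directions are transverse to `Y`. -/
theorem surjective_mfderiv_smul_val
    (hemb : Manifold.IsSmoothEmbedding 𝓘(ℝ, F) 𝓘(ℝ, E') ∞ (Subtype.val : Y → M))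
    (hC1 : ProperAction G M) (hC2 : IsProperMap Φ)
    (L : E' ≃L[ℝ] StrongDual ℝ (pSubspace (E := E) Θ) × F) (p : G × Y) :
    Function.Surjective (mfderiv (𝓘(ℝ, E).prod 𝓘(ℝ, F)) 𝓘(ℝ, E')
      (fun p : G × Y => p.1 • (p.2 : M)) p) := by
  obtain ⟨g, y⟩ := p
  intro u
  have hgd := fun g : G => (hM.contMDiff_const_smul g).mdifferentiable (by simp)
  let u₀ : E' := mfderiv 𝓘(ℝ, E') 𝓘(ℝ, E') (fun m : M => g⁻¹ • m) (g • (y : M)) u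
  let A : E' → E' := fun u => mfderiv 𝓘(ℝ, E') 𝓘(ℝ, E') (fun m : M => g • m) (y : M) u
  have hu₀ : A u₀ = u := by
    have h1 := mfderiv_comp_apply_of_eq (x := g • (y : M)) (y := (y : M))
      (f := fun m : M => g⁻¹ • m) (g := fun m : M => g • m) (hgd g _) (hgd g⁻¹ _)
      (inv_smul_smul g (y : M)) u
    have e : (fun m : M => g • m) ∘ (fun m : M => g⁻¹ • m) = id := by
      funext m; exact smul_inv_smul g m
    rw [e, mfderiv_id] at h1
    exact h1.symm
  obtain ⟨X, -, v, hXv⟩ := hG.exists_generator_add_mfderiv_val_eq hM hY hemb hC1 hC2 L y u₀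
  let V : E := mfderiv 𝓘(ℝ, E) 𝓘(ℝ, E) (fun h : G => g * h) 1 (-X)
  let w : E' := mfderiv 𝓘(ℝ, F) 𝓘(ℝ, E') (Subtype.val : Y → M) y v
  refine ⟨((V, v) : E × F), ?_⟩
  refine (hM.mfderiv_smul_val hemb.isImmersion.contMDiff g y V v).trans ?_
  have h1 : (-(generator (L := G) (F := E') (-X) (y : M) : E') : E') =
      generator (L := G) (F := E') X (y : M) := by
    rw [neg_generator]
    exact (mfderiv 𝓘(ℝ, E) 𝓘(ℝ, E') (fun g : G => g • (y : M)) (1 : G)).map_neg X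
  have h2 : (mfderiv 𝓘(ℝ, E) 𝓘(ℝ, E') (fun h : G => h • (y : M)) g V : E') =
      A (generator (L := G) (F := E') X (y : M)) :=
    (hM.mfderiv_orbit_left g (y : M) (-X)).trans (congrArg A h1)
  refine (congrArg (fun z : E' => z + A w) h2).trans ?_
  refine ((mfderiv 𝓘(ℝ, E') 𝓘(ℝ, E') (fun m : M => g • m) (y : M)).map_add _ _).symm.trans ?_
  exact (congrArg A hXv.symm).trans hu₀

omit [FiniteDimensional ℝ E'] [IsManifold 𝓘(ℝ, E') ∞ M] in
/-- Each orbit of `G` meets `Y` in exactly one orbit of `K`, so that `G ×_K Y → M` is bijective. -/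
theorem bijective_toM [T2Space M] (hC1 : ProperAction G M) (hC2 : IsProperMap Φ) :
    Function.Bijective (Assoc.toM Y) := by
  constructor
  · rintro ⟨p⟩ ⟨q⟩ (h : p.1 • (p.2 : M) = q.1 • (q.2 : M))
    have h1 : (q.1⁻¹ * p.1) • (p.2 : M) = q.2 := by
      rw [mul_smul, h, inv_smul_smul]
    have h2 := hG.mem_of_moment_vanishes_smul hM hC1 hC2 ((hY p.2).1 p.2.2) (g := q.1⁻¹ * p.1)
      (by rw [h1]; exact (hY q.2).1 q.2.2)
    refine Quotient.sound ⟨⟨q.1⁻¹ * p.1, h2⟩, ?_, ?_⟩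
    · simp
    · exact Subtype.ext h1.symm
  · intro m
    obtain ⟨g, hg⟩ := hG.exists_smul_moment_vanishes hM hC1 hC2 m
    exact ⟨Assoc.mk Y (g⁻¹, ⟨g • m, (hY _).2 hg⟩), inv_smul_smul g m⟩

/-- The canonical map `G ×_K Y → M` is a homeomorphism: it is a continuous bijection, and it is open
since the action map `G × Y → M` is a submersion. -/
theorem exists_homeomorph_toM [T2Space M]
    (hemb : Manifold.IsSmoothEmbedding 𝓘(ℝ, F) 𝓘(ℝ, E') ∞ (Subtype.val : Y → M))
    (hC1 : ProperAction G M) (hC2 : IsProperMap Φ)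
    (L : E' ≃L[ℝ] StrongDual ℝ (pSubspace (E := E) Θ) × F) :
    ∃ h : Assoc Y ≃ₜ M, ∀ z, h z = Assoc.toM Y z := by
  have ha := hM.contMDiff_smul_val hemb.isImmersion.contMDiff
  have hopen := ha.isOpenMap_of_surjective_mfderiv
    (hG.surjective_mfderiv_smul_val hM hY hemb hC1 hC2 L)
  have hcont : Continuous (Assoc.toM Y) := Continuous.quotient_lift ha.continuous _
  have hbij := hG.bijective_toM hM hY hC1 hC2
  refine ⟨(Equiv.ofBijective _ hbij).toHomeomorphOfContinuousOpen hcont fun U hU => ?_,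
    fun z => rfl⟩
  have h1 : Assoc.toM Y '' U = (fun p : G × Y => p.1 • (p.2 : M)) '' (Assoc.mk Y ⁻¹' U) := by
    ext m
    constructor
    · rintro ⟨⟨p⟩, hp, rfl⟩
      exact ⟨p, hp, rfl⟩
    · rintro ⟨p, hp, rfl⟩
      exact ⟨Assoc.mk Y p, hp, rfl⟩
  change IsOpen (Assoc.toM Y '' U)
  rw [h1]
  exact hopen _ (hU.preimage continuous_quotient_mk')

end HamReductive.IsRealReductive

end AssociatedBundle

section DimensionCount

/-- Finite-dimensional spaces split according to their dimensions. -/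
theorem exists_equiv_prod_euclideanSpace {V W : Type*} [NormedAddCommGroup V] [NormedSpace ℝ V]
    [FiniteDimensional ℝ V] [NormedAddCommGroup W] [NormedSpace ℝ W] [FiniteDimensional ℝ W]
    {T : V →ₗ[ℝ] W} (hT : Function.Surjective T) :
    ∃ n : ℕ, Nonempty (V ≃L[ℝ] W × EuclideanSpace ℝ (Fin n)) := by
  refine ⟨Module.finrank ℝ V - Module.finrank ℝ W, ⟨ContinuousLinearEquiv.ofFinrankEq ?_⟩⟩
  have h := LinearMap.finrank_le_finrank_of_surjective hT
  rw [Module.finrank_prod, finrank_euclideanSpace_fin]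
  omega

end DimensionCount

section AssociatedBundleSubmersion

variable {E : Type*} [NormedAddCommGroup E] [NormedSpace ℝ E] [FiniteDimensional ℝ E]
  {G : Type*} [TopologicalSpace G] [ChartedSpace E G] [Group G] [IsManifold 𝓘(ℝ, E) ∞ G]
  {E' : Type*} [NormedAddCommGroup E'] [NormedSpace ℝ E'] [FiniteDimensional ℝ E']
  {M : Type*} [TopologicalSpace M] [ChartedSpace E' M] [MulAction G M]
  {F : Type*} [NormedAddCommGroup F] [NormedSpace ℝ F] [FiniteDimensional ℝ F]
  {K : Subgroup G} {Y : SubMulAction K M} [Nonempty Y] [ChartedSpace F Y] [IsManifold 𝓘(ℝ, F) ∞ Y]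
  [ChartedSpace E' (Assoc Y)] [IsManifold 𝓘(ℝ, E') ∞ (Assoc Y)]

/-- If `G ×_K Y` is identified with `M`, then the quotient map from `G × Y` inherits the properties
of the action map. -/
theorem contMDiff_assocMk_and_isSubmersion
    (ha : ContMDiff (𝓘(ℝ, E).prod 𝓘(ℝ, F)) 𝓘(ℝ, E') ∞ (fun p : G × Y => p.1 • (p.2 : M)))
    (hsurj : ∀ p, Function.Surjective (mfderiv (𝓘(ℝ, E).prod 𝓘(ℝ, F)) 𝓘(ℝ, E')
      (fun p : G × Y => p.1 • (p.2 : M)) p))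
    (D : Diffeomorph 𝓘(ℝ, E') 𝓘(ℝ, E') (Assoc Y) M ∞) (hD : ∀ z, D z = Assoc.toM Y z) :
    ContMDiff (𝓘(ℝ, E).prod 𝓘(ℝ, F)) 𝓘(ℝ, E') ∞ (Assoc.mk Y) ∧
      Manifold.IsSubmersion (𝓘(ℝ, E).prod 𝓘(ℝ, F)) 𝓘(ℝ, E') ∞ (Assoc.mk Y) := by
  have hmk : Assoc.mk Y = D.symm ∘ fun p : G × Y => p.1 • (p.2 : M) := by
    funext p
    have h : D (Assoc.mk Y p) = p.1 • (p.2 : M) := hD _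
    rw [Function.comp_apply, ← h, D.symm_apply_apply]
  have hs : ContMDiff (𝓘(ℝ, E).prod 𝓘(ℝ, F)) 𝓘(ℝ, E') ∞ (Assoc.mk Y) := by
    rw [hmk]
    exact D.symm.contMDiff.comp ha
  have hDs := D.symm.contMDiff.mdifferentiable (by simp)
  have hDd := D.contMDiff.mdifferentiable (by simp)
  have hsurj' : ∀ p, Function.Surjective
      (mfderiv (𝓘(ℝ, E).prod 𝓘(ℝ, F)) 𝓘(ℝ, E') (Assoc.mk Y) p) := by
    intro p u
    have hp : D (Assoc.mk Y p) = p.1 • (p.2 : M) := hD _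
    obtain ⟨ξ, hξ⟩ := hsurj p (mfderiv 𝓘(ℝ, E') 𝓘(ℝ, E') D (Assoc.mk Y p) u : E')
    refine ⟨ξ, ?_⟩
    have h1 := mfderiv_comp_apply (I := 𝓘(ℝ, E).prod 𝓘(ℝ, F)) p (hDs (p.1 • (p.2 : M)))
      (ha.mdifferentiable (by simp) p) ξ
    rw [← hmk] at h1
    have h2 := mfderiv_comp_apply_of_eq (x := Assoc.mk Y p) (y := p.1 • (p.2 : M)) (f := D)
      (g := D.symm) (hDs _) (hDd _) hp u
    have e : D.symm ∘ D = id := funext D.symm_apply_apply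
    rw [e, mfderiv_id] at h2
    refine h1.trans (Eq.trans ?_ h2.symm)
    exact congrArg (fun z : E' =>
      (mfderiv 𝓘(ℝ, E') 𝓘(ℝ, E') D.symm (p.1 • (p.2 : M)) z : E')) hξ
  refine ⟨hs, ?_⟩
  let p₀ : G × Y := (1, Classical.arbitrary Y)
  let T : E × F →L[ℝ] E' := mfderiv (𝓘(ℝ, E).prod 𝓘(ℝ, F)) 𝓘(ℝ, E') (Assoc.mk Y) p₀
  obtain ⟨k, ⟨L⟩⟩ := exists_equiv_prod_euclideanSpace (T := (T : E × F →ₗ[ℝ] E')) (hsurj' p₀)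
  exact hs.isSubmersion_of_surjective_mfderiv hsurj' L

end AssociatedBundleSubmersion

theorem mainTheorem9
    {EG : Type*} [NormedAddCommGroup EG] [NormedSpace ℝ EG] [FiniteDimensional ℝ EG]
    [CompleteSpace EG]
    {G : Type*} [TopologicalSpace G] [ChartedSpace EG G] [Group G] [LieGroup 𝓘(ℝ, EG) ∞ G]
    [T2Space G] [ConnectedSpace G]
    {EK : Type*} [NormedAddCommGroup EK] [NormedSpace ℝ EK] [FiniteDimensional ℝ EK]
    (K : Subgroup G) [ChartedSpace EK K] [LieGroup 𝓘(ℝ, EK) ∞ K]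
    (Θ : G →* G) (b : LinearMap.BilinForm ℝ EG)
    (hG : IsRealReductive (EK := EK) K Θ b)
    {EM : Type*} [NormedAddCommGroup EM] [NormedSpace ℝ EM] [FiniteDimensional ℝ EM]
    {M : Type*} [TopologicalSpace M] [ChartedSpace EM M] [IsManifold 𝓘(ℝ, EM) ∞ M]
    [T2Space M] [SecondCountableTopology M] [ConnectedSpace M] [MulAction G M]
    (Ω : DForm 𝓘(ℝ, EM) M 2) (Φ : M → StrongDual ℝ EG)
    (hM : IsHamiltonian G Ω Φ)
    (hC1 : ProperAction G M) (hC2 : IsProperMap Φ) :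
    -- `Y` is a `K`-invariant subset of `M`
    ∃ Y : SubMulAction K M,
      (Y : Set M) = {m | ∀ X ∈ pSubspace (E := EG) Θ, Φ m X = 0} ∧
      -- `Y` is a connected embedded submanifold
      IsConnected (Y : Set M) ∧
      ∃ (n : ℕ) (_ : ChartedSpace (EuclideanSpace ℝ (Fin n)) Y) (_ : IsManifold (𝓡 n) ∞ Y),
        Manifold.IsSmoothEmbedding (𝓡 n) 𝓘(ℝ, EM) ∞ (Subtype.val : Y → M) ∧
        -- it is a symplectic Hamiltonian `K`-manifold with proper moment map
        IsHamiltonian K (pullbackForm (𝓡 n) 𝓘(ℝ, EM) (Subtype.val : Y → M) Ω)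
          (fun y : Y => momentK (EK := EK) K Φ (y : M)) ∧
        IsProperMap (fun y : Y => momentK (EK := EK) K Φ (y : M)) ∧
        -- on `Y`, the map `Φ` takes values in `𝔨^* ⊆ 𝔤^*`, and is proper
        (∀ (y : Y) (X : EG), Φ (y : M) X = Φ (y : M) (kProj Θ X)) ∧
        IsProperMap (fun y : Y => Φ (y : M)) ∧
        -- `G ×_K Y` is a manifold, the quotient of `G × Y` by `K`
        ∃ (_ : ChartedSpace EM (Assoc Y)) (_ : IsManifold 𝓘(ℝ, EM) ∞ (Assoc Y)),
          Manifold.IsSubmersion (𝓘(ℝ, EG).prod (𝓡 n)) 𝓘(ℝ, EM) ∞ (Assoc.mk Y) ∧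
          ∃ (ΩQ : DForm 𝓘(ℝ, EM) (Assoc Y) 2) (ΦQ : Assoc Y → StrongDual ℝ EG),
            -- the induced Hamiltonian structure of `G ×_K Y`
            IsHamiltonian G ΩQ ΦQ ∧
            pullbackForm (𝓘(ℝ, EG).prod (𝓡 n)) 𝓘(ℝ, EM) (Assoc.mk Y) ΩQ =
              pullbackForm (𝓘(ℝ, EG).prod (𝓡 n)) (𝓡 n) (Prod.snd : G × Y → Y)
                (pullbackForm (𝓡 n) 𝓘(ℝ, EM) (Subtype.val : Y → M) Ω) -
              extD (𝓘(ℝ, EG).prod (𝓡 n)) (thetaForm Θ Y Φ) ∧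
            (∀ (g : G) (y : Y), ΦQ (Assoc.mk Y (g, y)) = coAd g (Φ (y : M))) ∧
            -- `π` is an isomorphism of Hamiltonian `G`-manifolds
            (∃ D : Diffeomorph 𝓘(ℝ, EM) 𝓘(ℝ, EM) (Assoc Y) M ∞,
              ∀ z, D z = Assoc.toM Y z) ∧
            (∀ (g : G) (z : Assoc Y), Assoc.toM Y (g • z) = g • Assoc.toM Y z) ∧
            pullbackForm 𝓘(ℝ, EM) 𝓘(ℝ, EM) (Assoc.toM Y) Ω = ΩQ ∧
            (∀ z, Φ (Assoc.toM Y z) = ΦQ z) := by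
  let Y : SubMulAction K M :=
    { carrier := {m | ∀ X ∈ pSubspace (E := EG) Θ, Φ m X = 0}
      smul_mem' := fun k _ hm => hG.moment_vanishes_smul hM k hm }
  have hY : ∀ m, m ∈ Y ↔ ∀ X ∈ pSubspace (E := EG) Θ, Φ m X = 0 := fun _ => Iff.rfl
  obtain ⟨m₀⟩ : Nonempty M := inferInstance
  obtain ⟨g₀, hg₀⟩ := hG.exists_smul_moment_vanishes hM hC1 hC2 m₀
  have : Nonempty Y := ⟨⟨g₀ • m₀, hg₀⟩⟩
  let T : EM →L[ℝ] StrongDual ℝ (pSubspace (E := EG) Θ) :=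
    mfderiv 𝓘(ℝ, EM) 𝓘(ℝ, StrongDual ℝ (pSubspace (E := EG) Θ)) (momentP Θ Φ) (g₀ • m₀)
  have hT : Function.Surjective (T : EM →ₗ[ℝ] StrongDual ℝ (pSubspace (E := EG) Θ)) :=
    hG.surjective_mfderiv_momentP hM hC1 hC2 hg₀
  obtain ⟨n, ⟨L⟩⟩ := exists_equiv_prod_euclideanSpace (V := EM)
    (W := StrongDual ℝ (pSubspace (E := EG) Θ)) (T := T) hT
  obtain ⟨_, _, hemb⟩ := exists_submanifold_levelSet (q := fun m => m ∈ Y) (hM.contMDiff_momentP Θ)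
    (fun m => momentP_eq_zero_iff.symm) (fun m hm => hG.surjective_mfderiv_momentP hM hC1 hC2 hm) L
  have hval := hemb.isImmersion.contMDiff
  have hk := hG.moment_kProj hY
  obtain ⟨h, hh⟩ := hG.exists_homeomorph_toM hM hY hemb hC1 hC2 L
  obtain ⟨_, _, D, hD⟩ := h.exists_chartedSpace_diffeomorph (E' := EM)
  replace hD : ∀ z, D z = Assoc.toM Y z := fun z => (hD z).trans (hh z)
  have hDM : (D : Assoc Y → M) = Assoc.toM Y := funext hD
  have hequiv : ∀ (g : G) (z : Assoc Y), Assoc.toM Y (g • z) = g • Assoc.toM Y z := by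
    rintro g ⟨p⟩
    exact mul_smul g p.1 (p.2 : M)
  have : ConnectedSpace (Assoc Y) := h.symm.surjective.connectedSpace h.symm.continuous
  have hQ := hM.pullback_diffeomorph D fun g z => by rw [hD, hD, hequiv]
  rw [hDM] at hQ
  obtain ⟨hmk, hsub⟩ := contMDiff_assocMk_and_isSubmersion (hM.contMDiff_smul_val hval)
    (hG.surjective_mfderiv_smul_val hM hY hemb hC1 hC2 L) D hD
  have hpull : pullbackForm (𝓘(ℝ, EG).prod (𝓡 n)) 𝓘(ℝ, EM) (Assoc.mk Y)
      (pullbackForm 𝓘(ℝ, EM) 𝓘(ℝ, EM) (Assoc.toM Y) Ω) =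
      pullbackForm (𝓘(ℝ, EG).prod (𝓡 n)) 𝓘(ℝ, EM) (fun p : G × Y => p.1 • (p.2 : M)) Ω := by
    funext p
    rw [← pullbackForm_comp_apply Ω (hDM ▸ D.contMDiff.mdifferentiable (by simp) _)
      (hmk.mdifferentiable (by simp) p)]
    rfl
  exact ⟨Y, rfl, hG.isConnected_of_connectedSpace_assoc hM, n, inferInstance, inferInstance, hemb,
    hM.isHamiltonian_momentK hG.embedding_K.isImmersion.contMDiff hemb
      (hG.isSymplecticForm_pullback_val hM hY hemb hC1 hC2 L),
    hG.isProperMap_momentK hY hC2, hk, IsRealReductive.isProperMap_moment_zeroSet hY hC2,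
    inferInstance, inferInstance, hsub, _, _, hQ,
    hpull.trans (hM.pullbackForm_smul_val hval hk),
    fun g y => hM.equivariant g (y : M), ⟨D, hD⟩, hequiv, rfl, fun z => rfl⟩
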